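/- Let $X$ and $Y$ be convex polygons in the plane (with non-empty interior), each given by the array of its vertices in counterclockwise order; the complexity of a polygon is its number of vertices, and $n$ is the total complexity of $X$ and $Y$. Write $\mu(t)=\operatorname{area}(X\cap(t+Y))$ for $t\in\mathbb{R}^2$ and $\mu_{\max}=\max_{t\in\mathbb{R}^2}\mu(t)$. For $\varepsilon\in(0,1)$, a function $f:\mathbb{R}^2\to\mathbb{R}$ is an $(\varepsilon,\nu,\rho)$-approximation of $\mu$ if (A) $|\mu(t)-f(t)|\le\varepsilon\,\mu_{\max}$ for all $t\in\mathbb{R}^2$, and (B) there are convex polygons $P_1,\dots,P_\nu$, each of complexity at most $\rho$, such that on every face of their arrangement (every connected component of $\mathbb{R}^2\setminus\bigcup_i\partial P_i$) $f$ coincides with a single polynomial of degree at most two. Lemma. There are an absolute constant $C$ and an algorithm on the real RAM (exact real arithmetic $+,-,\times,/$ and comparisons at unit cost, rational constants, indirect addressing) that, given any such $X$, $Y$ and any $\varepsilon\in(0,1)$, constructs within $Cn/\varepsilon^2$ steps an $(\varepsilon,\nu,\rho)$-approximation $f$ of $\mu$ with $\nu\le C/\varepsilon^2$ and $\rho\le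 Cn/\varepsilon^2$. Here constructing $f$ means writing out the vertex lists of polygons $P_1,\dots,P_\nu$ as in (B), together with the coefficients of a polynomial $q_i$ of degree at most two for each $P_i$, such that $f(t)=\sum_{i:\,t\in P_i}q_i(t)$ for all $t$, each $P_i$ being taken as a closed region. -/

import Mathlib

/-! ## Convex polygons in the plane and the overlap function -/

/-- Twice the signed area of the triangle `p q r`; positive iff `p, q, r` is a left turn. -/
def orient (p q r : ℝ × ℝ) : ℝ :=
  (q.1 - p.1) * (r.2 - p.2) - (q.2 - p.2) * (r.1 - p.1)

/-- A convex polygon given by its (at least three) vertices in counterclockwise order: every three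
vertices, taken in the order of the list, make a strict left turn. -/
structure ConvexPolygon where
  /-- the number of vertices, that is, the complexity of the polygon -/
  size : ℕ
  three_le : 3 ≤ size
  vertex : Fin size → ℝ × ℝ
  ccw : ∀ i j k, i < j → j < k → 0 < orient (vertex i) (vertex j) (vertex k)

/-- The closed region that the polygon bounds. -/
def ConvexPolygon.region (P : ConvexPolygon) : Set (ℝ × ℝ) :=
  convexHull ℝ (Set.range P.vertex)

/-- The overlap function `t ↦ area (X ∩ (t + Y))`. -/
noncomputable def overlap (X Y : ConvexPolygon) (t : ℝ × ℝ) : ℝ :=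
  (MeasureTheory.volume (X.region ∩ (fun p => t + p) '' Y.region)).toReal

/-- The maximal area of overlap under translation. -/
noncomputable def maxOverlap (X Y : ConvexPolygon) : ℝ :=
  ⨆ t : ℝ × ℝ, overlap X Y t

/-- A polynomial of degree at most two in two real variables, by its coefficients. -/
structure Quadratic where
  xx : ℝ
  xy : ℝ
  yy : ℝ
  x : ℝ
  y : ℝ
  c : ℝ

def Quadratic.eval (q : Quadratic) (t : ℝ × ℝ) : ℝ :=
  q.xx * t.1 ^ 2 + q.xy * (t.1 * t.2) + q.yy * t.2 ^ 2 + q.x * t.1 + q.y * t.2 + q.c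

/-- The faces of the arrangement of the polygons `P i`: the connected components of the plane minus
all the polygon boundaries. -/
def IsFace {ν : ℕ} (P : Fin ν → ConvexPolygon) (F : Set (ℝ × ℝ)) : Prop :=
  ∃ t ∈ (⋃ i, frontier (P i).region)ᶜ, F = connectedComponentIn (⋃ i, frontier (P i).region)ᶜ t

/-- `f` is an `(ε, ν, ρ)`-approximation of the overlap function of `X` and `Y`, where the convex
polygons required for the second condition are `P 0, …, P (ν - 1)`. -/
structure IsApproximation (X Y : ConvexPolygon) (ε : ℝ) (ν ρ : ℕ)
    (P : Fin ν → ConvexPolygon) (f : ℝ × ℝ → ℝ) : Prop where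
  error_le : ∀ t, |overlap X Y t - f t| ≤ ε * maxOverlap X Y
  size_le : ∀ i, (P i).size ≤ ρ
  quadratic_on_faces : ∀ F, IsFace P F → ∃ q : Quadratic, ∀ t ∈ F, f t = q.eval t

/-- The explicit description by which a piecewise quadratic function is handed over: finitely many
convex polygons, each with a quadratic function. -/
structure PiecewiseQuadratic where
  count : ℕ
  polygon : Fin count → ConvexPolygon
  weight : Fin count → Quadratic

/-- The function described: at `t`, the sum of the quadratics of all the polygons that contain `t`.
On each face of the arrangement of the polygons the set of these polygons is fixed. -/
noncomputable def PiecewiseQuadratic.eval (ψ : PiecewiseQuadratic) (t : ℝ × ℝ) : ℝ :=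
  ∑ i, (ψ.polygon i).region.indicator (ψ.weight i).eval t

/-! ## The real RAM

Structured programs over two sorts of unbounded memory, natural numbers (for addressing and
counting) and exact real numbers. The memory of each sort is divided into arrays; a program, being
a finite text, names only finitely many of them. A scalar variable is entry `0` of an array. -/

namespace RealRAM

/-- `nat a i` and `real a i` are the `i`-th entries of the `a`-th array of either sort. -/
structure Memory where
  nat : ℕ → ℕ → ℕ
  real : ℕ → ℕ → ℝ

/-- Expressions for natural numbers: `get a e` reads the array `a` at the computed address `e`,
and `sub` is truncated subtraction. -/
inductive NExpr where
  | lit (n : ℕ)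
  | get (a : ℕ) (e : NExpr)
  | add (e f : NExpr)
  | sub (e f : NExpr)

def NExpr.eval (m : Memory) : NExpr → ℕ
  | .lit n => n
  | .get a e => m.nat a (e.eval m)
  | .add e f => e.eval m + f.eval m
  | .sub e f => e.eval m - f.eval m

/-- The number of elementary operations in the evaluation of the expression. -/
def NExpr.cost : NExpr → ℕ
  | .lit _ => 1
  | .get _ e => e.cost + 1
  | .add e f => e.cost + f.cost + 1
  | .sub e f => e.cost + f.cost + 1

/-- Expressions for real numbers, from rational constants and memory contents by the four
arithmetic operations. There is no rounding and there are no roots. -/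
inductive RExpr where
  | lit (r : ℚ)
  | get (a : ℕ) (e : NExpr)
  | add (e f : RExpr)
  | sub (e f : RExpr)
  | mul (e f : RExpr)
  | div (e f : RExpr)

noncomputable def RExpr.eval (m : Memory) : RExpr → ℝ
  | .lit r => (r : ℝ)
  | .get a e => m.real a (e.eval m)
  | .add e f => e.eval m + f.eval m
  | .sub e f => e.eval m - f.eval m
  | .mul e f => e.eval m * f.eval m
  | .div e f => e.eval m / f.eval m

def RExpr.cost : RExpr → ℕ
  | .lit _ => 1
  | .get _ e => e.cost + 1
  | .add e f => e.cost + f.cost + 1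
  | .sub e f => e.cost + f.cost + 1
  | .mul e f => e.cost + f.cost + 1
  | .div e f => e.cost + f.cost + 1

/-- Tests: comparisons of natural numbers, comparisons of real numbers, Boolean combinations. -/
inductive Test where
  | nlt (e f : NExpr)
  | rlt (e f : RExpr)
  | neg (b : Test)
  | conj (b c : Test)

def Test.Holds (m : Memory) : Test → Prop
  | .nlt e f => e.eval m < f.eval m
  | .rlt e f => e.eval m < f.eval m
  | .neg b => ¬ b.Holds m
  | .conj b c => b.Holds m ∧ c.Holds m

def Test.cost : Test → ℕ
  | .nlt e f => e.cost + f.cost + 1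
  | .rlt e f => e.cost + f.cost + 1
  | .neg b => b.cost + 1
  | .conj b c => b.cost + c.cost + 1

def Memory.setNat (m : Memory) (a i v : ℕ) : Memory :=
  { m with nat := Function.update m.nat a (Function.update (m.nat a) i v) }

noncomputable def Memory.setReal (m : Memory) (a i : ℕ) (v : ℝ) : Memory :=
  { m with real := Function.update m.real a (Function.update (m.real a) i v) }

/-- Programs: assignment to an array entry of either sort, sequential composition, conditional,
and while-loop. -/
inductive Program where
  | skip
  | nset (a : ℕ) (i e : NExpr)
  | rset (a : ℕ) (i : NExpr) (e : RExpr)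
  | seq (p q : Program)
  | cond (b : Test) (p q : Program)
  | loop (b : Test) (p : Program)

/-- `Runs p m T m'`: started in memory `m`, the program `p` halts in memory `m'` after exactly `T`
elementary steps. -/
inductive Runs : Program → Memory → ℕ → Memory → Prop where
  | skip (m : Memory) : Runs .skip m 1 m
  | nset (a : ℕ) (i e : NExpr) (m : Memory) :
      Runs (.nset a i e) m (i.cost + e.cost + 1) (m.setNat a (i.eval m) (e.eval m))
  | rset (a : ℕ) (i : NExpr) (e : RExpr) (m : Memory) :
      Runs (.rset a i e) m (i.cost + e.cost + 1) (m.setReal a (i.eval m) (e.eval m))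
  | seq {p q : Program} {m₁ m₂ m₃ : Memory} {T S : ℕ} :
      Runs p m₁ T m₂ → Runs q m₂ S m₃ → Runs (.seq p q) m₁ (T + S) m₃
  | cond_true {b : Test} {p q : Program} {m m' : Memory} {T : ℕ} :
      b.Holds m → Runs p m T m' → Runs (.cond b p q) m (b.cost + T) m'
  | cond_false {b : Test} {p q : Program} {m m' : Memory} {T : ℕ} :
      ¬ b.Holds m → Runs q m T m' → Runs (.cond b p q) m (b.cost + T) m'
  | loop_done {b : Test} {p : Program} {m : Memory} :
      ¬ b.Holds m → Runs (.loop b p) m b.cost m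
  | loop_step {b : Test} {p : Program} {m₁ m₂ m₃ : Memory} {T S : ℕ} :
      b.Holds m₁ → Runs p m₁ T m₂ → Runs (.loop b p) m₂ S m₃ →
        Runs (.loop b p) m₁ (b.cost + T + S) m₃

/-- The memory at the start: the two numbers of vertices (natural arrays 0 and 1), `ε` (real
array 0), the two coordinate lists of `X` (real arrays 1 and 2) and of `Y` (real arrays 3 and 4),
and zeros elsewhere. -/
noncomputable def input (X Y : ConvexPolygon) (ε : ℝ) : Memory where
  nat := fun a i =>
    match a, i with
    | 0, 0 => X.size
    | 1, 0 => Y.size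
    | _, _ => 0
  real := fun a i =>
    match a with
    | 0 => if i = 0 then ε else 0
    | 1 => if h : i < X.size then (X.vertex ⟨i, h⟩).1 else 0
    | 2 => if h : i < X.size then (X.vertex ⟨i, h⟩).2 else 0
    | 3 => if h : i < Y.size then (Y.vertex ⟨i, h⟩).1 else 0
    | 4 => if h : i < Y.size then (Y.vertex ⟨i, h⟩).2 else 0
    | _ => 0

/-- The memory holds the description `ψ`: the number of polygons (natural array 2), their numbers
of vertices (natural array 3), the coordinates of the vertices of all the polygons, one polygon
after the other (real arrays 5 and 6), and the six coefficients belonging to each polygon (real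
arrays 7 to 12). -/
def HoldsOutput (m : Memory) (ψ : PiecewiseQuadratic) : Prop :=
  m.nat 2 0 = ψ.count ∧
  ∀ i : Fin ψ.count,
    m.nat 3 i = (ψ.polygon i).size ∧
    (∀ j : Fin (ψ.polygon i).size,
      m.real 5 ((∑ k ∈ Finset.Iio i, (ψ.polygon k).size) + j) = ((ψ.polygon i).vertex j).1 ∧
      m.real 6 ((∑ k ∈ Finset.Iio i, (ψ.polygon k).size) + j) = ((ψ.polygon i).vertex j).2) ∧
    m.real 7 i = (ψ.weight i).xx ∧
    m.real 8 i = (ψ.weight i).xy ∧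
    m.real 9 i = (ψ.weight i).yy ∧
    m.real 10 i = (ψ.weight i).x ∧
    m.real 11 i = (ψ.weight i).y ∧
    m.real 12 i = (ψ.weight i).c

end RealRAM

/-! ## Geometry of convex polygons -/

/-! Suppose that linear coordinates `α`, `β` of determinant `d > 0` are such that every intersection
`X ∩ (t + Y)` lies in a unit square (whose position may depend on `t`), and that the maximal overlap
is at least `1 / (64 d)`. The area of a convex subset of a unit square is, up to `2 / N`, the
proportion of the `N ^ 2` grid midpoints that it contains (`abs_area_sub_sample_le`). Counting grid
points therefore gives the overlap up to `2 / (N d)`, which is at most `128 / N` times the maximal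
overlap, and `N = ⌈128 / ε⌉` suffices. The approximation is the count times `1 / (N ^ 2 d)`, so all
the quadratics are constants.

For each grid point, the translations for which it is counted must form a convex polygon. If both
grid coordinates are anchored to `A` (mode `0`), the point `p` is fixed, and the translations are `p
- B` if `p` lies in `A`, and none otherwise. If `α` is anchored to `A` while `β` moves along with
`B` (mode `1`), then membership in `A` restricts only `β t` and membership in the translate of `B`
only `α t`, each to an interval; the result is a parallelogram.

To find the coordinates, exchange the polygons if necessary (this replaces `t` by `-t`), so that `A`
has the smaller horizontal extent `a`. The chord from the leftmost to the rightmost vertex of each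
polygon gives a functional constant along the chord, scaled to width `1` on the polygon: `γ` for `A`
and `γ'` for `B`. A triangle over the chord contains a box of comparable size
(`ConvexPolygon.exists_box`), so both polygons contain translates of `|x| / a, |γ|, |γ'| ≤ 1 / 8`.
Of the functionals `x / a`, `γ`, `γ'` choose the two with the largest determinant. By Cramer's rule
the third is a combination of them with coefficients in `[-1, 1]`, so `|α|, |β| ≤ 1 / 16`, of area
`1 / (64 d)`, already fits into both polygons. The first of the chosen functionals has width `1` on
`A`, the second on `A` or on `B`: these are the two modes.

Preparation takes time `O(n + 1 / ε)`, and every one of the `N ^ 2` grid points takes time `O(n)`.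
The program is verified by total correctness statements with step bounds (`RealRAM.Ex`) and a
syntactic frame rule (`RealRAM.Runs.keeps`). -/

/-- The value at `p` of the linear functional with coefficients `α`. -/
def dot (α p : ℝ × ℝ) : ℝ := α.1 * p.1 + α.2 * p.2

/-- The determinant of two linear functionals. -/
def cross (α β : ℝ × ℝ) : ℝ := α.1 * β.2 - α.2 * β.1

/-- The linear map with the coordinate functionals `α` and `β`. -/
def coords (α β p : ℝ × ℝ) : ℝ × ℝ := (dot α p, dot β p)

/-- The inverse of `coords α β`. -/
noncomputable def uncoords (α β z : ℝ × ℝ) : ℝ × ℝ :=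
  ((β.2 * z.1 - α.2 * z.2) / cross α β, (α.1 * z.2 - β.1 * z.1) / cross α β)

theorem coords_uncoords {α β : ℝ × ℝ} (h : 0 < cross α β) (z : ℝ × ℝ) :
    coords α β (uncoords α β z) = z := by
  have h' := h.ne'
  ext
  · simp only [coords, uncoords, dot]; field_simp; simp only [cross]; ring
  · simp only [coords, uncoords, dot]; field_simp; simp only [cross]; ring

theorem uncoords_coords {α β : ℝ × ℝ} (h : 0 < cross α β) (p : ℝ × ℝ) :
    uncoords α β (coords α β p) = p := by
  have h' := h.ne'
  ext
  · simp only [coords, uncoords, dot]; field_simp; simp only [cross]; ring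
  · simp only [coords, uncoords, dot]; field_simp; simp only [cross]; ring

theorem orient_coords (α β p q r : ℝ × ℝ) :
    orient (coords α β p) (coords α β q) (coords α β r) = cross α β * orient p q r := by
  simp only [orient, coords, dot, cross]; ring

theorem orient_rotate (p q r : ℝ × ℝ) : orient q r p = orient p q r := by
  simp only [orient]; ring

theorem convex_halfPlane (a b : ℝ × ℝ) : Convex ℝ {p | 0 ≤ orient a b p} := by
  intro x hx y hy s t hs ht hst
  simp only [Set.mem_ofPred_eq] at *
  have : orient a b (s • x + t • y) = s * orient a b x + t * orient a b y := by
    obtain rfl : s = 1 - t := by linarith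
    simp only [orient, Prod.fst_add, Prod.snd_add, Prod.smul_fst, Prod.smul_snd, smul_eq_mul]
    ring
  rw [this]; positivity

theorem Convex.mem_of_barycentric {S : Set (ℝ × ℝ)} (hS : Convex ℝ S) {x y z u : ℝ × ℝ}
    (hx : x ∈ S) (hy : y ∈ S) (hz : z ∈ S) {a b c : ℝ} (ha : 0 ≤ a) (hb : 0 ≤ b) (hc : 0 ≤ c)
    (h : a + b + c = 1) (h1 : u.1 = a * x.1 + b * y.1 + c * z.1)
    (h2 : u.2 = a * x.2 + b * y.2 + c * z.2) : u ∈ S := by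
  have key := hS.sum_mem (t := Finset.univ) (w := ![a, b, c]) (z := ![x, y, z])
    (by intro i _; fin_cases i <;> simpa) (by simp [Fin.sum_univ_three, h])
    (by intro i _; fin_cases i <;> simpa)
  convert key using 1
  ext <;> simp [Fin.sum_univ_three, h1, h2]

/-! ### Half-plane description, images, vertical slices and inscribed boxes of polygons. -/

namespace ConvexPolygon

theorem size_pos (P : ConvexPolygon) : 0 < P.size := by have := P.three_le; omega

/-- The vertices, followed by the first vertex once more. -/
def cyc (P : ConvexPolygon) (i : ℕ) : ℝ × ℝ :=
  if h : i < P.size then P.vertex ⟨i, h⟩ else P.vertex ⟨0, P.size_pos⟩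

theorem cyc_of_lt (P : ConvexPolygon) {i : ℕ} (h : i < P.size) : P.cyc i = P.vertex ⟨i, h⟩ :=
  dif_pos h

theorem cyc_size (P : ConvexPolygon) : P.cyc P.size = P.cyc 0 := by
  simp [cyc, P.size_pos]

theorem cyc_ccw (P : ConvexPolygon) {i j k : ℕ} (hij : i < j) (hjk : j < k) (hk : k < P.size) :
    0 < orient (P.cyc i) (P.cyc j) (P.cyc k) := by
  rw [P.cyc_of_lt hk, P.cyc_of_lt (hjk.trans hk), P.cyc_of_lt (hij.trans (hjk.trans hk))]
  exact P.ccw _ _ _ hij hjk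

theorem vertex_mem (P : ConvexPolygon) (i : Fin P.size) : P.vertex i ∈ P.region :=
  subset_convexHull ℝ _ ⟨i, rfl⟩

theorem cyc_mem (P : ConvexPolygon) (i : ℕ) : P.cyc i ∈ P.region := by
  unfold cyc; split <;> exact P.vertex_mem _

theorem convex_region (P : ConvexPolygon) : Convex ℝ P.region := convex_convexHull ℝ _

theorem isCompact_region (P : ConvexPolygon) : IsCompact P.region :=
  Set.Finite.isCompact_convexHull ℝ (Set.finite_range _)

theorem region_subset {P : ConvexPolygon} {S : Set (ℝ × ℝ)} (hS : Convex ℝ S)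
    (h : ∀ i < P.size, P.cyc i ∈ S) : P.region ⊆ S := by
  refine convexHull_min ?_ hS
  rintro _ ⟨i, rfl⟩
  have := h i i.2
  rwa [P.cyc_of_lt i.2] at this

/-- The cyclic invariance of `orient` reduces every position of `k` relative to the edge, including
the closing edge back to vertex `0`, to an increasing triple of indices. -/
theorem edge_nonneg (P : ConvexPolygon) {i k : ℕ} (hi : i < P.size) (hk : k < P.size) :
    0 ≤ orient (P.cyc i) (P.cyc (i + 1)) (P.cyc k) := by
  have hself : ∀ a b : ℝ × ℝ, orient a b a = 0 ∧ orient a b b = 0 := by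
    intro a b; simp only [orient]; constructor <;> ring
  rcases eq_or_ne k i with rfl | hki
  · exact (hself _ _).1.ge
  rcases Nat.lt_or_ge (i + 1) P.size with h1 | h1
  · rcases eq_or_ne k (i + 1) with rfl | hki'
    · exact (hself _ _).2.ge
    rcases lt_or_gt_of_ne hki with h | h
    · rw [orient_rotate]; exact (P.cyc_ccw h (Nat.lt_succ_self i) h1).le
    · exact (P.cyc_ccw (Nat.lt_succ_self i) (by omega) hk).le
  · have : i + 1 = P.size := by omega
    rw [this, P.cyc_size]
    rcases eq_or_ne k 0 with rfl | h0
    · exact (hself _ _).2.ge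
    · rw [← orient_rotate]; exact (P.cyc_ccw (by omega) (by omega) hi).le

/-- A convex polygon is the intersection of the half-planes to the left of its edges. -/
theorem mem_region_iff (P : ConvexPolygon) (p : ℝ × ℝ) :
    p ∈ P.region ↔ ∀ i < P.size, 0 ≤ orient (P.cyc i) (P.cyc (i + 1)) p := by
  refine ⟨fun hp i hi => region_subset (convex_halfPlane _ _)
    (fun k hk => P.edge_nonneg hi hk) hp, fun h => ?_⟩
  have h3 := P.three_le
  have hlast : orient (P.cyc 0) (P.cyc (P.size - 1)) p ≤ 0 := by
    have := h (P.size - 1) (by omega)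
    rw [Nat.sub_add_cancel (by omega), P.cyc_size] at this
    have e : orient (P.cyc 0) (P.cyc (P.size - 1)) p =
      -orient (P.cyc (P.size - 1)) (P.cyc 0) p := by simp only [orient]; ring
    linarith
  -- Fan triangulation from vertex `0`: for the first `j ≥ 2` whose diagonal has `p` on its right or
  -- on it, `p` lies in the triangle with vertices `0`, `j - 1`, `j`.
  have hex : ∃ j, 2 ≤ j ∧ orient (P.cyc 0) (P.cyc j) p ≤ 0 := ⟨P.size - 1, by omega, hlast⟩
  classical
  obtain ⟨hj2, hj⟩ := Nat.find_spec hex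
  have hmin := fun k => @Nat.find_min _ _ hex k
  have hjn : Nat.find hex ≤ P.size - 1 := Nat.find_min' hex ⟨by omega, hlast⟩
  generalize Nat.find hex = j at *
  obtain ⟨i, rfl⟩ : ∃ i, j = i + 1 := ⟨j - 1, by omega⟩
  have hi : 0 ≤ orient (P.cyc 0) (P.cyc i) p := by
    rcases eq_or_ne i 1 with rfl | hi1
    · exact h 0 P.size_pos
    · by_contra hneg
      exact hmin i (by omega) ⟨by omega, by linarith⟩
  have he := h i (by omega)
  have hD := P.cyc_ccw (show 0 < i by omega) (Nat.lt_succ_self i) (by omega)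
  refine P.convex_region.mem_of_barycentric (P.cyc_mem 0) (P.cyc_mem i) (P.cyc_mem (i + 1))
    (a := orient (P.cyc i) (P.cyc (i + 1)) p / orient (P.cyc 0) (P.cyc i) (P.cyc (i + 1)))
    (b := -orient (P.cyc 0) (P.cyc (i + 1)) p / orient (P.cyc 0) (P.cyc i) (P.cyc (i + 1)))
    (c := orient (P.cyc 0) (P.cyc i) p / orient (P.cyc 0) (P.cyc i) (P.cyc (i + 1)))
    (div_nonneg he hD.le) (div_nonneg (by linarith) hD.le) (div_nonneg hi hD.le) ?_ ?_ ?_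
  all_goals
    have hD' := hD.ne'
    field_simp
    simp only [orient]
    ring

/-- The image of a polygon under an orientation preserving linear map. -/
def map (P : ConvexPolygon) (α β : ℝ × ℝ) (h : 0 < cross α β) : ConvexPolygon where
  size := P.size
  three_le := P.three_le
  vertex i := coords α β (P.vertex i)
  ccw i j k hij hjk := by
    rw [orient_coords]; exact mul_pos h (P.ccw i j k hij hjk)

theorem cyc_map (P : ConvexPolygon) {α β : ℝ × ℝ} (h : 0 < cross α β) (i : ℕ) :
    (P.map α β h).cyc i = coords α β (P.cyc i) := by
  by_cases hi : i < P.size <;> simp [cyc, map, hi]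

/-- A linear map multiplies every `orient` by its positive determinant, so the half-plane conditions
are unchanged. -/
theorem coords_mem_map (P : ConvexPolygon) {α β : ℝ × ℝ} (h : 0 < cross α β) (p : ℝ × ℝ) :
    coords α β p ∈ (P.map α β h).region ↔ p ∈ P.region := by
  simp only [mem_region_iff, cyc_map, orient_coords, mul_nonneg_iff_of_pos_left h]
  rfl

/-- The polygon `p - P`. -/
def reflect (P : ConvexPolygon) (p : ℝ × ℝ) : ConvexPolygon where
  size := P.size
  three_le := P.three_le
  vertex i := p - P.vertex i
  ccw i j k hij hjk := by
    have := P.ccw i j k hij hjk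
    simp only [orient, Prod.fst_sub, Prod.snd_sub] at *
    linarith

theorem mem_reflect (P : ConvexPolygon) (p q : ℝ × ℝ) :
    q ∈ (P.reflect p).region ↔ p - q ∈ P.region := by
  have hc : ∀ i, (P.reflect p).cyc i = p - P.cyc i := by
    intro i; by_cases hi : i < P.size <;> simp [cyc, reflect, hi]
  have ho : ∀ a b : ℝ × ℝ, orient (p - a) (p - b) q = orient a b (p - q) := by
    intro a b; simp only [orient, Prod.fst_sub, Prod.snd_sub]; ring
  simp only [mem_region_iff, hc, ho]
  rfl

/-- The axis-parallel rectangle `[x₀, x₁] × [y₀, y₁]`. -/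
def rect (x₀ x₁ y₀ y₁ : ℝ) (hx : x₀ < x₁) (hy : y₀ < y₁) : ConvexPolygon where
  size := 4
  three_le := by norm_num
  vertex := ![(x₀, y₀), (x₁, y₀), (x₁, y₁), (x₀, y₁)]
  ccw i j k hij hjk := by
    have h := mul_pos (sub_pos.2 hx) (sub_pos.2 hy)
    fin_cases i <;> fin_cases j <;> fin_cases k <;>
      first
        | (exfalso; revert hij hjk; decide)
        | (simp [orient] at h ⊢; nlinarith)

theorem mem_rect {x₀ x₁ y₀ y₁ : ℝ} (hx : x₀ < x₁) (hy : y₀ < y₁) (p : ℝ × ℝ) :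
    p ∈ (rect x₀ x₁ y₀ y₁ hx hy).region ↔ (x₀ ≤ p.1 ∧ p.1 ≤ x₁) ∧ (y₀ ≤ p.2 ∧ p.2 ≤ y₁) := by
  have hx' := sub_pos.2 hx
  have hy' := sub_pos.2 hy
  have h : ∀ Q : ℕ → Prop, (∀ i < (rect x₀ x₁ y₀ y₁ hx hy).size, Q i) ↔
      Q 0 ∧ Q 1 ∧ Q 2 ∧ Q 3 := by
    intro Q
    refine ⟨fun h => ⟨h 0 ?_, h 1 ?_, h 2 ?_, h 3 ?_⟩, ?_⟩
    iterate 4 simp [rect]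
    rintro ⟨h0, h1, h2, h3⟩ i hi
    simp only [rect] at hi
    interval_cases i <;> assumption
  have e0 : orient (x₀, y₀) (x₁, y₀) p = (x₁ - x₀) * (p.2 - y₀) := by simp only [orient]; ring
  have e1 : orient (x₁, y₀) (x₁, y₁) p = (y₁ - y₀) * (x₁ - p.1) := by simp only [orient]; ring
  have e2 : orient (x₁, y₁) (x₀, y₁) p = (x₁ - x₀) * (y₁ - p.2) := by simp only [orient]; ring
  have e3 : orient (x₀, y₁) (x₀, y₀) p = (y₁ - y₀) * (p.1 - x₀) := by simp only [orient]; ring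
  rw [mem_region_iff, h]
  change 0 ≤ orient (x₀, y₀) (x₁, y₀) p ∧ 0 ≤ orient (x₁, y₀) (x₁, y₁) p ∧
    0 ≤ orient (x₁, y₁) (x₀, y₁) p ∧ 0 ≤ orient (x₀, y₁) (x₀, y₀) p ↔ _
  rw [e0, e1, e2, e3]
  simp only [mul_nonneg_iff_of_pos_left hx', mul_nonneg_iff_of_pos_left hy', sub_nonneg]
  tauto

/-- The vertical line at `a` meets the polygon in the points that are compatible with all the
non-vertical edges. -/
theorem mem_vertical_iff (P : ConvexPolygon) {a : ℝ} {u v : ℝ × ℝ} (hu : u ∈ P.region)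
    (hv : v ∈ P.region) (hua : u.1 ≤ a) (hav : a ≤ v.1) (b : ℝ) :
    (a, b) ∈ P.region ↔ ∀ i < P.size,
      ((P.cyc i).1 < (P.cyc (i + 1)).1 →
        (P.cyc i).2 + ((P.cyc (i + 1)).2 - (P.cyc i).2) * (a - (P.cyc i).1) /
          ((P.cyc (i + 1)).1 - (P.cyc i).1) ≤ b) ∧
      ((P.cyc (i + 1)).1 < (P.cyc i).1 →
        b ≤ (P.cyc i).2 + ((P.cyc (i + 1)).2 - (P.cyc i).2) * (a - (P.cyc i).1) /
          ((P.cyc (i + 1)).1 - (P.cyc i).1)) := by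
  rw [mem_region_iff]
  rw [mem_region_iff] at hu hv
  refine forall₂_congr fun i hi => ?_
  have hu := hu i hi
  have hv := hv i hi
  generalize P.cyc i = p at *
  generalize P.cyc (i + 1) = q at *
  rcases lt_trichotomy p.1 q.1 with h | h | h
  · simp only [h, h.not_gt, false_imp_iff, and_true, true_imp_iff]
    have h' := sub_pos.2 h
    rw [← le_sub_iff_add_le', div_le_iff₀ h', orient]
    constructor <;> intro _ <;> linarith
  -- A vertical edge imposes no condition: its inequality involves the abscissa only and holds at
  -- `u` and `v`, between whose abscissas `a` lies.
  · simp only [h, lt_irrefl, false_imp_iff, and_true, iff_true]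
    simp only [orient, h, sub_self, zero_mul, zero_sub] at *
    rcases le_total (q.2 - p.2) 0 with h0 | h0
    · nlinarith
    · nlinarith
  · simp only [h, h.not_gt, false_imp_iff, true_and, true_imp_iff]
    have h' := sub_pos.2 h
    rw [← sub_le_iff_le_add', ← neg_div_neg_eq, le_div_iff₀ (by linarith), orient]
    constructor <;> intro _ <;> linarith

theorem orient_ne_zero (P : ConvexPolygon) {i j k : Fin P.size} (hij : i ≠ j) (hik : i ≠ k)
    (hjk : j ≠ k) : orient (P.vertex i) (P.vertex j) (P.vertex k) ≠ 0 := by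
  have hs : ∀ p q r : ℝ × ℝ, orient p r q = -orient p q r := by
    intros; simp only [orient]; ring
  have key : ∀ {i j k : Fin P.size}, i < j → i < k → j ≠ k →
      orient (P.vertex i) (P.vertex j) (P.vertex k) ≠ 0 := by
    intro i j k h1 h2 h3
    rcases lt_or_gt_of_ne h3 with h | h
    · exact (P.ccw _ _ _ h1 h).ne'
    · rw [hs]; exact (neg_neg_of_pos (P.ccw _ _ _ h2 h)).ne
  rcases lt_or_gt_of_ne hij with h1 | h1
  · rcases lt_or_gt_of_ne hik with h2 | h2
    · exact key h1 h2 hjk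
    · rw [← orient_rotate, ← orient_rotate, orient_rotate, ← orient_rotate]
      exact key h2 (h2.trans h1) hij
  · rcases lt_or_gt_of_ne hjk with h2 | h2
    · rw [← orient_rotate]; exact key h2 h1 hik.symm
    · rw [← orient_rotate, ← orient_rotate]; exact key (h2.trans h1) h2 hij

theorem exists_third (P : ConvexPolygon) (i j : Fin P.size) : ∃ k, i ≠ k ∧ j ≠ k := by
  have h3 := P.three_le
  obtain ⟨k, hk⟩ : ∃ k, k ∉ ({i, j} : Finset (Fin P.size)) := by
    by_contra! h
    have := Finset.card_le_card (fun x _ => h x : Finset.univ ⊆ ({i, j} : Finset (Fin P.size)))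
    have h2 := Finset.card_le_two (a := i) (b := j)
    simp at this; omega
  simp only [Finset.mem_insert, Finset.mem_singleton, not_or] at hk
  exact ⟨k, Ne.symm hk.1, Ne.symm hk.2⟩

theorem segment_mem (P : ConvexPolygon) {u v : ℝ × ℝ} (hu : u ∈ P.region) (hv : v ∈ P.region)
    {a : ℝ} (h1 : u.1 ≤ a) (h2 : a < v.1) :
    (a, u.2 + (v.2 - u.2) * (a - u.1) / (v.1 - u.1)) ∈ P.region := by
  have h : 0 < v.1 - u.1 := by linarith
  refine P.convex_region.mem_of_barycentric hu hv hv (a := (v.1 - a) / (v.1 - u.1))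
    (b := (a - u.1) / (v.1 - u.1)) (c := 0) (div_nonneg (by linarith) h.le)
    (div_nonneg (by linarith) h.le) le_rfl ?_ ?_ ?_
  all_goals field_simp; try ring

/-- A vertical line strictly between two vertices meets the polygon in a non-degenerate segment. -/
theorem exists_ne_mem_vertical (P : ConvexPolygon) {a : ℝ} {i j : Fin P.size}
    (hi : (P.vertex i).1 < a) (hj : a < (P.vertex j).1) :
    ∃ b b', b ≠ b' ∧ (a, b) ∈ P.region ∧ (a, b') ∈ P.region := by
  -- A third vertex is off the line through the two given ones; on whichever side of `a` it lies, a
  -- segment from it to one of them crosses the vertical line at a second height.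
  obtain ⟨k, hik, hjk⟩ := P.exists_third i j
  have ho := P.orient_ne_zero (i := i) (j := j) (k := k) (by rintro rfl; linarith) hik hjk
  have mi := P.vertex_mem i
  have mj := P.vertex_mem j
  have mk := P.vertex_mem k
  generalize P.vertex i = u at *
  generalize P.vertex j = v at *
  generalize P.vertex k = w at *
  have huv : 0 < v.1 - u.1 := by linarith
  have h1 := P.segment_mem mi mj hi.le hj
  rcases le_or_gt w.1 a with hw | hw
  · have h2 := P.segment_mem mk mj hw hj
    refine ⟨_, _, ?_, h1, h2⟩
    have hwv : 0 < v.1 - w.1 := by linarith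
    have hva : v.1 - a ≠ 0 := by linarith
    intro h
    field_simp at h
    apply ho
    apply mul_left_cancel₀ hva
    simp only [orient]
    linarith
  · have h2 := P.segment_mem mi mk hi.le hw
    refine ⟨_, _, ?_, h1, h2⟩
    have hwu : 0 < w.1 - u.1 := by linarith
    have hva : a - u.1 ≠ 0 := by linarith
    intro h
    field_simp at h
    apply ho
    apply mul_left_cancel₀ hva
    simp only [orient]
    linarith

/-- The half-size box of a polygon with respect to the vertical direction and the line through
its extreme vertices `p` and `q`, of the one side of which `z` is the farthest vertex. -/
theorem exists_box (P : ConvexPolygon) {p q z : ℝ × ℝ} (hp : p ∈ P.region) (hq : q ∈ P.region)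
    (hz : z ∈ P.region) (hpq : p.1 < q.1) (hpz : p.1 ≤ z.1) (hzq : z.1 ≤ q.1)
    (ho : orient p q z ≠ 0) :
    ∃ c : ℝ × ℝ, ∀ v : ℝ × ℝ, |v.1| ≤ (q.1 - p.1) / 8 →
      |(q.1 - p.1) * v.2 - (q.2 - p.2) * v.1| ≤ |orient p q z| / 4 → c + v ∈ P.region := by
  have ha : 0 < q.1 - p.1 := by linarith
  -- The abscissa is that of the midpoint of the cross-section parallel to the chord at half the
  -- height of the triangle `p q z`; the ordinate puts the centre at a quarter of the height.
  obtain ⟨x, hx⟩ : ∃ x, x = (p.1 + q.1) / 4 + z.1 / 2 := ⟨_, rfl⟩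
  obtain ⟨y, hy⟩ : ∃ y, y = p.2 + (orient p q z / 4 + (q.2 - p.2) * (x - p.1)) / (q.1 - p.1) :=
    ⟨_, rfl⟩
  have hy' : (q.1 - p.1) * (y - p.2) - (q.2 - p.2) * (x - p.1) = orient p q z / 4 := by
    rw [hy]; field_simp; ring
  refine ⟨(x, y), fun v hv1 hv2 => ?_⟩
  -- `lam` is the barycentric coordinate at `z`. It deviates from `1 / 4` by at most `1 / 4`, so it
  -- stays in `[0, 1 / 2]`; there the other two coordinates are nonnegative as well.
  obtain ⟨lam, hl⟩ : ∃ lam, lam = orient p q ((x, y) + v) / orient p q z := ⟨_, rfl⟩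
  have hlam : lam = 1 / 4 + ((q.1 - p.1) * v.2 - (q.2 - p.2) * v.1) / orient p q z := by
    have : orient p q ((x, y) + v) = orient p q z / 4 +
        ((q.1 - p.1) * v.2 - (q.2 - p.2) * v.1) := by
      rw [← hy']; simp only [orient, Prod.fst_add, Prod.snd_add]; ring
    rw [hl, this, add_div]; congr 1; field_simp
  have hd : |((q.1 - p.1) * v.2 - (q.2 - p.2) * v.1) / orient p q z| ≤ 1 / 4 := by
    rw [abs_div, div_le_iff₀ (abs_pos.2 ho)]; linarith
  obtain ⟨hd1, hd2⟩ := abs_le.1 hd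
  obtain ⟨hv3, hv4⟩ := abs_le.1 hv1
  have hlo : 0 ≤ lam := by linarith
  have hhi : lam ≤ 1 / 2 := by linarith
  have hsolve : lam * orient p q z = orient p q ((x, y) + v) := by rw [hl]; field_simp
  refine P.convex_region.mem_of_barycentric hp hq hz
    (a := (q.1 - (x + v.1) - lam * (q.1 - z.1)) / (q.1 - p.1))
    (b := ((x + v.1) - p.1 - lam * (z.1 - p.1)) / (q.1 - p.1)) (c := lam)
    (div_nonneg ?_ ha.le) (div_nonneg ?_ ha.le) hlo ?_ ?_ ?_
  · nlinarith
  · nlinarith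
  · field_simp; ring
  · field_simp; simp only [Prod.fst_add]; ring
  · simp only [orient, Prod.fst_add, Prod.snd_add] at hsolve
    field_simp
    simp only [Prod.snd_add]
    linarith

end ConvexPolygon


/-! ## Sampling convex sets on a grid -/

open MeasureTheory in
/-- The proportion of the `N` midpoints of a subdivision of a unit interval that lie in a given
subinterval approximates its length. -/
theorem abs_length_sub_sample_le {J : Set ℝ} (hJ : J.OrdConnected) {a : ℝ}
    (hsub : J ⊆ Set.Icc a (a + 1)) {N : ℕ} (hN : 0 < N) :
    |volume.real J - 1 / N * ∑ k ∈ Finset.range N, J.indicator 1 (a + (k + 1 / 2) / N)|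
      ≤ 1 / (N : ℝ) := by
  classical
  have hN' : (0 : ℝ) < N := by exact_mod_cast hN
  obtain ⟨x, hx⟩ : ∃ x : ℕ → ℝ, x = fun k : ℕ => a + ((k : ℝ) + 1 / 2) / N :=
    ⟨_, rfl⟩
  have hxle : ∀ k l : ℕ, k ≤ l → x k ≤ x l := by
    intro k l h
    have : (k : ℝ) ≤ l := by exact_mod_cast h
    simp only [hx]; gcongr
  have hfin : volume J ≠ ⊤ := measure_ne_top_of_subset hsub (by simp)
  obtain ⟨S, hS⟩ : ∃ S, S = (Finset.range N).filter (fun k => x k ∈ J) := ⟨_, rfl⟩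
  have hsum : ∑ k ∈ Finset.range N, J.indicator (1 : ℝ → ℝ) (a + (k + 1 / 2) / N) = S.card := by
    rw [hS, Finset.card_filter, Nat.cast_sum]
    refine Finset.sum_congr rfl fun k _ => ?_
    simp [Set.indicator_apply, hx]
  rw [hsum]
  have hmem : ∀ k, k ∈ S ↔ k < N ∧ x k ∈ J := by intro k; simp [hS]
  -- If no midpoint is hit, the length is at most one spacing. Otherwise the indices hit form an
  -- interval from `p` to `q`; the count gives `(q - p + 1) / N`, and the length lies between `(q -
  -- p) / N` and `(q - p + 2) / N`.
  rcases S.eq_empty_or_nonempty with h0 | h0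
  · rw [h0, Finset.card_empty, Nat.cast_zero, mul_zero, sub_zero, abs_of_nonneg measureReal_nonneg]
    have key : ∀ y ∈ J, ∀ z ∈ J, z - y ≤ 1 / N := by
      intro y hy z hz
      by_contra! h
      obtain ⟨hy1, hy2⟩ := hsub hy
      obtain ⟨hz1, hz2⟩ := hsub hz
      -- The index of the first midpoint not to the left of `y`; if `z` is farther than one spacing
      -- from `y`, this midpoint lies between them.
      have hk1 := Nat.le_ceil (N * (y - a) - 1 / 2)
      have hk2 : (⌈N * (y - a) - 1 / 2⌉₊ : ℝ) < N * (y - a) - 1 / 2 + 1 := by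
        rcases le_or_gt (-1) (N * (y - a) - 1 / 2 - 1) with h' | h'
        · rcases le_or_gt 0 (N * (y - a) - 1 / 2) with h'' | h''
          · exact Nat.ceil_lt_add_one h''
          · rw [Nat.ceil_eq_zero.2 h''.le]; push_cast
            have := mul_nonneg hN'.le (sub_nonneg.2 hy1); linarith
        · rw [Nat.ceil_eq_zero.2 (by linarith)]; push_cast
          have := mul_nonneg hN'.le (sub_nonneg.2 hy1); linarith
      generalize ⌈N * (y - a) - 1 / 2⌉₊ = k at *
      have e : (x k - a) * N = k + 1 / 2 := by simp only [hx]; field_simp; ring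
      have h1 : y ≤ x k := by
        have : (y - a) * N ≤ (x k - a) * N := by rw [e]; linarith
        have := le_of_mul_le_mul_right this hN'; linarith
      have h2 : x k ≤ z := by
        have h3 : 1 < (z - y) * N := by rwa [div_lt_iff₀ hN'] at h
        have : (x k - a) * N ≤ (z - a) * N := by rw [e]; nlinarith
        have := le_of_mul_le_mul_right this hN'; linarith
      have hkN : k < N := by
        have : (x k - a) * N ≤ 1 * N := mul_le_mul_of_nonneg_right (by linarith) hN'.le
        rw [e] at this
        have : (k : ℝ) < N := by linarith
        exact_mod_cast this
      have : k ∈ S := (hmem k).2 ⟨hkN, hJ.out hy hz ⟨h1, h2⟩⟩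
      rw [h0] at this
      exact absurd this (Finset.notMem_empty k)
    rcases J.eq_empty_or_nonempty with hJ0 | ⟨y, hy⟩
    · rw [hJ0]; simp
    · have hb : BddBelow J := ⟨a, fun z hz => (hsub hz).1⟩
      have hsub2 : J ⊆ Set.Icc (sInf J) (sInf J + 1 / N) := by
        intro z hz
        refine ⟨csInf_le hb hz, ?_⟩
        have : z - 1 / N ≤ sInf J := le_csInf ⟨y, hy⟩ fun w hw => by linarith [key w hw z hz]
        linarith
      calc volume.real J ≤ volume.real (Set.Icc (sInf J) (sInf J + 1 / N)) :=
            measureReal_mono hsub2 (by simp)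
        _ = 1 / N := by rw [Real.volume_real_Icc]; simp
  · obtain ⟨p, hp⟩ : ∃ p, p = S.min' h0 := ⟨_, rfl⟩
    obtain ⟨q, hq⟩ : ∃ q, q = S.max' h0 := ⟨_, rfl⟩
    have hpS : p ∈ S := hp ▸ S.min'_mem h0
    have hqS : q ∈ S := hq ▸ S.max'_mem h0
    have hpq : p ≤ q := by rw [hp]; exact S.min'_le _ hqS
    obtain ⟨hpN, hpJ⟩ := (hmem p).1 hpS
    obtain ⟨hqN, hqJ⟩ := (hmem q).1 hqS
    have hSI : S = Finset.Icc p q := by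
      ext k
      rw [Finset.mem_Icc]
      constructor
      · intro hk
        exact ⟨hp ▸ S.min'_le _ hk, hq ▸ S.le_max' _ hk⟩
      · rintro ⟨h1, h2⟩
        exact (hmem k).2 ⟨by omega, hJ.out hpJ hqJ ⟨hxle _ _ h1, hxle _ _ h2⟩⟩
    have hcard : (S.card : ℝ) = q - p + 1 := by
      rw [hSI, Nat.card_Icc, Nat.cast_sub (by omega)]; push_cast; ring
    have exq : x q - x p = (q - p) / N := by simp only [hx]; field_simp; ring
    have hlow : (q - p : ℝ) / N ≤ volume.real J := by
      rw [← exq]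
      calc x q - x p = volume.real (Set.Icc (x p) (x q)) := by
            rw [Real.volume_real_Icc_of_le (hxle _ _ hpq)]
        _ ≤ volume.real J := measureReal_mono (hJ.out hpJ hqJ) hfin
    -- Reaching farther would include the neighbouring midpoint in `J`; at the ends of the unit
    -- interval there is none, but there only half a spacing is left.
    have hsub2 : J ⊆ Set.Icc (x p - 1 / N) (x q + 1 / N) := by
      intro z hz
      obtain ⟨hz1, hz2⟩ := hsub hz
      constructor
      · by_contra! h
        rcases p with _ | p
        · have : x 0 - a = 1 / 2 * (1 / N) := by simp only [hx]; push_cast; field_simp; ring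
          have : 0 < 1 / (N : ℝ) := by positivity
          linarith
        · have e : x p = x (p + 1) - 1 / N := by simp only [hx]; push_cast; field_simp; ring
          have : p ∈ S := (hmem p).2 ⟨by omega, hJ.out hz hpJ ⟨by linarith, hxle _ _ (by omega)⟩⟩
          have := S.min'_le _ this
          omega
      · by_contra! h
        rcases Nat.lt_or_ge (q + 1) N with h1 | h1
        · have e : x (q + 1) = x q + 1 / N := by simp only [hx]; push_cast; field_simp; ring
          have : q + 1 ∈ S := (hmem _).2 ⟨h1, hJ.out hqJ hz ⟨hxle _ _ (by omega), by linarith⟩⟩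
          have := S.le_max' _ this
          omega
        · have hqN : (q : ℝ) + 1 = N := by exact_mod_cast (by omega : q + 1 = N)
          have : x q = a + 1 - 1 / 2 * (1 / N) := by simp only [hx, ← hqN]; field_simp; ring
          have : 0 < 1 / (N : ℝ) := by positivity
          linarith
    have hup : volume.real J ≤ (q - p + 2) / N := by
      calc volume.real J ≤ volume.real (Set.Icc (x p - 1 / N) (x q + 1 / N)) :=
            measureReal_mono hsub2 (by simp)
        _ = (q - p + 2) / N := by
            have h0 : 0 < 1 / (N : ℝ) := by positivity
            rw [Real.volume_real_Icc_of_le (by linarith [hxle _ _ hpq])]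
            have : x q + 1 / N - (x p - 1 / N) = (x q - x p) + 2 / N := by ring
            rw [this, exq]; ring
    rw [hcard, abs_le]
    have e1 : (q - p + 2 : ℝ) / N = (q - p) / N + 2 * (1 / N) := by ring
    have e2 : 1 / (N : ℝ) * (q - p + 1) = (q - p) / N + 1 / N := by ring
    rw [e2]
    constructor <;> linarith

open MeasureTheory in
/-- The proportion of the `N ^ 2` points of a grid in a unit square that lie in a given convex set
approximates its area. -/
theorem abs_area_sub_sample_le {K : Set (ℝ × ℝ)} (hK : Convex ℝ K) (hm : MeasurableSet K) {a b : ℝ}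
    (hsub : K ⊆ Set.Icc a (a + 1) ×ˢ Set.Icc b (b + 1)) {N : ℕ} (hN : 0 < N) :
    |volume.real K - 1 / (N : ℝ) ^ 2 * ∑ k ∈ Finset.range N, ∑ l ∈ Finset.range N,
      K.indicator 1 (a + (k + 1 / 2) / N, b + (l + 1 / 2) / N)| ≤ 2 / (N : ℝ) := by
  have hN' : (0 : ℝ) < N := by exact_mod_cast hN
  have hfin : volume K ≠ ⊤ := measure_ne_top_of_subset hsub
    (by rw [Measure.volume_eq_prod, Measure.prod_prod]; simp)
  have hrow : ∀ x, (Prod.mk x ⁻¹' K).OrdConnected ∧ Prod.mk x ⁻¹' K ⊆ Set.Icc b (b + 1) := by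
    intro x
    refine ⟨⟨fun y hy z hz w hw => ?_⟩, fun y hy => (hsub hy).2⟩
    rcases hw.1.eq_or_lt with rfl | h1
    · exact hy
    have hyz : 0 < z - y := by linarith [hw.2]
    refine hK.mem_of_barycentric hy hz hz (a := (z - w) / (z - y)) (b := (w - y) / (z - y)) (c := 0)
      (div_nonneg (by linarith [hw.2]) hyz.le) (div_nonneg (by linarith) hyz.le) le_rfl ?_ ?_ ?_
    all_goals field_simp; try ring
  have hcol : ∀ y, {x | (x, y) ∈ K}.OrdConnected ∧ {x | (x, y) ∈ K} ⊆ Set.Icc a (a + 1) := by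
    intro x
    refine ⟨⟨fun y hy z hz w hw => ?_⟩, fun y hy => (hsub hy).1⟩
    rcases hw.1.eq_or_lt with rfl | h1
    · exact hy
    have hyz : 0 < z - y := by linarith [hw.2]
    refine hK.mem_of_barycentric hy hz hz (a := (z - w) / (z - y)) (b := (w - y) / (z - y)) (c := 0)
      (div_nonneg (by linarith [hw.2]) hyz.le) (div_nonneg (by linarith) hyz.le) le_rfl ?_ ?_ ?_
    all_goals field_simp; try ring
  have hcolm : ∀ y, MeasurableSet {x | (x, y) ∈ K} := fun y => (hcol y).1.measurableSet
  have hprod : volume.real K = ∫ x in Set.Icc a (a + 1), volume.real (Prod.mk x ⁻¹' K) := by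
    rw [setIntegral_eq_integral_of_forall_compl_eq_zero]
    · simp only [measureReal_def]
      rw [integral_toReal (measurable_measure_prodMk_left hm).aemeasurable, Measure.volume_eq_prod,
        Measure.prod_apply hm]
      exact ae_of_all _ fun x => (measure_lt_top_of_subset (hrow x).2 (by simp))
    · intro x hx
      have : Prod.mk x ⁻¹' K = ∅ := by
        ext y; simp only [Set.mem_preimage, Set.mem_empty_iff_false, iff_false]
        exact fun h => hx (hsub h).1
      rw [this]; simp
  have hi1 : IntegrableOn (fun x => volume.real (Prod.mk x ⁻¹' K)) (Set.Icc a (a + 1)) :=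
    (Measure.integrable_measure_prodMk_left hm (by rwa [← Measure.volume_eq_prod])).integrableOn
  have hind : ∀ l : ℕ, ∀ x : ℝ, K.indicator (1 : ℝ × ℝ → ℝ) (x, b + (l + 1 / 2) / N) =
      {x | (x, b + (l + 1 / 2) / N) ∈ K}.indicator 1 x := fun l x => rfl
  have hi2 : ∀ l : ℕ, IntegrableOn
      (fun x => K.indicator (1 : ℝ × ℝ → ℝ) (x, b + (l + 1 / 2) / N)) (Set.Icc a (a + 1)) := by
    intro l
    simp only [hind]
    exact (integrable_const (1 : ℝ)).indicator (hcolm _)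
  have hi3 : IntegrableOn (fun x => 1 / (N : ℝ) * ∑ l ∈ Finset.range N,
      K.indicator (1 : ℝ × ℝ → ℝ) (x, b + (l + 1 / 2) / N)) (Set.Icc a (a + 1)) :=
    (integrable_finsetSum _ fun l _ => hi2 l).const_mul _
  -- First error `1 / N`: by Fubini the area is the integral of the vertical slice lengths, each
  -- replaced by its sample. Integrating the samples gives the mean length of the horizontal slices
  -- at the sampled heights.
  have h1 : |volume.real K - 1 / (N : ℝ) * ∑ l ∈ Finset.range N,
      volume.real {x | (x, b + (l + 1 / 2) / N) ∈ K}| ≤ 1 / N := by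
    have e : 1 / (N : ℝ) * ∑ l ∈ Finset.range N, volume.real {x | (x, b + (l + 1 / 2) / N) ∈ K} =
        ∫ x in Set.Icc a (a + 1), 1 / (N : ℝ) * ∑ l ∈ Finset.range N,
          K.indicator (1 : ℝ × ℝ → ℝ) (x, b + (l + 1 / 2) / N) := by
      rw [integral_const_mul, integral_finsetSum _ fun l _ => hi2 l]
      congr 1
      refine Finset.sum_congr rfl fun l _ => ?_
      simp only [hind]
      rw [integral_indicator_one (hcolm _), measureReal_restrict_apply (hcolm _),
        Set.inter_eq_left.2 (hcol _).2]
    rw [e, hprod, ← integral_sub hi1 hi3]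
    have := norm_setIntegral_le_of_norm_le_const (μ := volume) (s := Set.Icc a (a + 1))
      (C := 1 / (N : ℝ)) (f := fun x => volume.real (Prod.mk x ⁻¹' K) - 1 / (N : ℝ) *
        ∑ l ∈ Finset.range N, K.indicator (1 : ℝ × ℝ → ℝ) (x, b + (l + 1 / 2) / N))
      (by simp) (fun x _ => abs_length_sub_sample_le (hrow x).1 (hrow x).2 hN)
    simpa [Real.norm_eq_abs] using this
  -- Second error `1 / N`: each of these `N` horizontal slice lengths is replaced by its own sample.
  have h2 : |1 / (N : ℝ) * ∑ l ∈ Finset.range N, volume.real {x | (x, b + (l + 1 / 2) / N) ∈ K} -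
      1 / (N : ℝ) ^ 2 * ∑ k ∈ Finset.range N, ∑ l ∈ Finset.range N,
      K.indicator 1 (a + (k + 1 / 2) / N, b + (l + 1 / 2) / N)| ≤ 1 / (N : ℝ) := by
    rw [Finset.sum_comm]
    have e : 1 / (N : ℝ) * ∑ l ∈ Finset.range N, volume.real {x | (x, b + (l + 1 / 2) / N) ∈ K} -
      1 / (N : ℝ) ^ 2 * ∑ l ∈ Finset.range N, ∑ k ∈ Finset.range N,
        K.indicator 1 (a + (k + 1 / 2) / N, b + (l + 1 / 2) / N) =
      1 / (N : ℝ) * ∑ l ∈ Finset.range N, (volume.real {x | (x, b + (l + 1 / 2) / N) ∈ K} -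
        1 / N * ∑ k ∈ Finset.range N, {x | (x, b + (l + 1 / 2) / N) ∈ K}.indicator 1
          (a + (k + 1 / 2) / N)) := by
      rw [Finset.sum_sub_distrib, ← Finset.mul_sum, mul_sub]
      simp only [hind]
      ring
    rw [e, abs_mul, abs_of_pos (by positivity : 0 < 1 / (N : ℝ))]
    have : |∑ l ∈ Finset.range N, (volume.real {x | (x, b + (l + 1 / 2) / N) ∈ K} -
        1 / N * ∑ k ∈ Finset.range N, {x | (x, b + (l + 1 / 2) / N) ∈ K}.indicator 1
          (a + (k + 1 / 2) / N))| ≤ ∑ l ∈ Finset.range N, 1 / (N : ℝ) :=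
      (Finset.abs_sum_le_sum_abs _ _).trans
        (Finset.sum_le_sum fun l _ => abs_length_sub_sample_le (hcol _).1 (hcol _).2 hN)
    rw [Finset.sum_const, Finset.card_range, nsmul_eq_mul, mul_one_div_cancel hN'.ne'] at this
    calc _ ≤ 1 / (N : ℝ) * 1 := by gcongr
      _ = 1 / N := mul_one _
  have e3 : 2 / (N : ℝ) = 1 / N + 1 / N := by ring
  rw [e3]
  exact (abs_sub_le _ _ _).trans (add_le_add h1 h2)


/-! ## The overlap function -/

theorem Quadratic.exists_sum {ι : Type*} (s : Finset ι) (w : ι → Quadratic) :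
    ∃ q : Quadratic, ∀ t, q.eval t = ∑ i ∈ s, (w i).eval t := by
  classical
  induction s using Finset.induction_on with
  | empty => exact ⟨⟨0, 0, 0, 0, 0, 0⟩, fun t => by simp [Quadratic.eval]⟩
  | insert i s hi ih =>
    obtain ⟨q, hq⟩ := ih
    refine ⟨⟨(w i).xx + q.xx, (w i).xy + q.xy, (w i).yy + q.yy, (w i).x + q.x, (w i).y + q.y,
      (w i).c + q.c⟩, fun t => ?_⟩
    rw [Finset.sum_insert hi, ← hq]
    simp only [Quadratic.eval]; ring

/-- Away from the frontier the plane splits into two disjoint open sets, the interior and the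
exterior of `R`. -/
theorem IsPreconnected.subset_or_disjoint_of_disjoint_frontier {F R : Set (ℝ × ℝ)}
    (hF : IsPreconnected F) (h : Disjoint F (frontier R)) : F ⊆ R ∨ Disjoint F R := by
  have hsub : F ⊆ interior R ∪ (closure R)ᶜ := by
    intro x hx
    by_contra hc
    simp only [Set.mem_union, Set.mem_compl_iff, not_or, not_not] at hc
    exact Set.disjoint_left.1 h hx ⟨hc.2, hc.1⟩
  rcases hF.subset_or_subset isOpen_interior isClosed_closure.isOpen_compl
    (Set.disjoint_left.2 fun x h1 h2 => h2 (subset_closure (interior_subset h1))) hsub with h | h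
  · exact Or.inl (h.trans interior_subset)
  · exact Or.inr (Set.disjoint_left.2 fun x h1 h2 => h h1 (subset_closure h2))

/-- A face is connected and avoids all the boundaries, so it lies inside or outside each polygon as
a whole; the quadratic is the sum over the polygons containing a base point of the face. -/
theorem PiecewiseQuadratic.quadratic_on_faces (ψ : PiecewiseQuadratic) (F : Set (ℝ × ℝ))
    (hF : IsFace ψ.polygon F) : ∃ q : Quadratic, ∀ t ∈ F, ψ.eval t = q.eval t := by
  classical
  obtain ⟨t₀, ht₀, rfl⟩ := hF
  have hpre : IsPreconnected
      (connectedComponentIn (⋃ i, frontier (ψ.polygon i).region)ᶜ t₀) :=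
    isPreconnected_connectedComponentIn
  have hsub := connectedComponentIn_subset (⋃ i, frontier (ψ.polygon i).region)ᶜ t₀
  have hmem := mem_connectedComponentIn ht₀
  generalize connectedComponentIn (⋃ i, frontier (ψ.polygon i).region)ᶜ t₀ = F at *
  obtain ⟨q, hq⟩ := Quadratic.exists_sum
    (Finset.univ.filter fun i => t₀ ∈ (ψ.polygon i).region) ψ.weight
  refine ⟨q, fun t ht => ?_⟩
  rw [hq, Finset.sum_filter]
  refine Finset.sum_congr rfl fun i _ => ?_
  have hiff : t ∈ (ψ.polygon i).region ↔ t₀ ∈ (ψ.polygon i).region := by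
    rcases hpre.subset_or_disjoint_of_disjoint_frontier (R := (ψ.polygon i).region)
      (Set.disjoint_left.2 fun x hx hx' => hsub hx (Set.mem_iUnion.2 ⟨i, hx'⟩)) with h | h
    · exact iff_of_true (h ht) (h hmem)
    · exact iff_of_false (Set.disjoint_left.1 h ht) (Set.disjoint_left.1 h hmem)
  simp only [Set.indicator_apply, hiff]

/-- The intersection of `A` with the translate of `B` by `t`. -/
def common (A B : ConvexPolygon) (t : ℝ × ℝ) : Set (ℝ × ℝ) :=
  {p | p ∈ A.region ∧ p - t ∈ B.region}

theorem common_eq (A B : ConvexPolygon) (t : ℝ × ℝ) :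
    A.region ∩ (fun p => t + p) '' B.region = common A B t := by
  ext p
  simp only [common, Set.mem_inter_iff, Set.mem_image, Set.mem_ofPred_eq]
  refine and_congr_right fun _ => ⟨?_, fun h => ⟨_, h, by simp⟩⟩
  rintro ⟨q, hq, rfl⟩
  simpa using hq

theorem overlap_eq (A B : ConvexPolygon) (t : ℝ × ℝ) :
    overlap A B t = MeasureTheory.volume.real (common A B t) := by
  rw [overlap, common_eq]; rfl

theorem isCompact_common (A B : ConvexPolygon) (t : ℝ × ℝ) : IsCompact (common A B t) := by
  rw [← common_eq]
  exact A.isCompact_region.inter (B.isCompact_region.image (by fun_prop))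

theorem convex_common (A B : ConvexPolygon) (t : ℝ × ℝ) : Convex ℝ (common A B t) := by
  rw [← common_eq]
  exact A.convex_region.inter (B.convex_region.translate t)

/-- Translating the intersection by `-t` exchanges the roles of the two polygons. This justifies
processing them in either order. -/
theorem overlap_swap (X Y : ConvexPolygon) (t : ℝ × ℝ) : overlap X Y t = overlap Y X (-t) := by
  rw [overlap_eq, overlap_eq]
  have : common X Y t = (fun p => p - t) ⁻¹' common Y X (-t) := by
    ext p; simp [common, and_comm]
  simp only [sub_eq_add_neg] at this
  rw [this, MeasureTheory.measureReal_def, MeasureTheory.measure_preimage_add_right]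
  rfl

-- The area of `X` bounds all overlaps; without a bound the real supremum would have a default
-- value.
theorem overlap_le_maxOverlap (X Y : ConvexPolygon) (t : ℝ × ℝ) :
    overlap X Y t ≤ maxOverlap X Y := by
  refine le_ciSup (f := fun t => overlap X Y t) ⟨MeasureTheory.volume.real X.region, ?_⟩ t
  rintro _ ⟨s, rfl⟩
  simp only [overlap_eq]
  exact MeasureTheory.measureReal_mono (fun p hp => hp.1)
    X.isCompact_region.measure_lt_top.ne

/-- `coords` as a linear map. -/
noncomputable def coordsLin (α β : ℝ × ℝ) : (ℝ × ℝ) →ₗ[ℝ] ℝ × ℝ :=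
  Matrix.toLin (Module.Basis.finTwoProd ℝ) (Module.Basis.finTwoProd ℝ) !![α.1, α.2; β.1, β.2]

theorem coordsLin_apply (α β p : ℝ × ℝ) : coordsLin α β p = coords α β p := by
  rw [coordsLin, Matrix.toLin_finTwoProd_apply]; rfl

theorem det_coordsLin (α β : ℝ × ℝ) : LinearMap.det (coordsLin α β) = cross α β := by
  rw [coordsLin, LinearMap.det_toLin, Matrix.det_fin_two_of]; rfl

theorem volume_image_coords {α β : ℝ × ℝ} (h : 0 < cross α β) (K : Set (ℝ × ℝ)) :
    MeasureTheory.volume.real (coords α β '' K) = cross α β * MeasureTheory.volume.real K := by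
  have e : coords α β = coordsLin α β := funext fun p => (coordsLin_apply α β p).symm
  rw [e, MeasureTheory.measureReal_def, MeasureTheory.Measure.addHaar_image_linearMap,
    det_coordsLin, abs_of_pos h, ENNReal.toReal_mul, ENNReal.toReal_ofReal h.le]
  rfl

theorem mem_image_coords {α β : ℝ × ℝ} (h : 0 < cross α β) (K : Set (ℝ × ℝ)) (z : ℝ × ℝ) :
    z ∈ coords α β '' K ↔ uncoords α β z ∈ K := by
  constructor
  · rintro ⟨p, hp, rfl⟩; rwa [uncoords_coords h]
  · intro hz; exact ⟨_, hz, coords_uncoords h z⟩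

/-- Counting grid points in the coordinates `α`, `β` approximates the overlap. -/
theorem abs_overlap_sub_sample_le (A B : ConvexPolygon) (t : ℝ × ℝ) {α β : ℝ × ℝ}
    (h : 0 < cross α β) {a b : ℝ} (hα : ∀ p ∈ common A B t, a ≤ dot α p ∧ dot α p ≤ a + 1)
    (hβ : ∀ p ∈ common A B t, b ≤ dot β p ∧ dot β p ≤ b + 1) {N : ℕ} (hN : 0 < N) :
    |overlap A B t - 1 / ((N : ℝ) ^ 2 * cross α β) * ∑ k ∈ Finset.range N, ∑ l ∈ Finset.range N,
      (common A B t).indicator 1 (uncoords α β (a + (k + 1 / 2) / N, b + (l + 1 / 2) / N))|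
      ≤ 2 / (N * cross α β) := by
  have hN' : (0 : ℝ) < N := by exact_mod_cast hN
  have hsub : coords α β '' common A B t ⊆ Set.Icc a (a + 1) ×ˢ Set.Icc b (b + 1) := by
    rintro _ ⟨p, hp, rfl⟩
    exact ⟨hα p hp, hβ p hp⟩
  have e : coords α β = coordsLin α β := funext fun p => (coordsLin_apply α β p).symm
  have hcv : Convex ℝ (coords α β '' common A B t) := by
    rw [e]; exact (convex_common A B t).linear_image _
  have hcp : IsCompact (coords α β '' common A B t) := by
    refine (isCompact_common A B t).image ?_
    unfold coords dot; fun_prop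
  have key := abs_area_sub_sample_le hcv hcp.measurableSet hsub hN
  have hind : ∀ z, (coords α β '' common A B t).indicator (1 : ℝ × ℝ → ℝ) z =
      (common A B t).indicator 1 (uncoords α β z) := by
    intro z
    by_cases hz : uncoords α β z ∈ common A B t
    · rw [Set.indicator_of_mem hz, Set.indicator_of_mem ((mem_image_coords h _ _).2 hz)]; rfl
    · rw [Set.indicator_of_notMem hz,
        Set.indicator_of_notMem (fun h' => hz ((mem_image_coords h _ _).1 h'))]
  simp only [hind] at key
  rw [volume_image_coords h, ← overlap_eq] at key
  generalize ∑ k ∈ Finset.range N, ∑ l ∈ Finset.range N,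
      (common A B t).indicator (1 : ℝ × ℝ → ℝ)
        (uncoords α β (a + (k + 1 / 2) / N, b + (l + 1 / 2) / N)) = s at *
  have e1 : overlap A B t - 1 / ((N : ℝ) ^ 2 * cross α β) * s =
      (cross α β * overlap A B t - 1 / (N : ℝ) ^ 2 * s) / cross α β := by field_simp
  rw [e1, abs_div, abs_of_pos h, div_le_iff₀ h]
  calc _ ≤ 2 / (N : ℝ) := key
    _ = _ := by field_simp

/-- If the polygons contain translates of the parallelogram `|α|, |β| ≤ 1 / 16`, then the maximal
overlap is at least its area. -/
theorem le_maxOverlap_of_box {A B : ConvexPolygon} {α β : ℝ × ℝ} (h : 0 < cross α β)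
    {c c' : ℝ × ℝ} (hbox : ∀ v, |dot α v| ≤ 1 / 16 → |dot β v| ≤ 1 / 16 →
      c + v ∈ A.region ∧ c' + v ∈ B.region) :
    1 / (64 * cross α β) ≤ overlap A B (c - c') := by
  have key := volume_image_coords h ((fun p => p - c) '' common A B (c - c'))
  have hsub : Set.Icc (-(1 / 16) : ℝ) (1 / 16) ×ˢ Set.Icc (-(1 / 16) : ℝ) (1 / 16) ⊆
      coords α β '' ((fun p => p - c) '' common A B (c - c')) := by
    intro z hz
    rw [mem_image_coords h]
    have hz' := coords_uncoords h z
    obtain ⟨h1, h2⟩ := hbox (uncoords α β z)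
      (by rw [show dot α (uncoords α β z) = z.1 from congrArg Prod.fst hz']; exact abs_le.2 hz.1)
      (by rw [show dot β (uncoords α β z) = z.2 from congrArg Prod.snd hz']; exact abs_le.2 hz.2)
    refine ⟨c + uncoords α β z, ⟨h1, ?_⟩, by simp⟩
    have : c + uncoords α β z - (c - c') = c' + uncoords α β z := by abel
    rwa [this]
  have hfin : IsCompact (coords α β '' ((fun p => p - c) '' common A B (c - c'))) := by
    refine ((isCompact_common A B _).image (by fun_prop)).image ?_
    unfold coords dot; fun_prop
  have hle := MeasureTheory.measureReal_mono (μ := MeasureTheory.volume) hsub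
    hfin.measure_lt_top.ne
  have hshift : MeasureTheory.volume.real ((fun p => p - c) '' common A B (c - c')) =
      overlap A B (c - c') := by
    rw [overlap_eq]
    have : (fun p => p - c) '' common A B (c - c') = (fun p => p + c) ⁻¹' common A B (c - c') := by
      ext p
      simp only [Set.mem_image, Set.mem_preimage]
      exact ⟨by rintro ⟨q, hq, rfl⟩; simpa using hq, fun hp => ⟨_, hp, by simp⟩⟩
    rw [this, MeasureTheory.measureReal_def, MeasureTheory.measure_preimage_add_right]
    rfl
  rw [key, hshift] at hle
  -- In the coordinates `α`, `β` the common box is a square of side `1 / 8`.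
  have hsq : MeasureTheory.volume.real
      (Set.Icc (-(1 / 16) : ℝ) (1 / 16) ×ˢ Set.Icc (-(1 / 16) : ℝ) (1 / 16)) = 1 / 64 := by
    rw [MeasureTheory.Measure.volume_eq_prod, MeasureTheory.measureReal_prod_prod]
    rw [Real.volume_real_Icc]; norm_num
  rw [hsq] at hle
  rw [div_le_iff₀ (by positivity)]
  linarith

/-- Of three linear functionals the two with the largest determinant bound the third one. -/
theorem abs_dot_le_of_cross_le {α β γ : ℝ × ℝ} (h : 0 < cross α β) (h1 : |cross γ β| ≤ cross α β)
    (h2 : |cross α γ| ≤ cross α β) {v : ℝ × ℝ} (hα : |dot α v| ≤ 1 / 16)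
    (hβ : |dot β v| ≤ 1 / 16) : |dot γ v| ≤ 1 / 8 := by
  -- Cramer's rule for `γ` in terms of `α` and `β`; both coefficients are at most `1` in absolute
  -- value after division by `cross α β`.
  have e : cross α β * dot γ v = cross γ β * dot α v + cross α γ * dot β v := by
    simp only [cross, dot]; ring
  have : cross α β * |dot γ v| ≤ cross α β * (1 / 8) := by
    rw [← abs_of_pos h, ← abs_mul, abs_of_pos h, e]
    calc _ ≤ |cross γ β * dot α v| + |cross α γ * dot β v| := abs_add_le _ _
      _ = |cross γ β| * |dot α v| + |cross α γ| * |dot β v| := by rw [abs_mul, abs_mul]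
      _ ≤ cross α β * (1 / 16) + cross α β * (1 / 16) := by gcongr
      _ = _ := by ring
  exact le_of_mul_le_mul_left this h


/-! ## Reasoning about programs of the real RAM -/

namespace RealRAM

infixr:60 " ;; " => Program.seq

theorem setNat_nat (m : Memory) (a i v b j : ℕ) :
    (m.setNat a i v).nat b j = if b = a ∧ j = i then v else m.nat b j := by
  by_cases hb : b = a
  · subst hb
    by_cases hj : j = i <;> simp [Memory.setNat, hj]
  · simp [Memory.setNat, hb]

theorem setNat_real (m : Memory) (a i v : ℕ) : (m.setNat a i v).real = m.real := rfl

theorem setReal_real (m : Memory) (a i : ℕ) (v : ℝ) (b j : ℕ) :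
    (m.setReal a i v).real b j = if b = a ∧ j = i then v else m.real b j := by
  by_cases hb : b = a
  · subst hb
    by_cases hj : j = i <;> simp [Memory.setReal, hj]
  · simp [Memory.setReal, hb]

theorem setReal_nat (m : Memory) (a i : ℕ) (v : ℝ) : (m.setReal a i v).nat = m.nat := rfl

theorem setNat_nat_ne (m : Memory) {a b : ℕ} (i v : ℕ) (h : b ≠ a) :
    (m.setNat a i v).nat b = m.nat b := by
  funext j; simp [setNat_nat, h]

theorem setReal_real_ne (m : Memory) {a b : ℕ} (i : ℕ) (v : ℝ) (h : b ≠ a) :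
    (m.setReal a i v).real b = m.real b := by
  funext j; simp [setReal_real, h]

/-- The scalar variable `a` in expressions for natural numbers. -/
abbrev nvar (a : ℕ) : NExpr := .get a (.lit 0)

/-- The scalar variable `a` in expressions for real numbers. -/
abbrev rvar (a : ℕ) : RExpr := .get a (.lit 0)

/-- The entry of the real array `a` whose address is the natural variable `i`. -/
abbrev entry (a i : ℕ) : RExpr := .get a (nvar i)

/-- The program text contains no assignment to the natural array `a`. -/
def Program.keepsNat (a : ℕ) : Program → Bool
  | .skip => true
  | .nset b _ _ => b != a
  | .rset _ _ _ => true
  | .seq p q => p.keepsNat a && q.keepsNat a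
  | .cond _ p q => p.keepsNat a && q.keepsNat a
  | .loop _ p => p.keepsNat a

/-- The program text contains no assignment to the real array `a`. -/
def Program.keepsReal (a : ℕ) : Program → Bool
  | .skip => true
  | .nset _ _ _ => true
  | .rset b _ _ => b != a
  | .seq p q => p.keepsReal a && q.keepsReal a
  | .cond _ p q => p.keepsReal a && q.keepsReal a
  | .loop _ p => p.keepsReal a

/-- The arrays that the program does not assign to agree. -/
def Keeps (p : Program) (m m' : Memory) : Prop :=
  (∀ a, p.keepsNat a = true → m'.nat a = m.nat a) ∧
  (∀ a, p.keepsReal a = true → m'.real a = m.real a)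

theorem Keeps.refl (p : Program) (m : Memory) : Keeps p m m := ⟨fun _ _ => rfl, fun _ _ => rfl⟩

theorem Keeps.trans {p : Program} {m m' m'' : Memory} (h : Keeps p m m') (h' : Keeps p m' m'') :
    Keeps p m m'' :=
  ⟨fun a ha => (h'.1 a ha).trans (h.1 a ha), fun a ha => (h'.2 a ha).trans (h.2 a ha)⟩

theorem Keeps.mono {p q : Program} {m m' : Memory} (h : Keeps p m m')
    (hn : ∀ a, q.keepsNat a = true → p.keepsNat a = true)
    (hr : ∀ a, q.keepsReal a = true → p.keepsReal a = true) : Keeps q m m' :=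
  ⟨fun a ha => h.1 a (hn a ha), fun a ha => h.2 a (hr a ha)⟩

/-- The frame rule. Whether an array is assigned to is a Boolean computation on the program text, so
for concrete programs and array numbers its instances below are proved by `rfl`. -/
theorem Runs.keeps {p : Program} {m m' : Memory} {T : ℕ} (h : Runs p m T m') : Keeps p m m' := by
  induction h with
  | skip m => exact Keeps.refl _ _
  | nset a i e m =>
    refine ⟨fun b hb => setNat_nat_ne _ _ _ ?_, fun _ _ => rfl⟩
    rintro rfl; simp [Program.keepsNat] at hb
  | rset a i e m =>
    refine ⟨fun _ _ => rfl, fun b hb => setReal_real_ne _ _ _ ?_⟩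
    rintro rfl; simp [Program.keepsReal] at hb
  | seq _ _ ih1 ih2 =>
    refine Keeps.trans (ih1.mono ?_ ?_) (ih2.mono ?_ ?_) <;> intro a ha <;>
      simp_all [Program.keepsNat, Program.keepsReal]
  | cond_true _ _ ih =>
    refine ih.mono ?_ ?_ <;> intro a ha <;> simp_all [Program.keepsNat, Program.keepsReal]
  | cond_false _ _ ih =>
    refine ih.mono ?_ ?_ <;> intro a ha <;> simp_all [Program.keepsNat, Program.keepsReal]
  | loop_done _ => exact Keeps.refl _ _
  | loop_step _ _ _ ih1 ih2 => exact Keeps.trans (ih1.mono (fun _ h => h) (fun _ h => h)) ih2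

/-- Started in `m`, the program `p` halts within `B` steps in a memory with the property `Q`. -/
def Ex (p : Program) (m : Memory) (B : ℕ) (Q : Memory → Prop) : Prop :=
  ∃ T m', Runs p m T m' ∧ T ≤ B ∧ Q m'

theorem Ex.mono {p : Program} {m : Memory} {B B' : ℕ} {Q Q' : Memory → Prop} (h : Ex p m B Q)
    (hB : B ≤ B') (hQ : ∀ m', Keeps p m m' → Q m' → Q' m') : Ex p m B' Q' := by
  obtain ⟨T, m', hr, hT, hq⟩ := h
  exact ⟨T, m', hr, hT.trans hB, hQ m' hr.keeps hq⟩

theorem Ex.le {p : Program} {m : Memory} {B B' : ℕ} {Q : Memory → Prop} (h : Ex p m B Q)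
    (hB : B ≤ B') : Ex p m B' Q :=
  h.mono hB fun _ _ h => h

theorem Ex.seq {p q : Program} {m : Memory} {B B' : ℕ} {Q R : Memory → Prop} (h : Ex p m B Q)
    (h' : ∀ m', Keeps p m m' → Q m' → Ex q m' B' R) : Ex (p ;; q) m (B + B') R := by
  obtain ⟨T, m', hr, hT, hq⟩ := h
  obtain ⟨S, m'', hr', hS, hR⟩ := h' m' hr.keeps hq
  exact ⟨T + S, m'', .seq hr hr', add_le_add hT hS, hR⟩

theorem Ex.cond {b : Test} {p q : Program} {m : Memory} {B : ℕ} {Q : Memory → Prop}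
    (h : b.Holds m → Ex p m B Q) (h' : ¬ b.Holds m → Ex q m B Q) :
    Ex (.cond b p q) m (b.cost + B) Q := by
  by_cases hb : b.Holds m
  · obtain ⟨T, m', hr, hT, hq⟩ := h hb
    exact ⟨_, m', .cond_true hb hr, by omega, hq⟩
  · obtain ⟨T, m', hr, hT, hq⟩ := h' hb
    exact ⟨_, m', .cond_false hb hr, by omega, hq⟩

/-- The program text contains no loop. -/
def Program.straight : Program → Bool
  | .skip => true
  | .nset _ _ _ => true
  | .rset _ _ _ => true
  | .seq p q => p.straight && q.straight
  | .cond _ p q => p.straight && q.straight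
  | .loop _ _ => false

/-- A bound for the number of steps of a program without loops. -/
def Program.bound : Program → ℕ
  | .skip => 1
  | .nset _ i e => i.cost + e.cost + 1
  | .rset _ i e => i.cost + e.cost + 1
  | .seq p q => p.bound + q.bound
  | .cond b p q => b.cost + (p.bound + q.bound)
  | .loop _ _ => 0

open Classical in
/-- The effect of a program without loops. -/
noncomputable def Program.exec : Program → Memory → Memory
  | .skip, m => m
  | .nset a i e, m => m.setNat a (i.eval m) (e.eval m)
  | .rset a i e, m => m.setReal a (i.eval m) (e.eval m)
  | .seq p q, m => q.exec (p.exec m)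
  | .cond b p q, m => if b.Holds m then p.exec m else q.exec m
  | .loop _ _, m => m

/-- Reduces loop-free code to symbolic execution: the final memory is the explicit `exec`, which
`simp` evaluates. The bound adds both branches of a conditional, which is wasteful but harmless. -/
theorem Ex.straight (p : Program) (m : Memory) (h : p.straight = true) :
    Ex p m p.bound (fun m' => m' = p.exec m) := by
  induction p generalizing m with
  | skip => exact ⟨_, _, .skip m, le_rfl, rfl⟩
  | nset a i e => exact ⟨_, _, .nset a i e m, le_rfl, rfl⟩
  | rset a i e => exact ⟨_, _, .rset a i e m, le_rfl, rfl⟩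
  | seq p q ihp ihq =>
    simp only [Program.straight, Bool.and_eq_true] at h
    exact (ihp m h.1).seq fun m' _ e => by subst e; exact ihq _ h.2
  | cond b p q ihp ihq =>
    simp only [Program.straight, Bool.and_eq_true] at h
    refine Ex.cond (fun hb => (ihp m h.1).mono (by omega) ?_)
      (fun hb => (ihq m h.2).mono (by omega) ?_)
    · rintro _ _ rfl; simp [Program.exec, hb]
    · rintro _ _ rfl; simp [Program.exec, hb]
  | loop b p _ => simp [Program.straight] at h

/-- The loop runs exactly `n` times, and the invariant is indexed by the number of completed rounds.
The step may use that the body has preserved everything it does not assign to. -/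
theorem Ex.loop {b : Test} {p : Program} {B n : ℕ} (Inv : ℕ → Memory → Prop) {m₀ : Memory}
    (h0 : Inv 0 m₀) (hn : ∀ m, Inv n m → ¬ b.Holds m)
    (hs : ∀ i < n, ∀ m, Inv i m → Keeps p m₀ m → b.Holds m ∧ Ex p m B (Inv (i + 1))) :
    Ex (.loop b p) m₀ (n * (b.cost + B) + b.cost) (Inv n) := by
  have key : ∀ d i m, i + d = n → Inv i m → Keeps p m₀ m →
      Ex (.loop b p) m (d * (b.cost + B) + b.cost) (Inv n) := by
    intro d
    induction d with
    | zero =>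
      rintro i m rfl hi -
      exact ⟨_, m, .loop_done (hn m hi), by omega, hi⟩
    | succ d ih =>
      intro i m hid hi hk
      obtain ⟨hb, T, m', hr, hT, hq⟩ := hs i (by omega) m hi hk
      obtain ⟨S, m'', hr', hS, hR⟩ := ih (i + 1) m' (by omega) hq (hk.trans hr.keeps)
      refine ⟨_, m'', .loop_step hb hr hr', ?_, hR⟩
      rw [Nat.succ_mul]; omega
  exact key n 0 m₀ (by omega) h0 (Keeps.refl _ _)

/-- `for c in 0, …, r - 1 do p`, where `c` and `r` are natural variables. -/
def forLoop (c r : ℕ) (p : Program) : Program :=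
  .nset c (.lit 0) (.lit 0) ;;
    .loop (.nlt (nvar c) (nvar r)) (p ;; .nset c (.lit 0) (.add (nvar c) (.lit 1)))

/-- The invariant must survive assignments to the counter, which is initialised before the loop and
increased after each body. The overhead of `11` per round is the test (`5`) and the increment (`6`);
the final `8` is the initialisation (`3`) and the last test (`5`). -/
theorem Ex.forLoop {c r n B : ℕ} {p : Program} {m₀ : Memory} (Inv : ℕ → Memory → Prop)
    (hn : m₀.nat r 0 = n) (hrc : r ≠ c) (hr : p.keepsNat r = true) (hc : p.keepsNat c = true)
    (hInv : ∀ i m v, Inv i m → Inv i (m.setNat c 0 v)) (h0 : Inv 0 m₀)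
    (hs : ∀ i < n, ∀ m, Inv i m → m.nat c 0 = i → Keeps (forLoop c r p) m₀ m →
      Ex p m B (Inv (i + 1))) :
    Ex (forLoop c r p) m₀ (n * (B + 11) + 8) (Inv n) := by
  have h1 := Ex.straight (.nset c (.lit 0) (.lit 0)) m₀ rfl
  refine (h1.seq (B' := n * (5 + (B + 6)) + 5) (R := Inv n) ?_).mono ?_ fun _ _ h => h
  · rintro m₁ - rfl
    simp only [Program.exec, NExpr.eval]
    have hk1 : Keeps (RealRAM.forLoop c r p) m₀ (m₀.setNat c 0 0) := by
      refine ⟨fun a ha => setNat_nat_ne _ _ _ ?_, fun _ _ => rfl⟩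
      rintro rfl; simp [RealRAM.forLoop, Program.keepsNat] at ha
    have hmono : ∀ {m m' : Memory},
        Keeps (p ;; .nset c (.lit 0) (.add (nvar c) (.lit 1))) m m' →
        Keeps (RealRAM.forLoop c r p) m m' := by
      intro m m' h
      refine h.mono ?_ ?_ <;> intro a ha <;>
        simp_all [RealRAM.forLoop, Program.keepsNat, Program.keepsReal]
    refine (Ex.loop (n := n) (B := B + 6) (b := .nlt (nvar c) (nvar r))
      (fun i m => Inv i m ∧ m.nat c 0 = i ∧ m.nat r 0 = n) ?_ ?_ ?_).mono ?_ ?_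
    · refine ⟨hInv _ _ _ h0, by simp [setNat_nat], ?_⟩
      simp [setNat_nat, hrc, hn]
    · rintro m ⟨-, h1, h2⟩
      simp [Test.Holds, NExpr.eval, h1, h2]
    · rintro i hi m ⟨h1, h2, h3⟩ hk
      refine ⟨by simp [Test.Holds, NExpr.eval, h2, h3, hi], ?_⟩
      refine ((hs i hi m h1 h2 (hk1.trans (hmono hk))).seq (B' := 6) fun m' hk' hi' =>
        (Ex.straight (.nset c (.lit 0) (.add (nvar c) (.lit 1))) m' rfl).mono ?_ ?_).mono
          le_rfl fun _ _ h => h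
      · simp [Program.bound, NExpr.cost]
      · rintro _ - rfl
        simp only [Program.exec, NExpr.eval]
        refine ⟨hInv _ _ _ hi', ?_, ?_⟩
        · simp [setNat_nat, hk'.1 c hc, h2]
        · simp [setNat_nat, hrc, hk'.1 r hr, h3]
    · simp [Test.cost, NExpr.cost]
    · exact fun m' _ h => h.1
  · simp only [Program.bound, NExpr.cost]; ring_nf; omega

end RealRAM


/-! ## Subroutines -/

namespace RealRAM

/-- Find the positions of a minimum and of a maximum of the first entries of an array. -/
def minMax (arr n : ℕ) : Program :=
  .nset 11 (.lit 0) (.lit 0) ;; .nset 12 (.lit 0) (.lit 0) ;;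
  forLoop 10 n
    (.cond (.rlt (entry arr 10) (entry arr 11)) (.nset 11 (.lit 0) (nvar 10)) .skip ;;
     .cond (.rlt (entry arr 12) (entry arr 10)) (.nset 12 (.lit 0) (nvar 10)) .skip)

theorem minMax_spec {arr r n : ℕ} {m : Memory} (hn : m.nat r 0 = n) (hpos : 0 < n) (h10 : r ≠ 10)
    (h11 : r ≠ 11) (h12 : r ≠ 12) :
    Ex (minMax arr r) m (40 * n + 20) fun m' => m'.nat 11 0 < n ∧ m'.nat 12 0 < n ∧
      ∀ j < n, m.real arr (m'.nat 11 0) ≤ m.real arr j ∧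
        m.real arr j ≤ m.real arr (m'.nat 12 0) := by
  refine ((Ex.straight (.nset 11 (.lit 0) (.lit 0)) m rfl).seq fun m₁ k₁ e₁ =>
    (Ex.straight (.nset 12 (.lit 0) (.lit 0)) m₁ rfl).seq fun m₂ k₂ e₂ =>
    Ex.forLoop (n := n) (B := 28)
    (fun i m' => m'.nat 11 0 < n ∧ m'.nat 12 0 < n ∧
      ∀ j < i, m.real arr (m'.nat 11 0) ≤ m.real arr j ∧
        m.real arr j ≤ m.real arr (m'.nat 12 0)) ?_ h10 ?_ rfl ?_ ?_ ?_).mono ?_ ?_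
  · subst e₁ e₂
    simp [Program.exec, NExpr.eval, setNat_nat, h11, h12, hn]
  · simp [Program.keepsNat, h11.symm, h12.symm]
  · intro i m v h; simpa [setNat_nat] using h
  · subst e₁ e₂
    simp [Program.exec, NExpr.eval, setNat_nat, hpos]
  · rintro i hi m' ⟨h1, h2, h3⟩ hc hk
    have hreal : m'.real = m.real := by
      funext a
      rw [hk.2 a rfl, k₂.2 a rfl, k₁.2 a rfl]
    refine (Ex.straight _ m' rfl).mono ?_ ?_
    · simp [Program.bound, Test.cost, RExpr.cost, NExpr.cost]
    · rintro m'' - rfl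
      by_cases c1 : m.real arr i < m.real arr (m'.nat 11 0) <;>
      by_cases c2 : m.real arr (m'.nat 12 0) < m.real arr i <;>
      simp only [Program.exec, NExpr.eval, RExpr.eval, Test.Holds, hc, hreal, c1, c2, setNat_nat,
        setNat_real, if_true, if_false,
        and_true, Nat.reduceEqDiff] <;>
      refine ⟨by assumption, by assumption, fun j hj => ?_⟩ <;>
      rcases Nat.lt_succ_iff_lt_or_eq.1 hj with hj | rfl
      all_goals
        first
          | (have := h3 j hj; constructor <;> linarith)
          | constructor <;> linarith
  · simp [Program.bound, NExpr.cost]; ring_nf; omega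
  · intro _ _ h; exact h

/-- Set the first entries of the array `dst` to the values of the expression `e`, which may refer to
the running index, the natural variable `10`. -/
def fill (n dst : ℕ) (e : RExpr) : Program :=
  forLoop 10 n (.rset dst (nvar 10) e)

/-- The expression is evaluated while `dst` is being overwritten, so `he` requires its value in
every memory that agrees with `m` outside `dst` and the counter. -/
theorem fill_spec {r n dst : ℕ} {e : RExpr} {m : Memory} (g : ℕ → ℝ) (hn : m.nat r 0 = n)
    (h10 : r ≠ 10)
    (he : ∀ m', Keeps (fill r dst e) m m' → ∀ i < n, m'.nat 10 0 = i → e.eval m' = g i) :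
    Ex (fill r dst e) m (n * (e.cost + 14) + 8) fun m' => ∀ i < n, m'.real dst i = g i := by
  refine (Ex.forLoop (n := n) (B := e.cost + 3) (fun i m' => ∀ j < i, m'.real dst j = g j)
    hn h10 rfl rfl ?_ ?_ ?_).mono (by ring_nf; omega) fun _ _ h => h
  · intro i m v h; exact h
  · intro j hj; omega
  · intro i hi m' h hc hk
    refine (Ex.straight _ m' rfl).mono ?_ ?_
    · simp [Program.bound, NExpr.cost]; omega
    · rintro m'' - rfl j hj
      simp only [Program.exec, NExpr.eval, hc, setReal_real]
      rcases Nat.lt_succ_iff_lt_or_eq.1 hj with hj | rfl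
      · rw [if_neg (by omega)]; exact h j hj
      · rw [if_pos (by simp)]; exact he m' hk _ hi hc

/-- The entry of the real array `a` whose address is one more than the natural variable `i`. -/
abbrev entry' (a i : ℕ) : RExpr := .get a (.add (nvar i) (.lit 1))

/-- The height at the abscissa in the real variable `a` of the line through two successive points
with coordinates in the arrays `x` and `y`. -/
def edgeHeight (x y a : ℕ) : RExpr :=
  .add (entry y 10) (.div (.mul (.sub (entry' y 10) (entry y 10)) (.sub (rvar a) (entry x 10)))
    (.sub (entry' x 10) (entry x 10)))

/-- Intersect the vertical line at the abscissa in the real variable `a` with the polygon with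
vertex coordinates in `x` and `y`, starting with the bounds in `bot` and `top`. -/
def slice (x y n a bot top lo hi : ℕ) : Program :=
  .rset lo (.lit 0) (rvar bot) ;; .rset hi (.lit 0) (rvar top) ;;
  forLoop 10 n
    (.cond (.rlt (entry x 10) (entry' x 10))
      (.cond (.rlt (rvar lo) (edgeHeight x y a)) (.rset lo (.lit 0) (edgeHeight x y a)) .skip)
      .skip ;;
     .cond (.rlt (entry' x 10) (entry x 10))
      (.cond (.rlt (edgeHeight x y a) (rvar hi)) (.rset hi (.lit 0) (edgeHeight x y a)) .skip)
      .skip)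

/-- `lo` is a running maximum over the edges that go to the right and `hi` a running minimum over
those that go to the left. An equivalence for all `b` stays meaningful when the interval is empty.
-/
theorem slice_spec {x y r n a bot top lo hi : ℕ} {m : Memory} (hn : m.nat r 0 = n) (h10 : r ≠ 10)
    (hd : [x, y, a, bot, top, lo, hi].Nodup) :
    Ex (slice x y r a bot top lo hi) m (250 * n + 30) fun m' => ∀ b,
      m'.real lo 0 ≤ b ∧ b ≤ m'.real hi 0 ↔ (m.real bot 0 ≤ b ∧ b ≤ m.real top 0) ∧
      ∀ i < n,
      (m.real x i < m.real x (i + 1) →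
        m.real y i + (m.real y (i + 1) - m.real y i) * (m.real a 0 - m.real x i) /
          (m.real x (i + 1) - m.real x i) ≤ b) ∧
      (m.real x (i + 1) < m.real x i →
        b ≤ m.real y i + (m.real y (i + 1) - m.real y i) * (m.real a 0 - m.real x i) /
          (m.real x (i + 1) - m.real x i)) := by
  simp only [List.nodup_cons, List.mem_cons, not_or, List.not_mem_nil, List.nodup_nil,
    not_false_eq_true, and_true] at hd
  obtain ⟨⟨-, -, -, -, hxl, hxh⟩, ⟨-, -, -, hyl, hyh⟩, ⟨-, -, hal, hah⟩, ⟨-, hbl, hbh⟩, ⟨htl, hth⟩,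
    hlh⟩ := hd
  obtain ⟨E, hE⟩ : ∃ E : ℕ → ℝ, E = fun i => m.real y i + (m.real y (i + 1) - m.real y i) *
    (m.real a 0 - m.real x i) / (m.real x (i + 1) - m.real x i) := ⟨_, rfl⟩
  refine ((Ex.straight (.rset lo (.lit 0) (rvar bot)) m rfl).seq fun m₁ k₁ e₁ =>
    (Ex.straight (.rset hi (.lit 0) (rvar top)) m₁ rfl).seq fun m₂ k₂ e₂ =>
    Ex.forLoop (n := n) (B := 239)
    (fun k m' => ∀ b, m'.real lo 0 ≤ b ∧ b ≤ m'.real hi 0 ↔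
      (m.real bot 0 ≤ b ∧ b ≤ m.real top 0) ∧ ∀ i < k,
      (m.real x i < m.real x (i + 1) → E i ≤ b) ∧
      (m.real x (i + 1) < m.real x i → b ≤ E i)) ?_ h10 rfl rfl ?_ ?_ ?_).mono ?_ ?_
  · rw [k₂.1 r rfl, k₁.1 r rfl, hn]
  · intro i m v h; exact h
  · subst e₁ e₂
    simp [Program.exec, NExpr.eval, RExpr.eval, setReal_real, hlh, htl]
  · intro k hk m' h hc hkp
    have hkeep : ∀ d, d ≠ lo → d ≠ hi → m'.real d = m.real d := by
      intro d h1 h2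
      rw [hkp.2 d, k₂.2 d, k₁.2 d] <;>
        simp [Program.keepsReal, forLoop, h1.symm, h2.symm]
    refine (Ex.straight _ m' rfl).mono ?_ ?_
    · simp [Program.bound, Test.cost, RExpr.cost, NExpr.cost, edgeHeight]
    · rintro m'' - rfl b
      have hx := hkeep x hxl hxh
      have hy := hkeep y hyl hyh
      have ha := hkeep a hal hah
      have hlh' : hi ≠ lo := Ne.symm hlh
      have hEe' : (edgeHeight x y a).eval m' = E k := by
        simp [edgeHeight, RExpr.eval, NExpr.eval, hc, hx, hy, ha, hE]
      have hsplit : (∀ i < k + 1, (m.real x i < m.real x (i + 1) → E i ≤ b) ∧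
          (m.real x (i + 1) < m.real x i → b ≤ E i)) ↔
          (∀ i < k, (m.real x i < m.real x (i + 1) → E i ≤ b) ∧
          (m.real x (i + 1) < m.real x i → b ≤ E i)) ∧
          (m.real x k < m.real x (k + 1) → E k ≤ b) ∧
          (m.real x (k + 1) < m.real x k → b ≤ E k) :=
        Nat.forall_lt_succ_right
      rw [hsplit, ← and_assoc, ← h b]
      rcases lt_trichotomy (m.real x k) (m.real x (k + 1)) with c | c | c
      · by_cases c2 : m'.real lo 0 < E k
        · simp [Program.exec, NExpr.eval, RExpr.eval, Test.Holds, hc, hx, c, c.not_gt, hEe', c2,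
            setReal_real, setReal_nat, hxl, hlh']
          constructor
          · rintro ⟨h1, h2⟩; exact ⟨⟨by linarith, h2⟩, h1⟩
          · rintro ⟨⟨h1, h2⟩, h3⟩; exact ⟨h3, h2⟩
        · simp [Program.exec, NExpr.eval, RExpr.eval, Test.Holds, hc, hx, c, c.not_gt, hEe', c2]
          intro h1 h2; linarith
      · simp [Program.exec, NExpr.eval, RExpr.eval, Test.Holds, hc, hx, c]
      · by_cases c2 : E k < m'.real hi 0
        · simp [Program.exec, NExpr.eval, RExpr.eval, Test.Holds, hc, hx, c, c.not_gt, hEe', c2,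
            setReal_real, hlh]
          intro h1 h2; linarith
        · simp [Program.exec, NExpr.eval, RExpr.eval, Test.Holds, hc, hx, c, c.not_gt, hEe', c2]
          intro h1 h2; linarith
  · simp [Program.bound, NExpr.cost, RExpr.cost]; ring_nf; omega
  · intro m' _ h; simpa only [hE] using h

end RealRAM


/-! ## Writing out the polygons -/

namespace RealRAM

/-- The start values `bot` and `top` stand in for infinite bounds; since they enclose the polygon,
they do not affect the slice. Vertices strictly on both sides make the slice non-degenerate, as
needed for the strict turns of the rectangles built from it. -/
theorem slice_polygon (P : ConvexPolygon) {x y r a bot top lo hi : ℕ} {m : Memory}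
    (hn : m.nat r 0 = P.size) (h10 : r ≠ 10) (hd : [x, y, a, bot, top, lo, hi].Nodup)
    (hx : ∀ i ≤ P.size, m.real x i = (P.cyc i).1) (hy : ∀ i ≤ P.size, m.real y i = (P.cyc i).2)
    (hb : ∀ p ∈ P.region, m.real bot 0 ≤ p.2 ∧ p.2 ≤ m.real top 0)
    (hl : ∃ i, (P.vertex i).1 < m.real a 0) (hr : ∃ i, m.real a 0 < (P.vertex i).1) :
    Ex (slice x y r a bot top lo hi) m (250 * P.size + 30) fun m' =>
      m'.real lo 0 < m'.real hi 0 ∧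
      ∀ b, m'.real lo 0 ≤ b ∧ b ≤ m'.real hi 0 ↔ (m.real a 0, b) ∈ P.region := by
  obtain ⟨i, hi'⟩ := hl
  obtain ⟨j, hj⟩ := hr
  refine (slice_spec hn h10 hd).mono le_rfl fun m' _ h => ?_
  have key : ∀ b, m'.real lo 0 ≤ b ∧ b ≤ m'.real hi 0 ↔ (m.real a 0, b) ∈ P.region := by
    intro b
    rw [h b, P.mem_vertical_iff (P.vertex_mem i) (P.vertex_mem j) hi'.le hj.le b]
    have hiff : (∀ i < P.size,
        (m.real x i < m.real x (i + 1) → m.real y i + (m.real y (i + 1) - m.real y i) *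
          (m.real a 0 - m.real x i) / (m.real x (i + 1) - m.real x i) ≤ b) ∧
        (m.real x (i + 1) < m.real x i → b ≤ m.real y i + (m.real y (i + 1) - m.real y i) *
          (m.real a 0 - m.real x i) / (m.real x (i + 1) - m.real x i))) ↔ _ :=
      forall₂_congr fun i hi => by
        rw [hx i hi.le, hx (i + 1) hi, hy i hi.le, hy (i + 1) hi]
    rw [hiff, and_iff_right_iff_imp]
    intro hmem
    exact hb (m.real a 0, b) ((P.mem_vertical_iff (P.vertex_mem i) (P.vertex_mem j) hi'.le hj.le b).2
      hmem)
  refine ⟨?_, key⟩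
  obtain ⟨b, b', hne, h1, h2⟩ := P.exists_ne_mem_vertical hi' hj
  rw [← key] at h1 h2
  rcases lt_or_gt_of_ne hne with h | h <;> linarith [h1.1, h1.2, h2.1, h2.2]

/-- The real coordinate of the `k`-th of `N` midpoints of the unit interval starting at `a`. -/
noncomputable def sampleAt (a : ℝ) (N k : ℕ) : ℝ := a + (k + 1 / 2) / N

/-- The memory is prepared for writing out the polygons: it contains the coordinates of the
polygons `P` and `R`, the matrix with rows `e` and `f` for the final change of coordinates, and the
weight `w`. In mode `0` the sample lines in both directions are attached to `P`, in mode `1` those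
in one direction are attached to `R`. -/
structure Ready (m : Memory) (P R : ConvexPolygon) (N mode : ℕ) (a₀ b₀ w : ℝ) (e f : ℝ × ℝ) :
    Prop where
  sizeP : m.nat 15 0 = P.size
  sizeR : m.nat 16 0 = R.size
  number : m.nat 17 0 = N
  modeEq : m.nat 18 0 = mode
  numberReal : m.real 20 0 = N
  cast : ∀ k ≤ N, m.real 26 k = k
  weight : m.real 46 0 = w
  e1 : m.real 47 0 = e.1
  e2 : m.real 48 0 = e.2
  f1 : m.real 49 0 = f.1
  f2 : m.real 50 0 = f.2
  startA : m.real 51 0 = a₀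
  startB : m.real 52 0 = b₀
  px : ∀ i ≤ P.size, m.real 53 i = (P.cyc i).1
  py : ∀ i ≤ P.size, m.real 54 i = (P.cyc i).2
  rx : ∀ i ≤ R.size, m.real 55 i = (R.cyc i).1
  ry : ∀ i ≤ R.size, m.real 56 i = (R.cyc i).2
  boundP : ∀ p ∈ P.region, m.real 57 0 ≤ p.2 ∧ p.2 ≤ m.real 58 0
  boundR : ∀ p ∈ R.region, m.real 59 0 ≤ p.2 ∧ p.2 ≤ m.real 60 0

theorem Ready.of_keeps {p : Program} {m m' : Memory} {P R : ConvexPolygon} {N mode : ℕ}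
    {a₀ b₀ w : ℝ} {e f : ℝ × ℝ} (h : Ready m P R N mode a₀ b₀ w e f) (hk : Keeps p m m')
    (hn : [15, 16, 17, 18].all p.keepsNat = true)
    (hr : [20, 26, 46, 47, 48, 49, 50, 51, 52, 53, 54, 55, 56, 57, 58, 59, 60].all p.keepsReal =
      true) : Ready m' P R N mode a₀ b₀ w e f := by
  simp only [List.all_cons, List.all_nil, Bool.and_eq_true, and_true] at hn hr
  obtain ⟨n1, n2, n3, n4⟩ := hn
  obtain ⟨r1, r2, r3, r4, r5, r6, r7, r8, r9, r10, r11, r12, r13, r14, r15, r16, r17⟩ := hr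
  constructor
  · rw [hk.1 _ n1]; exact h.sizeP
  · rw [hk.1 _ n2]; exact h.sizeR
  · rw [hk.1 _ n3]; exact h.number
  · rw [hk.1 _ n4]; exact h.modeEq
  · rw [hk.2 _ r1]; exact h.numberReal
  · rw [hk.2 _ r2]; exact h.cast
  · rw [hk.2 _ r3]; exact h.weight
  · rw [hk.2 _ r4]; exact h.e1
  · rw [hk.2 _ r5]; exact h.e2
  · rw [hk.2 _ r6]; exact h.f1
  · rw [hk.2 _ r7]; exact h.f2
  · rw [hk.2 _ r8]; exact h.startA
  · rw [hk.2 _ r9]; exact h.startB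
  · rw [hk.2 _ r10]; exact h.px
  · rw [hk.2 _ r11]; exact h.py
  · rw [hk.2 _ r12]; exact h.rx
  · rw [hk.2 _ r13]; exact h.ry
  · rw [hk.2 _ r14, hk.2 _ r15]; exact h.boundP
  · rw [hk.2 _ r16, hk.2 _ r17]; exact h.boundR

/-! ### The polygon belonging to one sample point. -/

/-- The translations for which the sample point `(k, l)` lies in both polygons. -/
def hits (P R : ConvexPolygon) (mode : ℕ) (a b : ℝ) : Set (ℝ × ℝ) :=
  {z | (a, b + mode * z.2) ∈ P.region ∧ (b + mode * z.2 - z.2, z.1 - a) ∈ R.region}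

/-- The memory contains the vertices of the polygon `Q` and the weight of the polygon. -/
def Template (m : Memory) (Q : ConvexPolygon) (w : ℝ) (D : Set (ℝ × ℝ)) : Prop :=
  m.nat 20 0 = Q.size ∧ (∀ j < Q.size, m.real 67 j = (Q.cyc j).1 ∧ m.real 68 j = (Q.cyc j).2) ∧
  ∀ z, m.real 69 0 * Q.region.indicator 1 z = w * D.indicator 1 z

/-- The polygon of the sample point whose both coordinates are attached to `P`. -/
def pointTemplate : Program :=
  fill 16 67 (.add (rvar 61) (entry 56 10)) ;; fill 16 68 (.sub (rvar 62) (entry 55 10)) ;;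
  .nset 20 (.lit 0) (nvar 16) ;;
  .cond (.conj (.neg (.rlt (rvar 62) (rvar 63))) (.neg (.rlt (rvar 64) (rvar 62))))
    (.rset 69 (.lit 0) (rvar 46)) (.rset 69 (.lit 0) (.lit 0))

/-- With both coordinates anchored, whether the point lies in `P` does not depend on the
translation. A point outside still produces a polygon, but with weight `0`, so that the number of
polygons is always `N ^ 2`. -/
theorem pointTemplate_spec {m : Memory} {P R : ConvexPolygon} {N : ℕ}
    {a₀ b₀ w : ℝ} {e f : ℝ × ℝ} (h : Ready m P R N 0 a₀ b₀ w e f) {a b : ℝ}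
    (ha : m.real 61 0 = a) (hb : m.real 62 0 = b)
    (hs : ∀ y, m.real 63 0 ≤ y ∧ y ≤ m.real 64 0 ↔ (a, y) ∈ P.region) :
    Ex pointTemplate m (50 * R.size + 50) fun m' => ∃ Q : ConvexPolygon, Q.size = R.size ∧
      Template m' Q w (hits P R 0 a b) := by
  classical
  refine ((fill_spec (n := R.size) (fun i => a + (R.cyc i).2) h.sizeR (by decide) ?_).seq
    fun m₁ k₁ h₁ => (fill_spec (n := R.size) (fun i => b - (R.cyc i).1) ?_ (by decide) ?_).seq
    fun m₂ k₂ h₂ => (Ex.straight _ m₂ rfl).mono le_rfl ?_).le ?_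
  · intro m' hk i hi hc
    simp only [RExpr.eval, NExpr.eval, hc, hk.2 61 rfl, hk.2 56 rfl, ha, h.ry i hi.le]
  · rw [k₁.1 16 rfl]; exact h.sizeR
  · intro m' hk i hi hc
    simp only [RExpr.eval, NExpr.eval, hc, hk.2 62 rfl, hk.2 55 rfl, k₁.2 62 rfl, k₁.2 55 rfl, hb,
      h.rx i hi.le]
  · have hrot : 0 < cross (0, -1) (1, 0) := by norm_num [cross]
    rintro m' hk rfl
    obtain ⟨Q, hQ⟩ : ∃ Q, Q = (R.map (0, -1) (1, 0) hrot).reflect (a, b) := ⟨_, rfl⟩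
    have hsize : Q.size = R.size := by rw [hQ]; rfl
    have hcyc : ∀ j < R.size, Q.cyc j = (a + (R.cyc j).2, b - (R.cyc j).1) := by
      intro j hj
      rw [Q.cyc_of_lt (by omega), R.cyc_of_lt hj, Prod.ext_iff]
      subst hQ
      simp [ConvexPolygon.reflect, ConvexPolygon.map, coords, dot]
    have hmem : ∀ z, z ∈ Q.region ↔ (b - z.2, z.1 - a) ∈ R.region := by
      intro z
      rw [hQ, ConvexPolygon.mem_reflect, ← R.coords_mem_map hrot]
      simp [coords, dot, Prod.sub_def]
    have hw : m₂.real 46 0 = w := by rw [k₂.2 46 rfl, k₁.2 46 rfl]; exact h.weight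
    have hbb : m₂.real 62 0 = b := by rw [k₂.2 62 rfl, k₁.2 62 rfl]; exact hb
    have e3 : m₂.real 63 = m.real 63 := by rw [k₂.2 63 rfl, k₁.2 63 rfl]
    have e4 : m₂.real 64 = m.real 64 := by rw [k₂.2 64 rfl, k₁.2 64 rfl]
    have hiff := hs b
    refine ⟨Q, hsize, ?_, ?_, ?_⟩
    · rw [hsize, ← h.sizeR, ← k₁.1 16 rfl, ← k₂.1 16 rfl]
      simp only [Program.exec, NExpr.eval, RExpr.eval]
      split_ifs with hc <;> simp [hc, setNat_nat, setReal_nat]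
    · intro j hj
      rw [hsize] at hj
      rw [hcyc j hj, ← h₁ j hj, ← h₂ j hj, ← k₂.2 67 rfl, hk.2 67 rfl, hk.2 68 rfl]
      exact ⟨rfl, rfl⟩
    · intro z
      have hD : (z ∈ hits P R 0 a b) ↔ (a, b) ∈ P.region ∧ z ∈ Q.region := by
        rw [hmem]; simp [hits]
      simp only [Set.indicator_apply, hD, ← hiff]
      simp only [Program.exec, Test.Holds, NExpr.eval, RExpr.eval, setNat_real, hbb, e3, e4, hw,
        not_lt]
      by_cases c : m.real 63 0 ≤ b ∧ b ≤ m.real 64 0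
      · simp only [c, and_self, if_true, true_and, setReal_real]
      · simp only [c, if_false, false_and, setReal_real]
        simp
  · simp [Program.bound, RExpr.cost, NExpr.cost, Test.cost]; ring_nf; omega

/-- The rectangle of the sample point of which one coordinate is attached to either polygon. -/
def rectTemplate : Program :=
  slice 55 56 16 62 59 60 65 66 ;;
  .rset 67 (.lit 0) (.add (rvar 61) (rvar 65)) ;; .rset 68 (.lit 0) (.sub (rvar 63) (rvar 62)) ;;
  .rset 67 (.lit 1) (.add (rvar 61) (rvar 66)) ;; .rset 68 (.lit 1) (.sub (rvar 63) (rvar 62)) ;;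
  .rset 67 (.lit 2) (.add (rvar 61) (rvar 66)) ;; .rset 68 (.lit 2) (.sub (rvar 64) (rvar 62)) ;;
  .rset 67 (.lit 3) (.add (rvar 61) (rvar 65)) ;; .rset 68 (.lit 3) (.sub (rvar 64) (rvar 62)) ;;
  .nset 20 (.lit 0) (.lit 4) ;; .rset 69 (.lit 0) (rvar 46)

/-- In mode `1` the condition from `P` involves only `z.2` and the one from `R` only `z.1`; the
rectangle is the product of a slice of each polygon. -/
theorem rectTemplate_spec {m : Memory} {P R : ConvexPolygon} {N : ℕ}
    {a₀ b₀ w : ℝ} {e f : ℝ × ℝ} (h : Ready m P R N 1 a₀ b₀ w e f) {a b : ℝ}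
    (ha : m.real 61 0 = a) (hb : m.real 62 0 = b) (hlt : m.real 63 0 < m.real 64 0)
    (hs : ∀ y, m.real 63 0 ≤ y ∧ y ≤ m.real 64 0 ↔ (a, y) ∈ P.region)
    (hl : ∃ i, (R.vertex i).1 < b) (hr : ∃ i, b < (R.vertex i).1) :
    Ex rectTemplate m (250 * R.size + 200) fun m' => ∃ Q : ConvexPolygon, Q.size = 4 ∧
      Template m' Q w (hits P R 1 a b) := by
  classical
  refine ((slice_polygon R h.sizeR (by decide) (by decide) h.rx h.ry h.boundR (by rwa [hb])
    (by rwa [hb])).seq fun m₁ k₁ h₁ => (Ex.straight _ m₁ rfl).mono le_rfl ?_).le ?_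
  · rintro m' hk ⟨⟩
    obtain ⟨hlt2, hs2⟩ := h₁
    rw [hb] at hs2
    have e1 : m₁.real 61 0 = a := by rw [k₁.2 61 rfl, ha]
    have e2 : m₁.real 62 0 = b := by rw [k₁.2 62 rfl, hb]
    have e3 : m₁.real 63 0 = m.real 63 0 := by rw [k₁.2 63 rfl]
    have e4 : m₁.real 64 0 = m.real 64 0 := by rw [k₁.2 64 rfl]
    have hw : m₁.real 46 0 = w := by rw [k₁.2 46 rfl]; exact h.weight
    generalize m.real 63 0 = lo at *
    generalize m.real 64 0 = hi at *
    generalize hlo2 : m₁.real 65 0 = lo2 at *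
    generalize hhi2 : m₁.real 66 0 = hi2 at *
    refine ⟨ConvexPolygon.rect (a + lo2) (a + hi2) (lo - b) (hi - b) (by linarith) (by linarith),
      rfl, ?_, ?_, ?_⟩
    · simp [Program.exec, NExpr.eval, setNat_nat, setReal_nat, ConvexPolygon.rect]
    · intro j hj
      rw [ConvexPolygon.cyc_of_lt _ hj]
      simp only [ConvexPolygon.rect] at hj
      interval_cases j <;>
        simp [Program.exec, NExpr.eval, RExpr.eval, setNat_real, setReal_real, ConvexPolygon.rect,
          e1, e2, e3, e4, hlo2, hhi2]
    · intro z
      have hD : (z ∈ hits P R 1 a b) ↔ z ∈ (ConvexPolygon.rect (a + lo2) (a + hi2) (lo - b) (hi - b)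
          (by linarith) (by linarith)).region := by
        rw [ConvexPolygon.mem_rect]
        simp only [hits, Set.mem_ofPred_eq, Nat.cast_one, one_mul, add_sub_cancel_right]
        rw [← hs, ← hs2]
        constructor
        · rintro ⟨⟨_, _⟩, _, _⟩; refine ⟨⟨?_, ?_⟩, ?_, ?_⟩ <;> linarith
        · rintro ⟨⟨_, _⟩, _, _⟩; refine ⟨⟨?_, ?_⟩, ?_, ?_⟩ <;> linarith
      simp only [Set.indicator_apply, hD]
      simp [Program.exec, NExpr.eval, RExpr.eval, setNat_real, setReal_real, hw]
  · simp [Program.bound, RExpr.cost, NExpr.cost]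

end RealRAM


/-! ### Appending polygons to the output, and the loop over the sample points. -/

namespace RealRAM

/-- Append the polygon in the template to the output. -/
def emit : Program :=
  forLoop 10 20
    (.rset 5 (.add (nvar 19) (nvar 10))
      (.add (.mul (rvar 47) (entry 67 10)) (.mul (rvar 48) (entry 68 10))) ;;
     .rset 6 (.add (nvar 19) (nvar 10))
      (.add (.mul (rvar 49) (entry 67 10)) (.mul (rvar 50) (entry 68 10)))) ;;
  .nset 3 (nvar 2) (nvar 20) ;; .rset 12 (nvar 2) (rvar 69) ;;
  .nset 19 (.lit 0) (.add (nvar 19) (nvar 20)) ;; .nset 2 (.lit 0) (.add (nvar 2) (.lit 1))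

/-- The `i`-th polygon of the output, each having `sz` vertices, is the image of a polygon that
contributes `w` exactly on the set `D`. -/
def Emitted (m : Memory) (sz i : ℕ) (w : ℝ) (e f : ℝ × ℝ) (D : Set (ℝ × ℝ)) : Prop :=
  ∃ Q : ConvexPolygon, Q.size = sz ∧ m.nat 3 i = sz ∧
    (∀ j < sz, m.real 5 (i * sz + j) = (coords e f (Q.cyc j)).1 ∧
      m.real 6 (i * sz + j) = (coords e f (Q.cyc j)).2) ∧
    ∀ z, m.real 12 i * Q.region.indicator 1 z = w * D.indicator 1 z

/-- The output so far consists of the `M` polygons that belong to the sets `D i`. -/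
def Output (m : Memory) (sz M : ℕ) (w : ℝ) (e f : ℝ × ℝ) (D : ℕ → Set (ℝ × ℝ)) : Prop :=
  m.nat 2 0 = M ∧ m.nat 19 0 = M * sz ∧ ∀ i < M, Emitted m sz i w e f (D i)

theorem Output.of_keeps {p : Program} {m m' : Memory} {sz M : ℕ} {w : ℝ} {e f : ℝ × ℝ}
    {D : ℕ → Set (ℝ × ℝ)} (h : Output m sz M w e f D) (hk : Keeps p m m')
    (hn : [2, 3, 19].all p.keepsNat = true) (hr : [5, 6, 12].all p.keepsReal = true) :
    Output m' sz M w e f D := by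
  simp only [List.all_cons, List.all_nil, Bool.and_eq_true, and_true] at hn hr
  obtain ⟨n1, n2, n3⟩ := hn
  obtain ⟨r1, r2, r3⟩ := hr
  unfold Output Emitted
  rw [hk.1 _ n1, hk.1 _ n2, hk.1 _ n3, hk.2 _ r1, hk.2 _ r2, hk.2 _ r3]
  exact h

theorem emit_spec {m : Memory} {sz M : ℕ} {w : ℝ} {e f : ℝ × ℝ} {D : ℕ → Set (ℝ × ℝ)}
    (h : Output m sz M w e f D) {Q : ConvexPolygon} (hsz : Q.size = sz)
    (hQ : Template m Q w (D M)) (e1 : m.real 47 0 = e.1) (e2 : m.real 48 0 = e.2)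
    (f1 : m.real 49 0 = f.1) (f2 : m.real 50 0 = f.2) :
    Ex emit m (70 * sz + 50) fun m' => Output m' sz (M + 1) w e f D := by
  subst hsz
  obtain ⟨ho1, ho2, ho3⟩ := h
  obtain ⟨hq1, hq2, hq3⟩ := hQ
  -- The first clause protects the vertices of the earlier polygons: all polygons have the same
  -- number of vertices, so those occupy exactly the addresses below `M * Q.size`.
  refine ((Ex.forLoop (n := Q.size) (B := 48) (fun k m' =>
      (∀ q < M * Q.size, m'.real 5 q = m.real 5 q ∧ m'.real 6 q = m.real 6 q) ∧
      ∀ j < k, m'.real 5 (M * Q.size + j) = (coords e f (Q.cyc j)).1 ∧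
        m'.real 6 (M * Q.size + j) = (coords e f (Q.cyc j)).2) hq1 (by decide) rfl rfl ?_ ?_
      ?_).seq fun m₁ k₁ h₁ => (Ex.straight _ m₁ rfl).mono le_rfl ?_).le ?_
  · intro i m v h; exact h
  · exact ⟨fun q _ => ⟨rfl, rfl⟩, fun j hj => by omega⟩
  · rintro k hk m' ⟨h1, h2⟩ hc hkp
    refine (Ex.straight _ m' rfl).mono (by simp [Program.bound, NExpr.cost, RExpr.cost]) ?_
    rintro m'' - rfl
    obtain ⟨t1, t2⟩ := hq2 k hk
    simp only [Program.exec, NExpr.eval, RExpr.eval, setReal_nat, hc, hkp.1 19 rfl, ho2,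
      setReal_real, hkp.2 47 rfl, hkp.2 48 rfl, hkp.2 49 rfl, hkp.2 50 rfl, hkp.2 67 rfl,
      hkp.2 68 rfl, e1, e2, f1, f2, t1, t2, Nat.reduceEqDiff, false_and, if_false, true_and]
    constructor
    · intro q hq
      have : q ≠ M * Q.size + k := by omega
      simpa [this] using h1 q hq
    · intro j hj
      rcases Nat.lt_succ_iff_lt_or_eq.1 hj with hj | rfl
      · simpa [hj.ne] using h2 j hj
      · simp [coords, dot]
  · rintro m' hk rfl
    obtain ⟨h1, h2⟩ := h₁
    have n2 : m₁.nat 2 0 = M := by rw [k₁.1 2 rfl, ho1]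
    have n20 : m₁.nat 20 0 = Q.size := by rw [k₁.1 20 rfl, hq1]
    have n19 : m₁.nat 19 0 = M * Q.size := by rw [k₁.1 19 rfl, ho2]
    refine ⟨?_, ?_, ?_⟩
    · simp [Program.exec, NExpr.eval, setNat_nat, setReal_nat, n2]
    · simp [Program.exec, NExpr.eval, setNat_nat, setReal_nat, n19, n20]; ring
    · intro i hi
      unfold Emitted
      rw [hk.2 5 rfl, hk.2 6 rfl]
      rcases Nat.lt_succ_iff_lt_or_eq.1 hi with hi | rfl
      · obtain ⟨Q', s1, s2, s3, s4⟩ := ho3 i hi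
        refine ⟨Q', s1, ?_, ?_, ?_⟩
        · simp [Program.exec, NExpr.eval, setNat_nat, setReal_nat, n2, hi.ne, k₁.1 3 rfl, s2]
        · intro j hj
          have hlt : i * Q.size + j < M * Q.size := by
            calc i * Q.size + j < (i + 1) * Q.size := by rw [Nat.succ_mul]; omega
              _ ≤ M * Q.size := Nat.mul_le_mul_right _ hi
          rw [(h1 _ hlt).1, (h1 _ hlt).2]
          exact s3 j hj
        · intro z
          rw [← s4 z]
          simp [Program.exec, NExpr.eval, RExpr.eval, setNat_nat, setNat_real, setReal_real, n2,
            hi.ne, k₁.2 12 rfl]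
      · refine ⟨Q, rfl, ?_, h2, ?_⟩
        · simp [Program.exec, NExpr.eval, setNat_nat, setReal_nat, n2, n20]
        · intro z
          rw [← hq3 z]
          simp [Program.exec, NExpr.eval, RExpr.eval, setNat_nat, setNat_real, setReal_real, n2,
            k₁.2 69 rfl]
  · simp [Program.bound, NExpr.cost, RExpr.cost]; ring_nf; omega

/-- Compute the coordinates of the sample point with the indices in the natural variables `13` and
`14`. -/
def locate : Program :=
  .rset 61 (.lit 0) (.add (rvar 51) (.div (.add (entry 26 13) (.lit (1 / 2))) (rvar 20))) ;;
  .rset 62 (.lit 0) (.add (rvar 52) (.div (.add (entry 26 14) (.lit (1 / 2))) (rvar 20)))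

theorem locate_spec {m : Memory} {P R : ConvexPolygon} {N mode k l : ℕ} {a₀ b₀ w : ℝ}
    {e f : ℝ × ℝ} (h : Ready m P R N mode a₀ b₀ w e f) (hk : m.nat 13 0 = k) (hl : m.nat 14 0 = l)
    (hkN : k < N) (hlN : l < N) :
    Ex locate m 40 fun m' =>
      m'.real 61 0 = sampleAt a₀ N k ∧ m'.real 62 0 = sampleAt b₀ N l := by
  refine (Ex.straight _ m rfl).mono (by simp [locate, Program.bound, NExpr.cost, RExpr.cost]) ?_
  rintro m' - rfl
  constructor <;>
  simp [locate, Program.exec, NExpr.eval, RExpr.eval, setReal_real, setReal_nat, h.startA, h.startB, hk, hl,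
    h.cast k hkN.le, h.cast l hlN.le, h.numberReal, sampleAt]

/-- Treat the sample point with the indices in the natural variables `13` and `14`. -/
def treat : Program :=
  locate ;; slice 53 54 15 61 57 58 63 64 ;;
  .cond (.nlt (nvar 18) (.lit 1)) pointTemplate rectTemplate ;; emit

theorem treat_spec {m : Memory} {P R : ConvexPolygon} {N mode k l sz M : ℕ} {a₀ b₀ w : ℝ}
    {e f : ℝ × ℝ} {D : ℕ → Set (ℝ × ℝ)} (h : Ready m P R N mode a₀ b₀ w e f)
    (ho : Output m sz M w e f D) (hk : m.nat 13 0 = k) (hl : m.nat 14 0 = l) (hkN : k < N)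
    (hlN : l < N)
    (hD : D M = hits P R mode (sampleAt a₀ N k) (sampleAt b₀ N l))
    (hP : (∃ i, (P.vertex i).1 < sampleAt a₀ N k) ∧ ∃ i, sampleAt a₀ N k < (P.vertex i).1)
    (hmode : mode = 0 ∧ sz = R.size ∨ mode = 1 ∧ sz = 4 ∧
      (∃ i, (R.vertex i).1 < sampleAt b₀ N l) ∧ ∃ i, sampleAt b₀ N l < (R.vertex i).1) :
    Ex treat m (300 * P.size + 500 * R.size + 1000) fun m' => Output m' sz (M + 1) w e f D := by
  have hsz : sz ≤ R.size + 4 := by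
    rcases hmode with h | h <;> omega
  refine ((locate_spec h hk hl hkN hlN).seq
    (B' := 250 * P.size + 30 + (4 + (250 * R.size + 200) + (70 * sz + 50)))
    fun m₁ k₁ h₁ => ?_).le (by omega)
  obtain ⟨ha₁, hb₁⟩ := h₁
  have r₁ := h.of_keeps k₁ rfl rfl
  refine (slice_polygon P r₁.sizeP (by decide) (by decide) r₁.px r₁.py r₁.boundP (by rw [ha₁]; exact hP.1)
    (by rw [ha₁]; exact hP.2)).seq fun m₂ k₂ h₂ => ?_
  rw [ha₁] at h₂
  obtain ⟨hlt, hs⟩ := h₂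
  have r₂ := r₁.of_keeps k₂ rfl rfl
  have ha₂ : m₂.real 61 0 = sampleAt a₀ N k := by rw [k₂.2 61 rfl, ha₁]
  have hb₂ : m₂.real 62 0 = sampleAt b₀ N l := by rw [k₂.2 62 rfl, hb₁]
  refine (Ex.cond (B := 250 * R.size + 200) (Q := fun m' => ∃ Q : ConvexPolygon, Q.size = sz ∧
      Template m' Q w (D M)) ?_ ?_).seq fun m₃ k₃ h₃ => ?_
  · intro hc
    simp only [Test.Holds, NExpr.eval, r₂.modeEq, Nat.lt_one_iff] at hc
    subst hc
    obtain ⟨-, rfl⟩ | ⟨h0, -⟩ := hmode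
    · rw [hD]
      exact (pointTemplate_spec r₂ ha₂ hb₂ hs).le (by omega)
    · omega
  · intro hc
    simp only [Test.Holds, NExpr.eval, r₂.modeEq, Nat.lt_one_iff] at hc
    obtain ⟨h0, -⟩ | ⟨rfl, rfl, h1, h2⟩ := hmode
    · exact absurd h0 hc
    · rw [hD]
      exact (rectTemplate_spec r₂ ha₂ hb₂ hlt hs h1 h2).le (by omega)
  · obtain ⟨Q, hQ, hT⟩ := h₃
    have r₃ := r₂.of_keeps k₃ rfl rfl
    have ho₃ := ((ho.of_keeps k₁ rfl rfl).of_keeps k₂ rfl rfl).of_keeps k₃ rfl rfl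
    exact emit_spec ho₃ hQ hT r₃.e1 r₃.e2 r₃.f1 r₃.f2

/-- Treat all the sample points. -/
def treatAll : Program := forLoop 13 17 (forLoop 14 17 treat)

/-- The sample point `(k, l)` yields polygon number `k * N + l`, whence the quotient and remainder
in the conclusion. -/
theorem treatAll_spec {m : Memory} {P R : ConvexPolygon} {N mode sz : ℕ} {a₀ b₀ w : ℝ}
    {e f : ℝ × ℝ} (h : Ready m P R N mode a₀ b₀ w e f) (hN : 0 < N)
    (ho : m.nat 2 0 = 0) (ho' : m.nat 19 0 = 0)
    (hP : ∀ k < N, (∃ i, (P.vertex i).1 < sampleAt a₀ N k) ∧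
      ∃ i, sampleAt a₀ N k < (P.vertex i).1)
    (hmode : mode = 0 ∧ sz = R.size ∨ mode = 1 ∧ sz = 4 ∧ ∀ l < N,
      (∃ i, (R.vertex i).1 < sampleAt b₀ N l) ∧ ∃ i, sampleAt b₀ N l < (R.vertex i).1) :
    Ex treatAll m (N * (N * (300 * P.size + 500 * R.size + 1011) + 19) + 8) fun m' =>
      Output m' sz (N * N) w e f fun i =>
        hits P R mode (sampleAt a₀ N (i / N)) (sampleAt b₀ N (i % N)) := by
  obtain ⟨D, hD⟩ : ∃ D : ℕ → Set (ℝ × ℝ), D = fun i =>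
        hits P R mode (sampleAt a₀ N (i / N)) (sampleAt b₀ N (i % N)) := ⟨_, rfl⟩
  have hset : ∀ (c : ℕ) (m : Memory) (M v : ℕ), c = 13 ∨ c = 14 → Output m sz M w e f D →
      Output (m.setNat c 0 v) sz M w e f D := by
    intro c m M v hc h
    have h2 : (m.setNat c 0 v).nat 2 = m.nat 2 := setNat_nat_ne _ _ _ (by omega)
    have h3 : (m.setNat c 0 v).nat 3 = m.nat 3 := setNat_nat_ne _ _ _ (by omega)
    have h19 : (m.setNat c 0 v).nat 19 = m.nat 19 := setNat_nat_ne _ _ _ (by omega)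
    unfold Output Emitted
    rw [h2, h3, h19, setNat_real]
    exact h
  rw [← hD]
  refine (Ex.forLoop (n := N) (B := N * (300 * P.size + 500 * R.size + 1011) + 8)
    (fun k m' => Output m' sz (k * N) w e f D) h.number (by decide) rfl rfl
    (fun k m v => hset 13 m _ v (Or.inl rfl)) ?_ ?_).le (by ring_nf; omega)
  · exact ⟨by simpa using ho, by simpa using ho', fun i hi => by omega⟩
  · intro k hk m₁ h₁ hc₁ hk₁
    have r₁ := h.of_keeps hk₁ rfl rfl
    refine ((Ex.forLoop (n := N) (B := 300 * P.size + 500 * R.size + 1000)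
      (fun l m' => Output m' sz (k * N + l) w e f D) r₁.number (by decide) rfl rfl
      (fun k m v => hset 14 m _ v (Or.inr rfl)) ?_ ?_).mono (by ring_nf; omega) ?_)
    · simpa using h₁
    · intro l hl m₂ h₂ hc₂ hk₂
      have r₂ := r₁.of_keeps hk₂ rfl rfl
      refine treat_spec (k := k) (l := l) (M := k * N + l) r₂ h₂ ?_ hc₂ hk hl ?_ (hP k hk) ?_
      · rw [hk₂.1 13 rfl, hc₁]
      · have e1 : (k * N + l) / N = k := by
          rw [mul_comm, Nat.mul_add_div hN, Nat.div_eq_of_lt hl, add_zero]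
        have e2 : (k * N + l) % N = l := by
          rw [mul_comm, Nat.mul_add_mod, Nat.mod_eq_of_lt hl]
        rw [hD]; simp only [e1, e2]
      · rcases hmode with h0 | ⟨h1, h2, h3⟩
        · exact Or.inl h0
        · exact Or.inr ⟨h1, h2, h3 l hl⟩
    · intro m' _ h'
      have : (k + 1) * N = k * N + N := by ring
      rwa [this]

end RealRAM


/-! ## The choice of the coordinates -/

/-- The functional `α` takes values in an interval of length `1` on the polygon, and attains both
ends. -/
def UnitWidth (P : ConvexPolygon) (α : ℝ × ℝ) : Prop :=
  ∃ i j, dot α (P.vertex j) = dot α (P.vertex i) + 1 ∧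
    ∀ k, dot α (P.vertex i) ≤ dot α (P.vertex k) ∧ dot α (P.vertex k) ≤ dot α (P.vertex j)

/-- The polygon has horizontal extent `a`, unit width in the direction `γ`, and contains a translate
of the box `|x| ≤ a / 8`, `|γ| ≤ 1 / 8`. -/
structure BoxFrame (P : ConvexPolygon) (a : ℝ) (γ : ℝ × ℝ) : Prop where
  pos : 0 < a
  pos' : 0 < γ.2
  width : UnitWidth P (1 / a, 0)
  width' : UnitWidth P γ
  box : ∃ c, ∀ v : ℝ × ℝ, |v.1| ≤ a / 8 → |dot γ v| ≤ 1 / 8 → c + v ∈ P.region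

/-- The functional is `orient p q` up to a constant, divided by its range `g` on the polygon, where
`p` and `q` are the leftmost and rightmost vertices. -/
theorem BoxFrame.of_extreme (P : ConvexPolygon) {i j k l : Fin P.size} {p q : ℝ × ℝ}
    (hp : P.vertex i = p) (hq : P.vertex j = q)
    (hx : ∀ n, (P.vertex i).1 ≤ (P.vertex n).1 ∧ (P.vertex n).1 ≤ (P.vertex j).1)
    (ho : ∀ n, orient p q (P.vertex k) ≤ orient p q (P.vertex n) ∧
      orient p q (P.vertex n) ≤ orient p q (P.vertex l)) {g : ℝ}
    (hg : g = orient p q (P.vertex l) - orient p q (P.vertex k)) :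
    BoxFrame P (q.1 - p.1) ((p.2 - q.2) / g, (q.1 - p.1) / g) := by
  have h3 := P.three_le
  have hpq : p.1 < q.1 := by
    by_contra! hle
    rw [← hp, ← hq] at hle
    have hc : ∀ n, (P.vertex n).1 = (P.vertex i).1 := fun n =>
      le_antisymm ((hx n).2.trans hle) (hx n).1
    have := P.ccw ⟨0, by omega⟩ ⟨1, by omega⟩ ⟨2, by omega⟩ (by simp) (by simp)
    simp [orient, hc] at this
  have hij : i ≠ j := by rintro rfl; rw [hp] at hq; subst hq; exact lt_irrefl _ hpq
  have hop : orient p q p = 0 := by simp only [orient]; ring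
  have hoi := ho i
  rw [hp, hop] at hoi
  obtain ⟨n, hin, hjn⟩ := P.exists_third i j
  have hon := ho n
  have hne := P.orient_ne_zero hij hin hjn
  rw [hp, hq] at hne
  have hgpos : 0 < g := by
    rcases lt_or_gt_of_ne hne with h | h <;> linarith [hoi.1, hoi.2, hon.1, hon.2]
  have ha : 0 < q.1 - p.1 := by linarith
  -- The larger side of the chord accounts for at least half of the range. This loss of a factor two
  -- turns the `1 / 4` of `exists_box` into the `1 / 8` required here.
  obtain ⟨z, hz1, hz2⟩ : ∃ z : Fin P.size, orient p q (P.vertex z) ≠ 0 ∧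
      g / 2 ≤ |orient p q (P.vertex z)| := by
    rcases le_total (g / 2) (orient p q (P.vertex l)) with h | h
    · exact ⟨l, by linarith, h.trans (le_abs_self _)⟩
    · refine ⟨k, by linarith, le_trans ?_ (neg_le_abs _)⟩
      linarith
  have hdot : ∀ v, dot ((p.2 - q.2) / g, (q.1 - p.1) / g) v =
      ((q.1 - p.1) * v.2 - (q.2 - p.2) * v.1) / g := by
    intro v; simp only [dot]; field_simp; ring
  have hdo : ∀ v, dot ((p.2 - q.2) / g, (q.1 - p.1) / g) v = (orient p q v +
      ((q.1 - p.1) * p.2 - (q.2 - p.2) * p.1)) / g := by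
    intro v; rw [hdot]; simp only [orient]; ring
  refine ⟨ha, div_pos ha hgpos, ⟨i, j, ?_, fun n => ?_⟩, ⟨k, l, ?_, fun n => ?_⟩, ?_⟩
  · simp only [dot, hp, hq]; field_simp; ring
  · simp only [dot, zero_mul, add_zero]
    have := hx n
    exact ⟨mul_le_mul_of_nonneg_left this.1 (by positivity),
      mul_le_mul_of_nonneg_left this.2 (by positivity)⟩
  · rw [hdo, hdo, ← sub_eq_iff_eq_add', ← sub_div, div_eq_one_iff_eq hgpos.ne']; linarith
  · rw [hdo, hdo, hdo]
    have := ho n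
    constructor <;> gcongr
    exacts [this.1, this.2]
  · have hxz := hx z
    rw [hp, hq] at hxz
    obtain ⟨c, hc⟩ := P.exists_box (hp ▸ P.vertex_mem i) (hq ▸ P.vertex_mem j) (P.vertex_mem z) hpq
      hxz.1 hxz.2 hz1
    refine ⟨c, fun v hv1 hv2 => hc v hv1 ?_⟩
    rw [hdot, abs_div, abs_of_pos hgpos, div_le_iff₀ hgpos] at hv2
    linarith

/-- The functionals `α` and `β` are suitable coordinates: they have unit width on the polygons to
which the sample lines are attached, and the unit cell is comparable to the maximal overlap. -/
structure Suitable (A B : ConvexPolygon) (α β : ℝ × ℝ) (mode : ℕ) : Prop where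
  pos : 0 < cross α β
  width : UnitWidth A α
  width' : mode = 0 ∧ UnitWidth A β ∨ mode = 1 ∧ UnitWidth B β
  box : ∃ c c' : ℝ × ℝ, ∀ v, |dot α v| ≤ 1 / 16 → |dot β v| ≤ 1 / 16 →
    c + v ∈ A.region ∧ c' + v ∈ B.region

theorem UnitWidth.neg {P : ConvexPolygon} {α : ℝ × ℝ} (h : UnitWidth P α) : UnitWidth P (-α) := by
  obtain ⟨i, j, h1, h2⟩ := h
  have e : ∀ v, dot (-α) v = -dot α v := by intro v; simp only [dot, Prod.fst_neg, Prod.snd_neg]; ring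
  refine ⟨j, i, ?_, fun k => ?_⟩
  · rw [e, e]; linarith
  · rw [e, e, e]; have := h2 k; constructor <;> linarith

section Choice

variable {A B : ConvexPolygon} {a a' : ℝ} {γ γ' : ℝ × ℝ}

/-- Since `a ≤ a'`, the horizontal condition from `A` implies the one from `B`, so three functionals
suffice instead of four. -/
theorem BoxFrame.exists_common_box (hA : BoxFrame A a γ) (hB : BoxFrame B a' γ') (h : a ≤ a') :
    ∃ c c' : ℝ × ℝ, ∀ v, |dot (1 / a, 0) v| ≤ 1 / 8 → |dot γ v| ≤ 1 / 8 → |dot γ' v| ≤ 1 / 8 →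
      c + v ∈ A.region ∧ c' + v ∈ B.region := by
  obtain ⟨c, hc⟩ := hA.box
  obtain ⟨c', hc'⟩ := hB.box
  refine ⟨c, c', fun v h1 h2 h3 => ?_⟩
  have h4 : |v.1| ≤ a / 8 := by
    have e : dot (1 / a, 0) v = v.1 / a := by simp only [dot]; ring
    rw [e, abs_div, abs_of_pos hA.pos, div_le_iff₀ hA.pos] at h1
    linarith
  exact ⟨hc v h4 h2, hc' v (by linarith) h3⟩

theorem cross_swap (α β : ℝ × ℝ) : cross β α = -cross α β := by simp only [cross]; ring

theorem cross_neg_left (α β : ℝ × ℝ) : cross (-α) β = -cross α β := by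
  simp only [cross, Prod.fst_neg, Prod.snd_neg]; ring

theorem dot_neg (α v : ℝ × ℝ) : dot (-α) v = -dot α v := by
  simp only [dot, Prod.fst_neg, Prod.snd_neg]; ring

/-- The first two functionals determine the largest area. -/
theorem suitable_of_first (hA : BoxFrame A a γ) (hB : BoxFrame B a' γ') (h : a ≤ a')
    (h1 : cross (1 / a, 0) γ' ≤ cross (1 / a, 0) γ) (h2 : |cross γ γ'| ≤ cross (1 / a, 0) γ) :
    Suitable A B (1 / a, 0) γ 0 := by
  have ha := hA.pos
  have p1 : 0 < cross (1 / a, 0) γ := by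
    simp only [cross, zero_mul, sub_zero]; exact mul_pos (by positivity) hA.pos'
  have p2 : 0 < cross (1 / a, 0) γ' := by
    simp only [cross, zero_mul, sub_zero]; exact mul_pos (by positivity) hB.pos'
  obtain ⟨c, c', hc⟩ := hA.exists_common_box hB h
  refine ⟨p1, hA.width, Or.inl ⟨rfl, hA.width'⟩, c, c', fun v hv1 hv2 =>
    hc v (by linarith) (by linarith) (abs_dot_le_of_cross_le p1 ?_ ?_ hv1 hv2)⟩
  · rwa [cross_swap, abs_neg]
  · rwa [abs_of_pos p2]

/-- The first and the third functional determine the largest area. -/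
theorem suitable_of_second (hA : BoxFrame A a γ) (hB : BoxFrame B a' γ') (h : a ≤ a')
    (h1 : cross (1 / a, 0) γ ≤ cross (1 / a, 0) γ') (h2 : |cross γ γ'| ≤ cross (1 / a, 0) γ') :
    Suitable A B (1 / a, 0) γ' 1 := by
  have ha := hA.pos
  have p1 : 0 < cross (1 / a, 0) γ := by
    simp only [cross, zero_mul, sub_zero]; exact mul_pos (by positivity) hA.pos'
  have p2 : 0 < cross (1 / a, 0) γ' := by
    simp only [cross, zero_mul, sub_zero]; exact mul_pos (by positivity) hB.pos'
  obtain ⟨c, c', hc⟩ := hA.exists_common_box hB h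
  refine ⟨p2, hA.width, Or.inr ⟨rfl, hB.width'⟩, c, c', fun v hv1 hv2 =>
    hc v (by linarith) (abs_dot_le_of_cross_le p2 h2 ?_ hv1 hv2) (by linarith)⟩
  rwa [abs_of_pos p1]

/-- The last two functionals determine the largest area. -/
theorem suitable_of_third (hA : BoxFrame A a γ) (hB : BoxFrame B a' γ') (h : a ≤ a') {δ : ℝ × ℝ}
    (hδ : δ = γ ∨ δ = -γ) (h1 : cross (1 / a, 0) γ ≤ cross δ γ')
    (h2 : cross (1 / a, 0) γ' ≤ cross δ γ') : Suitable A B δ γ' 1 := by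
  have ha := hA.pos
  have p1 : 0 < cross (1 / a, 0) γ := by
    simp only [cross, zero_mul, sub_zero]; exact mul_pos (by positivity) hA.pos'
  have p2 : 0 < cross (1 / a, 0) γ' := by
    simp only [cross, zero_mul, sub_zero]; exact mul_pos (by positivity) hB.pos'
  have p3 : 0 < cross δ γ' := by linarith
  obtain ⟨c, c', hc⟩ := hA.exists_common_box hB h
  have hw : UnitWidth A δ := by
    rcases hδ with rfl | rfl
    exacts [hA.width', hA.width'.neg]
  have hd : ∀ v, |dot γ v| = |dot δ v| := by
    intro v
    rcases hδ with rfl | rfl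
    exacts [rfl, by rw [dot_neg, abs_neg]]
  have hx : |cross δ (1 / a, 0)| = cross (1 / a, 0) γ := by
    rcases hδ with rfl | rfl
    · rw [cross_swap, abs_neg, abs_of_pos p1]
    · rw [cross_neg_left, abs_neg, cross_swap, abs_neg, abs_of_pos p1]
  refine ⟨p3, hw, Or.inr ⟨rfl, hB.width'⟩, c, c', fun v hv1 hv2 =>
    hc v (abs_dot_le_of_cross_le p3 ?_ ?_ hv1 hv2) (by rw [hd]; linarith) (by linarith)⟩
  · rwa [abs_of_pos p2]
  · rwa [hx]

end Choice

/-- The first part puts the intersection into the unit window of the grid; the second shows that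
sample lines strictly inside that window separate vertices, so that slices along them are
non-degenerate. -/
theorem UnitWidth.bounds {P : ConvexPolygon} {α : ℝ × ℝ} (h : UnitWidth P α) {a : ℝ}
    (ha : (∃ i, dot α (P.vertex i) = a) ∧ ∀ i, a ≤ dot α (P.vertex i)) :
    (∀ p ∈ P.region, a ≤ dot α p ∧ dot α p ≤ a + 1) ∧
    ∀ s, a < s → s < a + 1 → (∃ i, dot α (P.vertex i) < s) ∧ ∃ i, s < dot α (P.vertex i) := by
  obtain ⟨i, j, h1, h2⟩ := h
  obtain ⟨⟨k, hk⟩, h3⟩ := ha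
  have e : a = dot α (P.vertex i) := le_antisymm (h3 i) (hk ▸ (h2 k).1)
  constructor
  · have hcv : Convex ℝ {p | a ≤ dot α p ∧ dot α p ≤ a + 1} := by
      intro x hx y hy s t hs ht hst
      simp only [Set.mem_ofPred_eq] at *
      have hd : dot α (s • x + t • y) = s * dot α x + t * dot α y := by
        simp only [dot, Prod.fst_add, Prod.snd_add, Prod.smul_fst, Prod.smul_snd, smul_eq_mul]; ring
      rw [hd]
      obtain rfl : s = 1 - t := by linarith
      constructor <;> nlinarith [hx.1, hx.2, hy.1, hy.2]
    refine fun p hp => ConvexPolygon.region_subset hcv (fun n hn => ?_) hp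
    rw [P.cyc_of_lt hn]
    exact ⟨h3 _, by rw [e, ← h1]; exact (h2 _).2⟩
  · intro s hs1 hs2
    exact ⟨⟨k, by rwa [hk]⟩, ⟨j, by rw [h1, ← e]; exact hs2⟩⟩


/-! ## Preparations of the algorithm -/

namespace RealRAM

/-- Determine the number of sample lines in either direction, and tabulate the conversion of natural
to real numbers. -/
def countLines : Program :=
  .rset 20 (.lit 0) (.lit 1) ;; .nset 17 (.lit 0) (.lit 1) ;;
  .rset 26 (.lit 0) (.lit 0) ;; .rset 26 (.lit 1) (.lit 1) ;;
  .loop (.rlt (.mul (rvar 20) (rvar 0)) (.lit 128))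
    (.nset 17 (.lit 0) (.add (nvar 17) (.lit 1)) ;; .rset 20 (.lit 0) (.add (rvar 20) (.lit 1)) ;;
     .rset 26 (nvar 17) (rvar 20))

/-- `N` is `⌈128 / ε⌉`. Having neither rounding nor conversion between the two sorts, the machine
counts upwards in both simultaneously and records the real values in a table for later use as grid
indices. -/
theorem countLines_spec {m : Memory} {ε : ℝ} (hε : m.real 0 0 = ε) (hpos : 0 < ε) (h1 : ε < 1) :
    ∃ N : ℕ, 0 < N ∧ 128 ≤ N * ε ∧ N * ε ≤ 129 ∧ Ex countLines m (60 * N + 60) fun m' =>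
      m'.nat 17 0 = N ∧ m'.real 20 0 = N ∧ ∀ k ≤ N, m'.real 26 k = k := by
  -- The counter starts at `1`, so the loop makes one round fewer than the ceiling.
  obtain ⟨n, hn⟩ : ∃ n, ⌈128 / ε⌉₊ = n + 1 := by
    refine Nat.exists_eq_add_one_of_ne_zero (Nat.ceil_pos.2 (by positivity)).ne'
  have hle : 128 / ε ≤ (n : ℝ) + 1 := by
    have := Nat.le_ceil (128 / ε); rw [hn] at this; exact_mod_cast this
  have hlt : (n : ℝ) < 128 / ε := by
    have := Nat.ceil_lt_add_one (show 0 ≤ 128 / ε by positivity)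
    rw [hn] at this; push_cast at this; linarith
  rw [div_le_iff₀ hpos] at hle
  rw [lt_div_iff₀ hpos] at hlt
  refine ⟨n + 1, Nat.succ_pos _, by push_cast; linarith, by push_cast; linarith, ?_⟩
  refine ((Ex.straight (.rset 20 (.lit 0) (.lit 1)) m rfl).seq fun m₁ k₁ e₁ =>
    (Ex.straight (.nset 17 (.lit 0) (.lit 1)) m₁ rfl).seq fun m₂ k₂ e₂ =>
    (Ex.straight (.rset 26 (.lit 0) (.lit 0)) m₂ rfl).seq fun m₃ k₃ e₃ =>
    (Ex.straight (.rset 26 (.lit 1) (.lit 1)) m₃ rfl).seq fun m₄ k₄ e₄ =>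
    ((Ex.loop (n := n) (B := 20) (fun i m' => m'.nat 17 0 = i + 1 ∧ m'.real 20 0 = i + 1 ∧
      m'.real 0 0 = ε ∧ ∀ k ≤ i + 1, m'.real 26 k = k) ?_ ?_ ?_).mono le_rfl ?_)).le ?_
  · subst e₁ e₂ e₃ e₄
    refine ⟨?_, ?_, ?_, fun k hk => ?_⟩
    · simp [Program.exec, NExpr.eval, setNat_nat, setReal_nat]
    · simp [Program.exec, NExpr.eval, RExpr.eval, setNat_real, setReal_real]
    · simp [Program.exec, NExpr.eval, RExpr.eval, setNat_real, setReal_real, hε]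
    · interval_cases k <;> simp [Program.exec, NExpr.eval, RExpr.eval, setReal_real]
  · rintro m' ⟨-, h2, h3, -⟩
    simp only [Test.Holds, RExpr.eval, NExpr.eval, h2, h3, not_lt]
    push_cast; linarith
  · rintro i hi m' ⟨h4, h2, h3, h5⟩ -
    constructor
    · simp only [Test.Holds, RExpr.eval, NExpr.eval, h2, h3]
      have : (i : ℝ) + 1 ≤ n := by exact_mod_cast hi
      push_cast; nlinarith
    · refine (Ex.straight _ m' rfl).mono (by simp [Program.bound, NExpr.cost, RExpr.cost]) ?_
      rintro m'' - rfl
      refine ⟨?_, ?_, ?_, fun k hk => ?_⟩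
      · simp [Program.exec, NExpr.eval, setNat_nat, setReal_nat, h4]
      · simp [Program.exec, NExpr.eval, RExpr.eval, setNat_real, setReal_real, h2]
      · simp [Program.exec, NExpr.eval, RExpr.eval, setNat_real, setReal_real, h3]
      · rcases hk.lt_or_eq with hk | rfl
        · simp [Program.exec, NExpr.eval, RExpr.eval, setNat_real, setReal_real, setNat_nat,
            setReal_nat, h4, h5 k (by omega), show k ≠ i + 1 + 1 by omega]
        · simp [Program.exec, NExpr.eval, RExpr.eval, setNat_real, setReal_real, setNat_nat,
            setReal_nat, h4, h2]
  · rintro m' - ⟨h4, h2, -, h5⟩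
    exact ⟨h4, by rw [h2]; push_cast; ring, h5⟩
  · simp [Program.bound, Test.cost, NExpr.cost, RExpr.cost]; omega

/-- The arrays `x` and `y` contain the coordinates of the vertices of the polygon, and the natural
variable `r` their number. -/
structure Holds (m : Memory) (P : ConvexPolygon) (x y r : ℕ) : Prop where
  size : m.nat r 0 = P.size
  x_eq : ∀ i : Fin P.size, m.real x i = (P.vertex i).1
  y_eq : ∀ i : Fin P.size, m.real y i = (P.vertex i).2

theorem Holds.of_keeps {p : Program} {m m' : Memory} {P : ConvexPolygon} {x y r : ℕ}
    (h : Holds m P x y r) (hk : Keeps p m m') (hn : p.keepsNat r = true)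
    (hr : (p.keepsReal x && p.keepsReal y) = true) : Holds m' P x y r := by
  rw [Bool.and_eq_true] at hr
  exact ⟨by rw [hk.1 _ hn]; exact h.size, by rw [hk.2 _ hr.1]; exact h.x_eq,
    by rw [hk.2 _ hr.2]; exact h.y_eq⟩

/-- Copy a polygon. -/
def copy (x y r x' y' r' : ℕ) : Program :=
  .nset r' (.lit 0) (nvar r) ;; fill r x' (entry x 10) ;; fill r y' (entry y 10)

theorem copy_spec {m : Memory} {P : ConvexPolygon} {x y r x' y' r' : ℕ} (h : Holds m P x y r)
    (hd : [x, y, x', y'].Nodup) (hr : [10, r, r'].Nodup) :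
    Ex (copy x y r x' y' r') m (40 * P.size + 30) fun m' => Holds m' P x' y' r' := by
  simp only [List.nodup_cons, List.mem_cons, not_or, List.not_mem_nil, List.nodup_nil,
    not_false_eq_true, and_true] at hd hr
  obtain ⟨⟨hxy, hxx', hxy'⟩, ⟨hyx', hyy'⟩, hxy''⟩ := hd
  obtain ⟨⟨h10, h10'⟩, hrr'⟩ := hr
  refine ((Ex.straight (.nset r' (.lit 0) (nvar r)) m rfl).seq fun m₁ k₁ h₁ =>
    (fill_spec (n := P.size) (fun i => m.real x i) ?_ (Ne.symm h10) ?_).seq fun m₂ k₂ h₂ =>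
    ((fill_spec (n := P.size) (fun i => m.real y i) ?_ (Ne.symm h10) ?_).mono le_rfl
      fun m₃ k₃ h₃ => ?_)).le ?_
  · rw [k₁.1 r (by simp [Program.keepsNat, Ne.symm hrr']), h.size]
  · intro m' hk i hi hc
    simp only [RExpr.eval, NExpr.eval, hc]
    rw [hk.2 x (by simp [fill, forLoop, Program.keepsReal, Ne.symm hxx']), k₁.2 x rfl]
  · rw [k₂.1 r (by simp [fill, forLoop, Program.keepsNat, h10]),
      k₁.1 r (by simp [Program.keepsNat, Ne.symm hrr']), h.size]
  · intro m' hk i hi hc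
    simp only [RExpr.eval, NExpr.eval, hc]
    rw [hk.2 y (by simp [fill, forLoop, Program.keepsReal, Ne.symm hyy']),
      k₂.2 y (by simp [fill, forLoop, Program.keepsReal, Ne.symm hyx']), k₁.2 y rfl]
  · refine ⟨?_, fun i => ?_, fun i => ?_⟩
    · rw [k₃.1 r' (by simp [fill, forLoop, Program.keepsNat, h10']),
        k₂.1 r' (by simp [fill, forLoop, Program.keepsNat, h10']), h₁]
      simp [Program.exec, NExpr.eval, setNat_nat, h.size]
    · rw [k₃.2 x' (by simp [fill, forLoop, Program.keepsReal, Ne.symm hxy'']), h₂ i i.2]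
      exact h.x_eq i
    · rw [h₃ i i.2]; exact h.y_eq i
  · simp [Program.bound, NExpr.cost, RExpr.cost]; ring_nf; omega

/-- Compute the horizontal extent of a polygon. -/
def extent (x r d : ℕ) : Program :=
  minMax x r ;; .rset d (.lit 0) (.sub (entry x 12) (entry x 11))

/-- The horizontal extent of the polygon is `a`. -/
def IsExtent (P : ConvexPolygon) (a : ℝ) : Prop :=
  ∃ i j, a = (P.vertex j).1 - (P.vertex i).1 ∧
    ∀ k, (P.vertex i).1 ≤ (P.vertex k).1 ∧ (P.vertex k).1 ≤ (P.vertex j).1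

/-- The polygons are ordered by extents that `frame` later computes afresh; uniqueness carries the
inequality over. -/
theorem IsExtent.unique {P : ConvexPolygon} {a b : ℝ} (h : IsExtent P a) (h' : IsExtent P b) :
    a = b := by
  obtain ⟨i, j, rfl, h1⟩ := h
  obtain ⟨k, l, rfl, h2⟩ := h'
  linarith [(h1 k).1, (h1 l).2, (h2 i).1, (h2 j).2]

theorem extent_spec {m : Memory} {P : ConvexPolygon} {x y r d : ℕ} (h : Holds m P x y r)
    (h10 : r ≠ 10) (h11 : r ≠ 11) (h12 : r ≠ 12) :
    Ex (extent x r d) m (40 * P.size + 40) fun m' => IsExtent P (m'.real d 0) := by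
  refine ((minMax_spec (arr := x) h.size P.size_pos h10 h11 h12).seq fun m₁ k₁ h₁ =>
    (Ex.straight _ m₁ rfl).mono le_rfl ?_).le ?_
  · rintro m' - rfl
    obtain ⟨h1, h2, h3⟩ := h₁
    refine ⟨⟨_, h1⟩, ⟨_, h2⟩, ?_, fun k => ?_⟩
    · rw [← h.x_eq, ← h.x_eq, ← k₁.2 x rfl]
      simp [Program.exec, RExpr.eval, NExpr.eval, setReal_real]
    · rw [← h.x_eq, ← h.x_eq, ← h.x_eq]
      exact h3 k k.2
  · simp [Program.bound, RExpr.cost, NExpr.cost]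

/-- Load the coordinates of the extreme vertices. -/
def loadExtreme (x y : ℕ) : Program :=
  .rset 70 (.lit 0) (entry x 11) ;; .rset 71 (.lit 0) (entry y 11) ;;
  .rset 72 (.lit 0) (entry x 12) ;; .rset 73 (.lit 0) (entry y 12)

/-- Write the frame to the real variables `d`, `d₁`, `d₂`. -/
def writeFrame (d d₁ d₂ : ℕ) : Program :=
  .rset 74 (.lit 0) (.sub (entry 25 12) (entry 25 11)) ;;
  .rset d (.lit 0) (.sub (rvar 72) (rvar 70)) ;;
  .rset d₁ (.lit 0) (.div (.sub (rvar 71) (rvar 73)) (rvar 74)) ;;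
  .rset d₂ (.lit 0) (.div (.sub (rvar 72) (rvar 70)) (rvar 74))

/-- Compute a frame of a polygon: its horizontal extent and the coefficients of a functional. -/
def frame (x y r d d₁ d₂ : ℕ) : Program :=
  minMax x r ;; loadExtreme x y ;;
  fill r 25 (.sub (.mul (.sub (rvar 72) (rvar 70)) (.sub (entry y 10) (rvar 71)))
    (.mul (.sub (rvar 73) (rvar 71)) (.sub (entry x 10) (rvar 70)))) ;;
  minMax 25 r ;; writeFrame d d₁ d₂

theorem frame_spec {m : Memory} {P : ConvexPolygon} {x y r d d₁ d₂ : ℕ} (h : Holds m P x y r)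
    (hr : 12 < r) (hx : x < 25) (hy : y < 25) (hd : d < 70) (hd₁ : d₁ < 70)
    (hdd : [d, d₁, d₂].Nodup) :
    Ex (frame x y r d d₁ d₂) m (150 * P.size + 150) fun m' =>
      BoxFrame P (m'.real d 0) (m'.real d₁ 0, m'.real d₂ 0) ∧ IsExtent P (m'.real d 0) := by
  simp only [List.nodup_cons, List.mem_cons, not_or, List.not_mem_nil, List.nodup_nil,
    not_false_eq_true, and_true] at hdd
  obtain ⟨⟨hdd₁, hdd₂⟩, hd₁₂⟩ := hdd
  refine ((minMax_spec (arr := x) h.size P.size_pos (by omega) (by omega) (by omega)).seq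
    (B' := 110 * P.size + 130) fun m₁ k₁ h₁ => ?_).le (by omega)
  obtain ⟨hi, hj, hij⟩ := h₁
  have H₁ := h.of_keeps k₁ (by simp [minMax, forLoop, Program.keepsNat]; omega) rfl
  obtain ⟨i, hi'⟩ : ∃ i : Fin P.size, (i : ℕ) = m₁.nat 11 0 := ⟨⟨_, hi⟩, rfl⟩
  obtain ⟨j, hj'⟩ : ∃ j : Fin P.size, (j : ℕ) = m₁.nat 12 0 := ⟨⟨_, hj⟩, rfl⟩
  obtain ⟨p, hp⟩ : ∃ p, p = P.vertex i := ⟨_, rfl⟩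
  obtain ⟨q, hq⟩ : ∃ q, q = P.vertex j := ⟨_, rfl⟩
  have hext : ∀ n, (P.vertex i).1 ≤ (P.vertex n).1 ∧ (P.vertex n).1 ≤ (P.vertex j).1 := by
    intro n
    have := hij n n.2
    rwa [← hi', ← hj', h.x_eq, h.x_eq, h.x_eq] at this
  refine ((Ex.straight (loadExtreme x y) m₁ rfl).mono
    (Q' := fun m' => m'.real 70 0 = p.1 ∧ m'.real 71 0 = p.2 ∧ m'.real 72 0 = q.1 ∧
      m'.real 73 0 = q.2) (B' := 30) (by simp [loadExtreme, Program.bound, RExpr.cost, NExpr.cost])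
    ?_).seq (B' := 110 * P.size + 100) (fun m₂ k₂ h₂ => ?_) |>.le (by omega)
  · rintro m' - rfl
    simp [loadExtreme, Program.exec, RExpr.eval, NExpr.eval, setReal_real, setReal_nat, hp, hq,
      ← hi', ← hj', H₁.x_eq, H₁.y_eq, show x ≠ 70 by omega, show x ≠ 71 by omega,
      show y ≠ 70 by omega, show y ≠ 71 by omega, show y ≠ 72 by omega]
  obtain ⟨hp1, hp2, hq1, hq2⟩ := h₂
  have H₂ := H₁.of_keeps k₂ rfl (by simp [loadExtreme, Program.keepsReal]; omega)
  refine ((fill_spec (n := P.size) (fun n => orient p q (P.cyc n)) H₂.size (by omega) ?_).seq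
    (B' := 40 * P.size + 70) fun m₃ k₃ h₃ => ?_).le
    (by simp [RExpr.cost, NExpr.cost]; ring_nf; omega)
  · intro m' hk n hn hc
    have ex := hk.2 x (by simp [fill, forLoop, Program.keepsReal]; omega)
    have ey := hk.2 y (by simp [fill, forLoop, Program.keepsReal]; omega)
    have hxn := H₂.x_eq ⟨n, hn⟩
    have hyn := H₂.y_eq ⟨n, hn⟩
    simp only [RExpr.eval, NExpr.eval, hc, hk.2 70 rfl, hk.2 71 rfl, hk.2 72 rfl, hk.2 73 rfl, ex,
      ey, hp1, hp2, hq1, hq2, orient, P.cyc_of_lt hn] at hxn hyn ⊢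
    rw [hxn, hyn]
  have hsz₃ : m₃.nat r 0 = P.size := by
    rw [k₃.1 r (by simp [fill, forLoop, Program.keepsNat]; omega)]; exact H₂.size
  refine ((minMax_spec (arr := 25) hsz₃ P.size_pos (by omega) (by omega) (by omega)).seq
    fun m₄ k₄ h₄ => (Ex.straight (writeFrame d d₁ d₂) m₄ rfl).mono le_rfl ?_).le
    (by simp [writeFrame, Program.bound, RExpr.cost, NExpr.cost])
  rintro m' - rfl
  obtain ⟨hk, hl, hkl⟩ := h₄
  have hm25 : ∀ n : Fin P.size, m₃.real 25 n = orient p q (P.vertex n) := by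
    intro n; rw [h₃ n n.2, P.cyc_of_lt n.2]
  have hfr := BoxFrame.of_extreme P (i := i) (j := j) (k := ⟨_, hk⟩) (l := ⟨_, hl⟩) hp.symm hq.symm
    hext (fun n => by
      have := hkl n n.2
      rwa [hm25 n, hm25 ⟨_, hk⟩, hm25 ⟨_, hl⟩] at this) rfl
  have e70 : m₄.real 70 0 = p.1 := by rw [k₄.2 70 rfl, k₃.2 70 rfl, hp1]
  have e71 : m₄.real 71 0 = p.2 := by rw [k₄.2 71 rfl, k₃.2 71 rfl, hp2]
  have e72 : m₄.real 72 0 = q.1 := by rw [k₄.2 72 rfl, k₃.2 72 rfl, hq1]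
  have e73 : m₄.real 73 0 = q.2 := by rw [k₄.2 73 rfl, k₃.2 73 rfl, hq2]
  rw [← hm25 ⟨_, hl⟩, ← hm25 ⟨_, hk⟩, ← k₄.2 25 rfl] at hfr
  have v0 : ((writeFrame d d₁ d₂).exec m₄).real d 0 = q.1 - p.1 := by
    simp [writeFrame, Program.exec, RExpr.eval, NExpr.eval, setReal_real, hdd₁, hdd₂, e70, e72]
  have v1 : ((writeFrame d d₁ d₂).exec m₄).real d₁ 0 = (p.2 - q.2) /
      (m₄.real 25 (m₄.nat 12 0) - m₄.real 25 (m₄.nat 11 0)) := by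
    simp [writeFrame, Program.exec, RExpr.eval, NExpr.eval, setReal_real, hd₁₂,
      e71, e73, show 71 ≠ d by omega, show 73 ≠ d by omega, show 74 ≠ d by omega]
  have v2 : ((writeFrame d d₁ d₂).exec m₄).real d₂ 0 = (q.1 - p.1) /
      (m₄.real 25 (m₄.nat 12 0) - m₄.real 25 (m₄.nat 11 0)) := by
    simp [writeFrame, Program.exec, RExpr.eval, NExpr.eval, setReal_real,
      e70, e72, show 70 ≠ d by omega, show 72 ≠ d by omega, show 74 ≠ d by omega,
      show 70 ≠ d₁ by omega, show 72 ≠ d₁ by omega, show 74 ≠ d₁ by omega]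
  rw [v0, v1, v2]
  refine ⟨hfr, i, j, by rw [hp, hq], hext⟩

/-- Store the chosen functionals, the mode, and the determinant. -/
def store (a₁ a₂ b₁ b₂ d : RExpr) (mode : ℕ) : Program :=
  .rset 40 (.lit 0) a₁ ;; .rset 41 (.lit 0) a₂ ;; .rset 42 (.lit 0) b₁ ;; .rset 43 (.lit 0) b₂ ;;
  .rset 45 (.lit 0) d ;; .nset 18 (.lit 0) (.lit mode)

/-- Choose the two functionals with the largest determinant. -/
def choose : Program :=
  (.rset 75 (.lit 0) (.div (rvar 32) (rvar 30)) ;; .rset 76 (.lit 0) (.div (rvar 35) (rvar 30)) ;;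
   .rset 77 (.lit 0) (.sub (.mul (rvar 31) (rvar 35)) (.mul (rvar 32) (rvar 34)))) ;;
  .cond (.conj (.neg (.rlt (rvar 75) (rvar 76))) (.conj (.neg (.rlt (rvar 75) (rvar 77)))
      (.neg (.rlt (rvar 75) (.sub (.lit 0) (rvar 77))))))
    (store (.div (.lit 1) (rvar 30)) (.lit 0) (rvar 31) (rvar 32) (rvar 75) 0)
    (.cond (.conj (.neg (.rlt (rvar 76) (rvar 77)))
        (.neg (.rlt (rvar 76) (.sub (.lit 0) (rvar 77)))))
      (store (.div (.lit 1) (rvar 30)) (.lit 0) (rvar 34) (rvar 35) (rvar 76) 1)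
      (.cond (.rlt (.lit 0) (rvar 77))
        (store (rvar 31) (rvar 32) (rvar 34) (rvar 35) (rvar 77) 1)
        (store (.sub (.lit 0) (rvar 31)) (.sub (.lit 0) (rvar 32)) (rvar 34) (rvar 35)
          (.sub (.lit 0) (rvar 77)) 1)))

/-- The memory contains suitable functionals for the polygons `A` and `B`. -/
def Chosen (m : Memory) (A B : ConvexPolygon) (α β : ℝ × ℝ) (mode : ℕ) : Prop :=
  Suitable A B α β mode ∧ m.real 40 0 = α.1 ∧ m.real 41 0 = α.2 ∧ m.real 42 0 = β.1 ∧
    m.real 43 0 = β.2 ∧ m.real 45 0 = cross α β ∧ m.nat 18 0 = mode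

/-- The nested tests find the largest of the three absolute determinants. Those involving `1 / a`
are positive because `γ.2` and `γ'.2` are; only the third can be negative, and then `γ` is replaced
by `-γ`. -/
theorem choose_spec {m : Memory} {A B : ConvexPolygon}
    (hA : BoxFrame A (m.real 30 0) (m.real 31 0, m.real 32 0))
    (hB : BoxFrame B (m.real 33 0) (m.real 34 0, m.real 35 0)) (h : m.real 30 0 ≤ m.real 33 0) :
    Ex choose m 400 fun m' => ∃ α β mode, Chosen m' A B α β mode := by
  obtain ⟨a, ha⟩ : ∃ a, a = m.real 30 0 := ⟨_, rfl⟩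
  obtain ⟨γ, hγ⟩ : ∃ γ, γ = (m.real 31 0, m.real 32 0) := ⟨_, rfl⟩
  obtain ⟨γ', hγ'⟩ : ∃ γ, γ = (m.real 34 0, m.real 35 0) := ⟨_, rfl⟩
  rw [← ha, ← hγ] at hA
  rw [← hγ'] at hB
  rw [← ha] at h
  have hγ1 : m.real 31 0 = γ.1 := by rw [hγ]
  have hγ2 : m.real 32 0 = γ.2 := by rw [hγ]
  have hγ3 : m.real 34 0 = γ'.1 := by rw [hγ']
  have hγ4 : m.real 35 0 = γ'.2 := by rw [hγ']
  have c1 : cross (1 / a, 0) γ = γ.2 / a := by simp only [cross]; ring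
  have c2 : cross (1 / a, 0) γ' = γ'.2 / a := by simp only [cross]; ring
  refine ((Ex.straight _ m rfl).seq (B' := 300) fun m₁ k₁ h₁ => ?_).le
    (by simp [Program.bound, NExpr.cost, RExpr.cost])
  have e30 : m₁.real 30 0 = a := by rw [k₁.2 30 rfl, ha]
  have e31 : m₁.real 31 0 = γ.1 := by rw [k₁.2 31 rfl, hγ1]
  have e32 : m₁.real 32 0 = γ.2 := by rw [k₁.2 32 rfl, hγ2]
  have e34 : m₁.real 34 0 = γ'.1 := by rw [k₁.2 34 rfl, hγ3]
  have e35 : m₁.real 35 0 = γ'.2 := by rw [k₁.2 35 rfl, hγ4]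
  have e75 : m₁.real 75 0 = cross (1 / a, 0) γ := by
    rw [h₁, c1]; simp [Program.exec, NExpr.eval, RExpr.eval, setReal_real, hγ2, ← ha]
  have e76 : m₁.real 76 0 = cross (1 / a, 0) γ' := by
    rw [h₁, c2]; simp [Program.exec, NExpr.eval, RExpr.eval, setReal_real, hγ4, ← ha]
  have e77 : m₁.real 77 0 = cross γ γ' := by
    rw [h₁]; simp [Program.exec, NExpr.eval, RExpr.eval, setReal_real, hγ1, hγ2, hγ3, hγ4, cross]
  refine (Ex.cond (B := 200) ?_ fun hn => (Ex.cond (B := 140) ?_ fun hn' =>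
      (Ex.cond (B := 100) ?_ ?_).le (by simp [Test.cost, NExpr.cost, RExpr.cost])).le
        (by simp [Test.cost, NExpr.cost, RExpr.cost])).le
        (by simp [Test.cost, NExpr.cost, RExpr.cost])
  all_goals
    simp only [Test.Holds, RExpr.eval, NExpr.eval, e75, e76, e77, not_lt, Rat.cast_zero, zero_sub]
    try simp only [Test.Holds, RExpr.eval, NExpr.eval, e75, e76, e77, not_lt, Rat.cast_zero,
      zero_sub] at hn
    try simp only [Test.Holds, RExpr.eval, NExpr.eval, e76, e77, not_lt, Rat.cast_zero,
      zero_sub] at hn'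
  · rintro ⟨h1, h2, h3⟩
    have hs := suitable_of_first hA hB h h1 (abs_le.2 ⟨by linarith, h2⟩)
    refine (Ex.straight _ m₁ rfl).mono
      (by simp [store, Program.bound, NExpr.cost, RExpr.cost]) ?_
    rintro m' - rfl
    refine ⟨_, _, _, hs, ?_⟩
    simp [store, Program.exec, NExpr.eval, RExpr.eval, setReal_real, setNat_real, setNat_nat, e30,
      e31, e32, e75]
  · rintro ⟨h1, h2⟩
    have habs := abs_le.2 ⟨by linarith, h1⟩
    have h3 : cross (1 / a, 0) γ ≤ cross (1 / a, 0) γ' := by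
      by_contra! hlt
      exact hn ⟨hlt.le, by linarith, by linarith⟩
    have hs := suitable_of_second hA hB h h3 habs
    refine (Ex.straight _ m₁ rfl).mono
      (by simp [store, Program.bound, NExpr.cost, RExpr.cost]) ?_
    rintro m' - rfl
    refine ⟨_, _, _, hs, ?_⟩
    simp [store, Program.exec, NExpr.eval, RExpr.eval, setReal_real, setNat_real, setNat_nat, e30,
      e34, e35, e76]
  · intro hpos
    have h1 : cross (1 / a, 0) γ' ≤ cross γ γ' := by
      by_contra! hlt
      exact hn' ⟨hlt.le, by linarith⟩
    have h2 : cross (1 / a, 0) γ ≤ cross γ γ' := by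
      by_contra! hlt
      exact hn ⟨by linarith, hlt.le, by linarith⟩
    have hs := suitable_of_third hA hB h (Or.inl rfl) h2 h1
    refine (Ex.straight _ m₁ rfl).mono
      (by simp [store, Program.bound, NExpr.cost, RExpr.cost]) ?_
    rintro m' - rfl
    refine ⟨_, _, _, hs, ?_⟩
    simp [store, Program.exec, NExpr.eval, RExpr.eval, setReal_real, setNat_real, setNat_nat,
      e31, e32, e34, e35, e77]
  · intro hneg
    have h1 : cross (1 / a, 0) γ' ≤ cross (-γ) γ' := by
      rw [cross_neg_left]
      by_contra! hlt
      exact hn' ⟨by linarith, hlt.le⟩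
    have h2 : cross (1 / a, 0) γ ≤ cross (-γ) γ' := by
      rw [cross_neg_left] at *
      by_contra! hlt
      exact hn ⟨by linarith, by linarith, hlt.le⟩
    have hs := suitable_of_third hA hB h (Or.inr rfl) h2 h1
    refine (Ex.straight _ m₁ rfl).mono
      (by simp [store, Program.bound, NExpr.cost, RExpr.cost]) ?_
    rintro m' - rfl
    refine ⟨_, _, _, hs, ?_⟩
    simp [store, Program.exec, NExpr.eval, RExpr.eval, setReal_real, setNat_real, setNat_nat,
      e31, e32, e34, e35, e77, cross_neg_left]

end RealRAM


/-! ## Loading the polygons and changing the coordinates -/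

namespace RealRAM

/-- Copy two polygons, and store the sign. -/
def loadPair (x y r x' y' r' : ℕ) (s : ℚ) : Program :=
  copy x y r 21 22 15 ;; copy x' y' r' 23 24 16 ;; .rset 44 (.lit 0) (.lit s)

/-- Load the polygons in the order of their horizontal extents. -/
def load : Program :=
  extent 1 0 36 ;; extent 3 1 37 ;;
  .cond (.rlt (rvar 37) (rvar 36)) (loadPair 3 4 1 1 2 0 (-1)) (loadPair 1 2 0 3 4 1 1)

/-- The polygons `A` and `B` are `X` and `Y`, exchanged if the sign is `-1`. -/
def Ordered (X Y A B : ConvexPolygon) (s : ℝ) : Prop :=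
  A = X ∧ B = Y ∧ s = 1 ∨ A = Y ∧ B = X ∧ s = -1

theorem load_spec {m : Memory} {X Y : ConvexPolygon} (hX : Holds m X 1 2 0) (hY : Holds m Y 3 4 1) :
    Ex load m (80 * (X.size + Y.size) + 200) fun m' => ∃ A B s, Ordered X Y A B s ∧
      Holds m' A 21 22 15 ∧ Holds m' B 23 24 16 ∧ m'.real 44 0 = s ∧
      ∃ a b, IsExtent A a ∧ IsExtent B b ∧ a ≤ b := by
  refine ((extent_spec hX (d := 36) (by decide) (by decide) (by decide)).seq fun m₁ k₁ h₁ =>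
    (extent_spec (hY.of_keeps k₁ rfl rfl) (d := 37) (by decide) (by decide) (by decide)).seq
    fun m₂ k₂ h₂ => Ex.cond (B := 40 * (X.size + Y.size) + 80) ?_ ?_).le ?_
  all_goals
    try rw [← k₂.2 36 rfl] at h₁
    try have hX₂ := (hX.of_keeps k₁ rfl rfl).of_keeps k₂ rfl rfl
    try have hY₂ := (hY.of_keeps k₁ rfl rfl).of_keeps k₂ rfl rfl
  · intro hlt
    refine ((copy_spec hY₂ (x' := 21) (y' := 22) (r' := 15) (by decide) (by decide)).seq
      fun m₃ k₃ h₃ => (copy_spec (hX₂.of_keeps k₃ rfl rfl) (x' := 23) (y' := 24) (r' := 16)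
        (by decide) (by decide)).seq fun m₄ k₄ h₄ => (Ex.straight _ m₄ rfl).mono le_rfl
        fun m₅ k₅ h₅ => ⟨Y, X, -1, .inr ⟨rfl, rfl, rfl⟩, (h₃.of_keeps k₄ rfl rfl).of_keeps k₅ rfl rfl,
          h₄.of_keeps k₅ rfl rfl, ?_, _, _, h₂, h₁, le_of_lt hlt⟩).le ?_
    · simp [Program.bound, RExpr.cost, NExpr.cost]; omega
    · subst h₅; simp [Program.exec, RExpr.eval, NExpr.eval, setReal_real]
  · intro hlt
    refine ((copy_spec hX₂ (x' := 21) (y' := 22) (r' := 15) (by decide) (by decide)).seq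
      fun m₃ k₃ h₃ => (copy_spec (hY₂.of_keeps k₃ rfl rfl) (x' := 23) (y' := 24) (r' := 16)
        (by decide) (by decide)).seq fun m₄ k₄ h₄ => (Ex.straight _ m₄ rfl).mono le_rfl
        fun m₅ k₅ h₅ => ⟨X, Y, 1, .inl ⟨rfl, rfl, rfl⟩, (h₃.of_keeps k₄ rfl rfl).of_keeps k₅ rfl rfl,
          h₄.of_keeps k₅ rfl rfl, ?_, _, _, h₁, h₂, le_of_not_gt hlt⟩).le ?_
    · simp [Program.bound, RExpr.cost, NExpr.cost]; omega
    · subst h₅; simp [Program.exec, RExpr.eval, NExpr.eval, setReal_real]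
  · simp [Test.cost, RExpr.cost, NExpr.cost]; omega

/-- Load the polygons, and choose the coordinates. -/
def prepare : Program :=
  load ;; frame 21 22 15 30 31 32 ;; frame 23 24 16 33 34 35 ;; choose

theorem prepare_spec {m : Memory} {X Y : ConvexPolygon} (hX : Holds m X 1 2 0)
    (hY : Holds m Y 3 4 1) :
    Ex prepare m (230 * (X.size + Y.size) + 900) fun m' => ∃ A B s α β mode,
      Ordered X Y A B s ∧ Holds m' A 21 22 15 ∧ Holds m' B 23 24 16 ∧ m'.real 44 0 = s ∧
      Chosen m' A B α β mode := by
  refine ((load_spec hX hY).seq (B' := 150 * (X.size + Y.size) + 700) fun m₁ k₁ h₁ => ?_).le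
    (by omega)
  obtain ⟨A, B, s, ho, hA, hB, hs, a, b, ha, hb, hab⟩ := h₁
  have hsz : A.size + B.size = X.size + Y.size := by
    rcases ho with ⟨rfl, rfl, -⟩ | ⟨rfl, rfl, -⟩ <;> omega
  refine ((frame_spec (d := 30) (d₁ := 31) (d₂ := 32) hA (by decide) (by decide) (by decide)
    (by decide) (by decide) (by decide)).seq fun m₂ k₂ h₂ =>
    (frame_spec (d := 33) (d₁ := 34) (d₂ := 35) (hB.of_keeps k₂ rfl rfl) (by decide) (by decide)
    (by decide) (by decide) (by decide) (by decide)).seq fun m₃ k₃ h₃ =>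
    (choose_spec (A := A) (B := B) ?_ h₃.1 ?_).mono le_rfl fun m₄ k₄ h₄ => ?_).le (by omega)
  · rw [k₃.2 30 rfl, k₃.2 31 rfl, k₃.2 32 rfl]; exact h₂.1
  · rw [k₃.2 30 rfl, h₂.2.unique ha, h₃.2.unique hb]; exact hab
  · obtain ⟨α, β, mode, h⟩ := h₄
    refine ⟨A, B, s, α, β, mode, ho, ((hA.of_keeps k₂ rfl rfl).of_keeps k₃ rfl rfl).of_keeps k₄ rfl
      rfl, ((hB.of_keeps k₂ rfl rfl).of_keeps k₃ rfl rfl).of_keeps k₄ rfl rfl, ?_, h⟩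
    rw [k₄.2 44 rfl, k₃.2 44 rfl, k₂.2 44 rfl, hs]

/-- The value of the functional in the real variables `a₁`, `a₂` at a vertex. -/
def functional (x y a₁ a₂ : ℕ) : RExpr :=
  .add (.mul (rvar a₁) (entry x 10)) (.mul (rvar a₂) (entry y 10))

/-- Tabulate the functional in the real variables `a₁`, `a₂` on the closed list of vertices, and
determine its range. -/
def evaluate (x y r a₁ a₂ d lo hi : ℕ) : Program :=
  fill r d (functional x y a₁ a₂) ;; .rset d (nvar r) (.get d (.lit 0)) ;;
  minMax d r ;; .rset lo (.lit 0) (entry d 11) ;; .rset hi (.lit 0) (entry d 12)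

/-- The array `d` contains the values of the functional `α` on the closed list of vertices, and `a`
and `b` are the smallest and the largest one. -/
structure Evaluated (m : Memory) (P : ConvexPolygon) (α : ℝ × ℝ) (d : ℕ) (a b : ℝ) : Prop where
  eq : ∀ i ≤ P.size, m.real d i = dot α (P.cyc i)
  attained : ∃ i, dot α (P.vertex i) = a
  lower : ∀ i, a ≤ dot α (P.vertex i)
  upper : ∀ i, dot α (P.vertex i) ≤ b

theorem Evaluated.of_keeps {p : Program} {m m' : Memory} {P : ConvexPolygon} {α : ℝ × ℝ} {d : ℕ}
    {a b : ℝ} (h : Evaluated m P α d a b) (hk : Keeps p m m') (hr : p.keepsReal d = true) :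
    Evaluated m' P α d a b :=
  ⟨by rw [hk.2 _ hr]; exact h.eq, h.attained, h.lower, h.upper⟩

theorem evaluate_spec {m : Memory} {P : ConvexPolygon} {α : ℝ × ℝ} {x y r a₁ a₂ d lo hi : ℕ}
    (h : Holds m P x y r) (h₁ : m.real a₁ 0 = α.1) (h₂ : m.real a₂ 0 = α.2) (hr : 12 < r)
    (hd : d ∉ [x, y, a₁, a₂, lo, hi]) (hlo : lo ≠ hi) :
    Ex (evaluate x y r a₁ a₂ d lo hi) m (80 * P.size + 60) fun m' =>
      Evaluated m' P α d (m'.real lo 0) (m'.real hi 0) := by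
  simp only [List.mem_cons, not_or, List.not_mem_nil, not_false_eq_true, and_true] at hd
  obtain ⟨hx, hy, hd₁, hd₂, hdl, hdh⟩ := hd
  refine ((fill_spec (n := P.size) (fun i => dot α (P.cyc i)) h.size (by omega) ?_).seq
    (B' := 50 * P.size + 50) fun m₁ k₁ e₁ => ?_).le ?_
  · intro m' hk i hi hc
    have hxi := h.x_eq ⟨i, hi⟩
    have hyi := h.y_eq ⟨i, hi⟩
    have hkeep : ∀ c, d ≠ c → m'.real c = m.real c := fun c hc =>
      hk.2 c (by simp [fill, forLoop, Program.keepsReal, hc])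
    simp only [functional, RExpr.eval, NExpr.eval, hc, hkeep x hx, hkeep y hy, hkeep a₁ hd₁,
      hkeep a₂ hd₂, h₁, h₂, dot, P.cyc_of_lt hi]
    simp only at hxi hyi
    rw [hxi, hyi]
  · have hsz : m₁.nat r 0 = P.size := by
      rw [k₁.1 r (by simp [fill, forLoop, Program.keepsNat]; omega), h.size]
    -- The first value is repeated after the last, so that `slice` can read the closing edge without
    -- computing indices cyclically.
    refine ((Ex.straight (.rset d (nvar r) (.get d (.lit 0))) m₁ rfl).seq
      (B' := 50 * P.size + 40) fun m₂ k₂ e₂ => ?_).le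
        (by simp [Program.bound, RExpr.cost, NExpr.cost]; omega)
    have hsz₂ : m₂.nat r 0 = P.size := by rw [k₂.1 r rfl, hsz]
    have hval : ∀ i ≤ P.size, m₂.real d i = dot α (P.cyc i) := by
      intro i hi
      rw [e₂]
      simp only [Program.exec, RExpr.eval, NExpr.eval, setReal_real, hsz, true_and]
      split_ifs with hc
      · rw [hc, e₁ 0 P.size_pos, P.cyc_size]
      · exact e₁ i (by omega)
    refine ((minMax_spec (arr := d) hsz₂ P.size_pos (by omega) (by omega) (by omega)).seq
      fun m₃ k₃ e₃ => (Ex.straight _ m₃ rfl).mono le_rfl fun m₄ k₄ e₄ => ?_).le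
      (by simp [Program.bound, RExpr.cost, NExpr.cost]; omega)
    obtain ⟨h1, h2, h3⟩ := e₃
    have hvert : ∀ i : Fin P.size, m₂.real d i = dot α (P.vertex i) := by
      intro i; rw [hval i i.2.le, P.cyc_of_lt i.2]
    have v₁ : m₄.real lo 0 = m₂.real d (m₃.nat 11 0) := by
      rw [e₄, ← k₃.2 d rfl]
      simp [Program.exec, RExpr.eval, NExpr.eval, setReal_real, hlo]
    have v₂ : m₄.real hi 0 = m₂.real d (m₃.nat 12 0) := by
      rw [e₄, ← k₃.2 d rfl]
      simp [Program.exec, RExpr.eval, NExpr.eval, setReal_real, hdl, setReal_nat]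
    refine ⟨fun i hi => ?_, ⟨⟨_, h1⟩, ?_⟩, fun i => ?_, fun i => ?_⟩
    · rw [k₄.2 d (by simp [Program.keepsReal, Ne.symm hdl, Ne.symm hdh]), k₃.2 d rfl, hval i hi]
    · rw [v₁, ← hvert]
    · rw [v₁, ← hvert]; exact (h3 i i.2).1
    · rw [v₂, ← hvert]; exact (h3 i i.2).2
  · simp [functional, RExpr.cost, NExpr.cost]; ring_nf; omega

end RealRAM


/-! ### Polygons in the chosen coordinates, and the complete program. -/

namespace RealRAM

/-- `a` is the minimum of the functional `α` on the polygon. -/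
def IsMinimum (P : ConvexPolygon) (α : ℝ × ℝ) (a : ℝ) : Prop :=
  (∃ i, dot α (P.vertex i) = a) ∧ ∀ i, a ≤ dot α (P.vertex i)

theorem Evaluated.mem_region {m : Memory} {P : ConvexPolygon} {α : ℝ × ℝ} {d : ℕ} {a b : ℝ}
    (h : Evaluated m P α d a b) {Q : ConvexPolygon} (hs : Q.size = P.size)
    (hQ : ∀ i, (Q.cyc i).2 = dot α (P.cyc i)) : ∀ p ∈ Q.region, a ≤ p.2 ∧ p.2 ≤ b := by
  have hcv : Convex ℝ {p : ℝ × ℝ | a ≤ p.2 ∧ p.2 ≤ b} := by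
    have : {p : ℝ × ℝ | a ≤ p.2 ∧ p.2 ≤ b} = (LinearMap.snd ℝ ℝ ℝ) ⁻¹' Set.Icc a b := rfl
    rw [this]
    exact (convex_Icc a b).linear_preimage _
  refine fun p hp => ConvexPolygon.region_subset hcv (fun i hi => ?_) hp
  rw [hs] at hi
  simp only [Set.mem_ofPred_eq, hQ, P.cyc_of_lt hi]
  exact ⟨h.lower _, h.upper _⟩

theorem cross_rotate (α β : ℝ × ℝ) : cross β (-α) = cross α β := by
  simp only [cross, Prod.fst_neg, Prod.snd_neg]; ring

/-- The first row of the inverse of the matrix with rows `α` and `β`, multiplied by `s`. -/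
noncomputable def inverseRow₁ (s : ℝ) (α β : ℝ × ℝ) : ℝ × ℝ :=
  (s * β.2 / cross α β, -(s * α.2 / cross α β))

/-- The second row of the inverse of the matrix with rows `α` and `β`, multiplied by `s`. -/
noncomputable def inverseRow₂ (s : ℝ) (α β : ℝ × ℝ) : ℝ × ℝ :=
  (-(s * β.1 / cross α β), s * α.1 / cross α β)

/-- The weight, the matrix of the inverse change of coordinates, and the third functional. -/
def setUp : Program :=
  .rset 46 (.lit 0) (.div (.lit 1) (.mul (.mul (rvar 20) (rvar 20)) (rvar 45))) ;;
  .rset 47 (.lit 0) (.div (.mul (rvar 44) (rvar 43)) (rvar 45)) ;;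
  .rset 48 (.lit 0) (.sub (.lit 0) (.div (.mul (rvar 44) (rvar 41)) (rvar 45))) ;;
  .rset 49 (.lit 0) (.sub (.lit 0) (.div (.mul (rvar 44) (rvar 42)) (rvar 45))) ;;
  .rset 50 (.lit 0) (.div (.mul (rvar 44) (rvar 40)) (rvar 45)) ;;
  .rset 81 (.lit 0) (.sub (.lit 0) (rvar 40)) ;; .rset 82 (.lit 0) (.sub (.lit 0) (rvar 41))

/-- Choose the origin of the sample lines in the second direction. -/
def chooseStart : Program :=
  .cond (.nlt (nvar 18) (.lit 1)) (.rset 52 (.lit 0) (rvar 57)) (.rset 52 (.lit 0) (rvar 79))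

/-- Express the polygons in the chosen coordinates. -/
def changeCoords : Program :=
  setUp ;; evaluate 21 22 15 40 41 53 51 78 ;; evaluate 21 22 15 42 43 54 57 58 ;;
  evaluate 23 24 16 42 43 55 79 80 ;; evaluate 23 24 16 81 82 56 59 60 ;; chooseStart

/-- `A` is expressed in `(α, β)`, so its vertical lines are the lines on which `α` is constant; `B`
is expressed in `(β, -α)`, so its vertical lines have constant `β`. The sign preserves the
orientation. The grid starts at the minimum of `β` on `A` or on `B`, according to the mode. -/
theorem changeCoords_spec {m : Memory} {A B : ConvexPolygon} {α β : ℝ × ℝ} {mode N : ℕ} {s : ℝ}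
    (hA : Holds m A 21 22 15) (hB : Holds m B 23 24 16) (hs : m.real 44 0 = s)
    (hc : Chosen m A B α β mode) (h17 : m.nat 17 0 = N) (h20 : m.real 20 0 = N)
    (h26 : ∀ k ≤ N, m.real 26 k = k) (hpos : 0 < cross α β) (hpos' : 0 < cross β (-α)) :
    Ex changeCoords m (160 * (A.size + B.size) + 400) fun m' => ∃ a₀ b₀,
      Ready m' (A.map α β hpos) (B.map β (-α) hpos') N mode a₀ b₀ (1 / ((N : ℝ) ^ 2 * cross α β))
        (inverseRow₁ s α β) (inverseRow₂ s α β) ∧ IsMinimum A α a₀ ∧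
      (mode = 0 ∧ IsMinimum A β b₀ ∨ mode = 1 ∧ IsMinimum B β b₀) := by
  obtain ⟨hsuit, h40, h41, h42, h43, h45, h18⟩ := hc
  refine ((Ex.straight setUp m rfl).seq (B' := 160 * (A.size + B.size) + 300) fun m₁ k₁ e₁ => ?_).le
    (by simp [setUp, Program.bound, RExpr.cost, NExpr.cost]; omega)
  have hA₁ := hA.of_keeps k₁ rfl rfl
  have hB₁ := hB.of_keeps k₁ rfl rfl
  have r46 : m₁.real 46 0 = 1 / ((N : ℝ) ^ 2 * cross α β) := by
    rw [e₁]; simp [setUp, Program.exec, RExpr.eval, NExpr.eval, setReal_real, h20, h45, sq]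
  have r47 : m₁.real 47 0 = (inverseRow₁ s α β).1 := by
    rw [e₁]
    simp [setUp, Program.exec, RExpr.eval, NExpr.eval, setReal_real, hs, h43, h45, inverseRow₁]
  have r48 : m₁.real 48 0 = (inverseRow₁ s α β).2 := by
    rw [e₁]
    simp [setUp, Program.exec, RExpr.eval, NExpr.eval, setReal_real, hs, h41, h45, inverseRow₁]
  have r49 : m₁.real 49 0 = (inverseRow₂ s α β).1 := by
    rw [e₁]
    simp [setUp, Program.exec, RExpr.eval, NExpr.eval, setReal_real, hs, h42, h45, inverseRow₂]
  have r50 : m₁.real 50 0 = (inverseRow₂ s α β).2 := by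
    rw [e₁]
    simp [setUp, Program.exec, RExpr.eval, NExpr.eval, setReal_real, hs, h40, h45, inverseRow₂]
  have r81 : m₁.real 81 0 = (-α).1 := by
    rw [e₁]; simp [setUp, Program.exec, RExpr.eval, NExpr.eval, setReal_real, h40]
  have r82 : m₁.real 82 0 = (-α).2 := by
    rw [e₁]; simp [setUp, Program.exec, RExpr.eval, NExpr.eval, setReal_real, h41]
  refine ((evaluate_spec (α := α) (lo := 51) (hi := 78) (d := 53) hA₁ (by rw [k₁.2 40 rfl, h40])
    (by rw [k₁.2 41 rfl, h41]) (by decide) (by decide) (by decide)).seq fun m₂ k₂ e₂ =>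
    (evaluate_spec (α := β) (a₁ := 42) (a₂ := 43) (lo := 57) (hi := 58) (d := 54)
      (hA₁.of_keeps k₂ rfl rfl)
      (by rw [k₂.2 42 rfl, k₁.2 42 rfl, h42]) (by rw [k₂.2 43 rfl, k₁.2 43 rfl, h43])
      (by decide) (by decide) (by decide)).seq fun m₃ k₃ e₃ =>
    (evaluate_spec (α := β) (a₁ := 42) (a₂ := 43) (lo := 79) (hi := 80) (d := 55)
      ((hB₁.of_keeps k₂ rfl rfl).of_keeps k₃ rfl rfl)
      (by rw [k₃.2 42 rfl, k₂.2 42 rfl, k₁.2 42 rfl, h42])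
      (by rw [k₃.2 43 rfl, k₂.2 43 rfl, k₁.2 43 rfl, h43])
      (by decide) (by decide) (by decide)).seq fun m₄ k₄ e₄ =>
    (evaluate_spec (α := -α) (a₁ := 81) (a₂ := 82) (lo := 59) (hi := 60) (d := 56)
      (((hB₁.of_keeps k₂ rfl rfl).of_keeps k₃ rfl rfl).of_keeps k₄ rfl rfl)
      (by rw [k₄.2 81 rfl, k₃.2 81 rfl, k₂.2 81 rfl, r81])
      (by rw [k₄.2 82 rfl, k₃.2 82 rfl, k₂.2 82 rfl, r82])
      (by decide) (by decide) (by decide)).seq fun m₅ k₅ e₅ =>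
    (Ex.straight chooseStart m₅ rfl).mono le_rfl fun m₆ k₆ e₆ => ?_).le
    (by simp [chooseStart, Program.bound, Test.cost, RExpr.cost, NExpr.cost]; ring_nf; omega)
  have keepReal : ∀ c, [evaluate 21 22 15 40 41 53 51 78, evaluate 21 22 15 42 43 54 57 58,
      evaluate 23 24 16 42 43 55 79 80, evaluate 23 24 16 81 82 56 59 60, chooseStart].all
      (Program.keepsReal c) = true → m₆.real c = m₁.real c := by
    intro c hc
    simp only [List.all_cons, List.all_nil, Bool.and_eq_true, and_true] at hc
    rw [k₆.2 _ hc.2.2.2.2, k₅.2 _ hc.2.2.2.1, k₄.2 _ hc.2.2.1, k₃.2 _ hc.2.1, k₂.2 _ hc.1]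
  have keepNat : ∀ c, [evaluate 21 22 15 40 41 53 51 78, evaluate 21 22 15 42 43 54 57 58,
      evaluate 23 24 16 42 43 55 79 80, evaluate 23 24 16 81 82 56 59 60, chooseStart].all
      (Program.keepsNat c) = true → m₆.nat c = m₁.nat c := by
    intro c hc
    simp only [List.all_cons, List.all_nil, Bool.and_eq_true, and_true] at hc
    rw [k₆.1 _ hc.2.2.2.2, k₅.1 _ hc.2.2.2.1, k₄.1 _ hc.2.2.1, k₃.1 _ hc.2.1, k₂.1 _ hc.1]
  have t57 : m₅.real 57 = m₃.real 57 := by rw [k₅.2 57 rfl, k₄.2 57 rfl]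
  have t58 : m₅.real 58 = m₃.real 58 := by rw [k₅.2 58 rfl, k₄.2 58 rfl]
  have t79 : m₅.real 79 = m₄.real 79 := k₅.2 79 rfl
  have n18 : m₅.nat 18 0 = mode := by
    rw [k₅.1 18 rfl, k₄.1 18 rfl, k₃.1 18 rfl, k₂.1 18 rfl, k₁.1 18 rfl, h18]
  have f₂ := (((e₂.of_keeps k₃ rfl).of_keeps k₄ rfl).of_keeps k₅ rfl).of_keeps k₆ rfl
  have f₃ := ((e₃.of_keeps k₄ rfl).of_keeps k₅ rfl).of_keeps k₆ rfl
  have f₄ := (e₄.of_keeps k₅ rfl).of_keeps k₆ rfl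
  have f₅ := e₅.of_keeps k₆ rfl
  refine ⟨m₆.real 51 0, m₆.real 52 0, ⟨?_, ?_, ?_, ?_, ?_, ?_, ?_, ?_, ?_, ?_, ?_, rfl, rfl, ?_, ?_,
    ?_, ?_, ?_, ?_⟩, ?_, ?_⟩
  · rw [keepNat 15 rfl]; exact hA₁.size
  · rw [keepNat 16 rfl]; exact hB₁.size
  · rw [keepNat 17 rfl, k₁.1 17 rfl, h17]
  · rw [k₆.1 18 rfl, n18]
  · rw [keepReal 20 rfl, k₁.2 20 rfl, h20]
  · rw [keepReal 26 rfl, k₁.2 26 rfl]; exact h26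
  · rw [keepReal 46 rfl, r46]
  · rw [keepReal 47 rfl, r47]
  · rw [keepReal 48 rfl, r48]
  · rw [keepReal 49 rfl, r49]
  · rw [keepReal 50 rfl, r50]
  · intro i hi; rw [ConvexPolygon.cyc_map]; exact f₂.eq i hi
  · intro i hi; rw [ConvexPolygon.cyc_map]; exact f₃.eq i hi
  · intro i hi; rw [ConvexPolygon.cyc_map]; exact f₄.eq i hi
  · intro i hi; rw [ConvexPolygon.cyc_map]; exact f₅.eq i hi
  · rw [k₆.2 57 rfl, t57, k₆.2 58 rfl, t58]
    exact f₃.mem_region rfl fun i => by rw [ConvexPolygon.cyc_map]; rfl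
  · rw [k₆.2 59 rfl, k₆.2 60 rfl]
    exact f₅.mem_region rfl fun i => by rw [ConvexPolygon.cyc_map]; rfl
  · rw [k₆.2 51 rfl, k₅.2 51 rfl, k₄.2 51 rfl, k₃.2 51 rfl]
    exact ⟨f₂.attained, f₂.lower⟩
  · rcases hsuit.width' with ⟨rfl, -⟩ | ⟨rfl, -⟩
    · refine Or.inl ⟨rfl, ?_⟩
      have : m₆.real 52 0 = m₃.real 57 0 := by
        rw [e₆, ← t57]
        simp [chooseStart, Program.exec, Test.Holds, RExpr.eval, NExpr.eval, n18, setReal_real]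
      rw [this]
      exact ⟨f₃.attained, f₃.lower⟩
    · refine Or.inr ⟨rfl, ?_⟩
      have : m₆.real 52 0 = m₄.real 79 0 := by
        rw [e₆, ← t79]
        simp [chooseStart, Program.exec, Test.Holds, RExpr.eval, NExpr.eval, n18, setReal_real]
      rw [this]
      exact ⟨f₄.attained, f₄.lower⟩

/-- Midpoints are strictly inside the window, which excludes degenerate slices. -/
theorem sampleAt_bounds (a : ℝ) {N k : ℕ} (h : k < N) :
    a < sampleAt a N k ∧ sampleAt a N k < a + 1 := by
  have hN : (0 : ℝ) < N := by exact_mod_cast (by omega : 0 < N)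
  have hk : (k : ℝ) + 1 ≤ N := by exact_mod_cast h
  unfold sampleAt
  constructor
  · have : 0 < ((k : ℝ) + 1 / 2) / N := by positivity
    linarith
  · have : ((k : ℝ) + 1 / 2) / N < 1 := by rw [div_lt_one hN]; linarith
    linarith

/-- The whole algorithm. -/
def algorithm : Program :=
  countLines ;; prepare ;; changeCoords ;; treatAll

theorem algorithm_spec (X Y : ConvexPolygon) {ε : ℝ} (hε : 0 < ε) (h1 : ε < 1) :
    ∃ N : ℕ, 0 < N ∧ 128 ≤ N * ε ∧ N * ε ≤ 129 ∧
    Ex algorithm (input X Y ε) (2000 * (N * N * (X.size + Y.size))) fun m =>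
      ∃ A B s α β mode a₀ b₀ sz, ∃ (hpos : 0 < cross α β) (hpos' : 0 < cross β (-α)),
        Ordered X Y A B s ∧ Suitable A B α β mode ∧ IsMinimum A α a₀ ∧
        (mode = 0 ∧ IsMinimum A β b₀ ∨ mode = 1 ∧ IsMinimum B β b₀) ∧ sz ≤ X.size + Y.size ∧
        (∀ a ∈ [7, 8, 9, 10, 11], ∀ i, m.real a i = 0) ∧
        Output m sz (N * N) (1 / ((N : ℝ) ^ 2 * cross α β)) (inverseRow₁ s α β) (inverseRow₂ s α β)
          fun i => hits (A.map α β hpos) (B.map β (-α) hpos') mode (sampleAt a₀ N (i / N))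
            (sampleAt b₀ N (i % N)) := by
  have hX : Holds (input X Y ε) X 1 2 0 := ⟨rfl, fun i => by simp [input], fun i => by simp [input]⟩
  have hY : Holds (input X Y ε) Y 3 4 1 := ⟨rfl, fun i => by simp [input], fun i => by simp [input]⟩
  obtain ⟨N, hN, hN1, hN2, hrun⟩ := countLines_spec (m := input X Y ε) (ε := ε) rfl hε h1
  refine ⟨N, hN, hN1, hN2, ?_⟩
  have hx3 := X.three_le
  have hy3 := Y.three_le
  refine ((hrun.seq (B' := 1600 * (N * N * (X.size + Y.size))) fun m₁ k₁ h₁ =>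
    ((prepare_spec (hX.of_keeps k₁ rfl rfl) (hY.of_keeps k₁ rfl rfl)).seq
      (B' := 1000 * (N * N * (X.size + Y.size))) fun m₂ k₂ h₂ => ?_).le ?_)).le ?_
  · obtain ⟨A, B, s, α, β, mode, ho, hA, hB, hs, hc⟩ := h₂
    have hsz : A.size + B.size = X.size + Y.size := by
      rcases ho with ⟨rfl, rfl, -⟩ | ⟨rfl, rfl, -⟩ <;> omega
    have hpos : 0 < cross α β := hc.1.pos
    have hpos' : 0 < cross β (-α) := by rw [cross_rotate]; exact hpos
    refine ((changeCoords_spec (N := N) hA hB hs hc (by rw [k₂.1 17 rfl]; exact h₁.1)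
      (by rw [k₂.2 20 rfl]; exact h₁.2.1) (by rw [k₂.2 26 rfl]; exact h₁.2.2) hpos hpos').seq
      (B' := N * (N * (300 * A.size + 500 * B.size + 1011) + 19) + 8) fun m₃ k₃ h₃ => ?_).le ?_
    · obtain ⟨a₀, b₀, hr, ha, hb⟩ := h₃
      have hP := (hc.1.width.bounds ha).2
      obtain ⟨sz, hmode, hle⟩ : ∃ sz, (mode = 0 ∧ sz = (B.map β (-α) hpos').size ∨
          mode = 1 ∧ sz = 4 ∧ ∀ l < N,
          (∃ i, ((B.map β (-α) hpos').vertex i).1 < sampleAt b₀ N l) ∧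
          ∃ i, sampleAt b₀ N l < ((B.map β (-α) hpos').vertex i).1) ∧ sz ≤ X.size + Y.size := by
        rcases hb with ⟨h0, hb⟩ | ⟨h1, hb⟩
        · exact ⟨_, Or.inl ⟨h0, rfl⟩, by change B.size ≤ _; omega⟩
        · refine ⟨_, Or.inr ⟨h1, rfl, fun l hl => ?_⟩, by omega⟩
          have hw : UnitWidth B β := by
            rcases hc.1.width' with h | h
            · omega
            · exact h.2
          exact (hw.bounds hb).2 _ (sampleAt_bounds b₀ hl).1 (sampleAt_bounds b₀ hl).2
      refine (treatAll_spec hr hN ?_ ?_ (fun k hk =>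
        hP _ (sampleAt_bounds a₀ hk).1 (sampleAt_bounds a₀ hk).2) hmode).mono le_rfl fun m₄ k₄ h₄ => ?_
      · rw [k₃.1 2 rfl, k₂.1 2 rfl, k₁.1 2 rfl]; rfl
      · rw [k₃.1 19 rfl, k₂.1 19 rfl, k₁.1 19 rfl]; rfl
      · refine ⟨A, B, s, α, β, mode, a₀, b₀, sz, hpos, hpos', ho, hc.1, ha, hb, hle, ?_, h₄⟩
        intro a ha i
        -- The arrays of the five non-constant coefficients are never written and keep their initial
        -- zeros.
        have : [countLines, prepare, changeCoords, treatAll].all (Program.keepsReal a) = true := by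
          fin_cases ha <;> rfl
        simp only [List.all_cons, List.all_nil, Bool.and_eq_true, and_true] at this
        rw [k₄.2 a this.2.2.2, k₃.2 a this.2.2.1, k₂.2 a this.2.1, k₁.2 a this.1]
        fin_cases ha <;> rfl
    -- Two polygons have at least six vertices and `N ≤ N * N`, so all lower-order costs are
    -- absorbed into a multiple of `N * N * S`.
    · have h6 : 6 ≤ X.size + Y.size := by omega
      generalize X.size + Y.size = S at *
      have hN1 : N ≤ N * N := Nat.le_mul_self N
      have : 1 ≤ N * N := Nat.mul_pos hN hN
      have e1 : N * N * 6 ≤ N * N * S := Nat.mul_le_mul_left _ h6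
      have e2 : 1 * S ≤ N * N * S := Nat.mul_le_mul_right _ this
      have e3 : 300 * A.size + 500 * B.size + 1011 ≤ 500 * S + 1011 := by omega
      have e4 := Nat.mul_le_mul_left N (Nat.add_le_add_right (Nat.mul_le_mul_left N e3) 19)
      have e5 : N * (N * (500 * S + 1011) + 19) = 500 * (N * N * S) + 1011 * (N * N) + 19 * N := by
        ring
      rw [hsz]
      omega
  · have h6 : 6 ≤ X.size + Y.size := by omega
    generalize X.size + Y.size = S at *
    have : 1 ≤ N * N := Nat.mul_pos hN hN
    have e1 : N * N * 6 ≤ N * N * S := Nat.mul_le_mul_left _ h6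
    have e2 : 1 * S ≤ N * N * S := Nat.mul_le_mul_right _ this
    omega
  · have h6 : 6 ≤ X.size + Y.size := by omega
    generalize X.size + Y.size = S at *
    have hN1 : N ≤ N * N := Nat.le_mul_self N
    have : 1 ≤ N * N := Nat.mul_pos hN hN
    have e1 : N * N * 6 ≤ N * N * S := Nat.mul_le_mul_left _ h6
    omega

end RealRAM


/-! ## The approximation -/

namespace RealRAM

/-- The written vertices are the images of the templates under `coords e f`, whose positive
determinant makes them counterclockwise polygons again. A template of weight `w` on `D i`, or of
weight `0` when that set is empty, contributes the same function. -/
theorem Output.exists_piecewise {m : Memory} {sz M : ℕ} {w : ℝ} {e f : ℝ × ℝ} {D : ℕ → Set (ℝ × ℝ)}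
    (h : Output m sz M w e f D) (hpos : 0 < cross e f)
    (h0 : ∀ a ∈ [7, 8, 9, 10, 11], ∀ i, m.real a i = 0) :
    ∃ ψ : PiecewiseQuadratic, ψ.count = M ∧ HoldsOutput m ψ ∧ (∀ i, (ψ.polygon i).size ≤ sz) ∧
      ∀ z, ψ.eval (coords e f z) = w * ∑ i ∈ Finset.range M, (D i).indicator 1 z := by
  obtain ⟨h2, -, hE⟩ := h
  -- Needed by `choose!`, which extends the choice of polygons to all indices.
  have : Nonempty ConvexPolygon := ⟨.rect 0 1 0 1 one_pos one_pos⟩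
  choose! Q hsz h3 hv hw using hE
  refine ⟨⟨M, fun i => (Q i).map e f hpos, fun i => ⟨0, 0, 0, 0, 0, m.real 12 i⟩⟩, rfl,
    ⟨h2, fun i => ?_⟩, fun i => (hsz i i.2).le, fun z => ?_⟩
  · have hoff : ∑ k ∈ Finset.Iio i, ((Q k).map e f hpos).size = i * sz := by
      rw [Finset.sum_congr rfl fun (k : Fin M) _ => show ((Q k).map e f hpos).size = sz from hsz k k.2,
        Finset.sum_const, Fin.card_Iio, smul_eq_mul]
    refine ⟨(h3 i i.2).trans (hsz i i.2).symm, fun j => ?_, h0 7 (by simp) i, h0 8 (by simp) i,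
      h0 9 (by simp) i, h0 10 (by simp) i, h0 11 (by simp) i, rfl⟩
    have hj : (j : ℕ) < (Q i).size := j.2
    have := hv i i.2 j (by rw [← hsz i i.2]; exact hj)
    rw [(Q i).cyc_of_lt hj] at this
    rw [hoff]
    exact this
  · rw [PiecewiseQuadratic.eval, Finset.mul_sum, Finset.sum_range]
    refine Finset.sum_congr rfl fun i _ => ?_
    rw [← hw i i.2]
    have hm := (Q i).coords_mem_map hpos z
    by_cases hz : z ∈ (Q i).region
    · rw [Set.indicator_of_mem hz, Set.indicator_of_mem (hm.2 hz)]
      simp [Quadratic.eval]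
    · rw [Set.indicator_of_notMem hz, Set.indicator_of_notMem fun h => hz (hm.1 h)]
      simp

theorem sum_range_mul_self {N : ℕ} (g : ℕ → ℕ → ℝ) :
    ∑ i ∈ Finset.range (N * N), g (i / N) (i % N) =
      ∑ k ∈ Finset.range N, ∑ l ∈ Finset.range N, g k l := by
  rw [Finset.sum_range, ← finProdFinEquiv.sum_comp, Fintype.sum_prod_type, Finset.sum_range]
  refine Finset.sum_congr rfl fun k _ => ?_
  rw [Finset.sum_range]
  refine Finset.sum_congr rfl fun l _ => ?_
  have hN : 0 < N := k.pos
  simp [finProdFinEquiv_apply_val, Nat.add_mul_div_left _ _ hN, Nat.div_eq_of_lt l.2,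
    Nat.mod_eq_of_lt l.2]

/-- The link between the two views of one incidence: the translation lies in the polygon of a grid
point exactly when that grid point, shifted by `β t` in mode `1`, lies in the intersection. -/
theorem coords_mem_hits {A B : ConvexPolygon} {α β : ℝ × ℝ} (hpos : 0 < cross α β)
    (hpos' : 0 < cross β (-α)) (mode : ℕ) (a b : ℝ) (t : ℝ × ℝ) :
    coords α β t ∈ hits (A.map α β hpos) (B.map β (-α) hpos') mode a b ↔
      uncoords α β (a, b + mode * dot β t) ∈ common A B t := by
  have hc := coords_uncoords hpos (a, b + mode * dot β t)
  generalize uncoords α β (a, b + mode * dot β t) = p at *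
  have h1 : dot α p = a := congrArg Prod.fst hc
  have h2 : dot β p = b + mode * dot β t := congrArg Prod.snd hc
  have h3 : coords β (-α) (p - t) = (b + mode * dot β t - dot β t, dot α t - a) := by
    rw [← h2, ← h1]
    simp only [coords, dot, Prod.fst_sub, Prod.snd_sub, Prod.fst_neg, Prod.snd_neg]
    ext <;> simp only <;> ring
  have e1 := A.coords_mem_map hpos p
  have e2 := B.coords_mem_map hpos' (p - t)
  rw [hc] at e1
  rw [h3] at e2
  exact and_congr e1 e2

theorem abs_overlap_sub_hits_le {A B : ConvexPolygon} {α β : ℝ × ℝ} {mode N : ℕ} {a₀ b₀ ε : ℝ}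
    (h : Suitable A B α β mode) (ha : IsMinimum A α a₀)
    (hb : mode = 0 ∧ IsMinimum A β b₀ ∨ mode = 1 ∧ IsMinimum B β b₀) (hN : 0 < N)
    (hNε : 128 ≤ N * ε) (hpos' : 0 < cross β (-α)) (t : ℝ × ℝ) :
    |overlap A B t - 1 / ((N : ℝ) ^ 2 * cross α β) * ∑ i ∈ Finset.range (N * N),
      (hits (A.map α β h.pos) (B.map β (-α) hpos') mode (sampleAt a₀ N (i / N))
        (sampleAt b₀ N (i % N))).indicator 1 (coords α β t)| ≤ ε * maxOverlap A B := by
  have hα : ∀ p ∈ common A B t, a₀ ≤ dot α p ∧ dot α p ≤ a₀ + 1 := fun p hp =>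
    (h.width.bounds ha).1 p hp.1
  -- In mode `1` the window for `β` is attached to `B` and travels with the translation.
  have hβ : ∀ p ∈ common A B t, b₀ + mode * dot β t ≤ dot β p ∧
      dot β p ≤ b₀ + mode * dot β t + 1 := by
    intro p hp
    rcases h.width' with ⟨rfl, hw⟩ | ⟨rfl, hw⟩
    · have := (hw.bounds (hb.resolve_right (by simp)).2).1 p hp.1
      simpa using this
    · have := (hw.bounds (hb.resolve_left (by simp)).2).1 (p - t) hp.2
      have hd : dot β (p - t) = dot β p - dot β t := by
        simp only [dot, Prod.fst_sub, Prod.snd_sub]; ring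
      rw [hd] at this
      rw [Nat.cast_one, one_mul]
      constructor <;> linarith
  have key := abs_overlap_sub_sample_le A B t h.pos hα hβ hN
  have hsum : ∑ i ∈ Finset.range (N * N), (hits (A.map α β h.pos) (B.map β (-α) hpos') mode
        (sampleAt a₀ N (i / N)) (sampleAt b₀ N (i % N))).indicator (1 : ℝ × ℝ → ℝ) (coords α β t) =
      ∑ k ∈ Finset.range N, ∑ l ∈ Finset.range N, (common A B t).indicator 1 (uncoords α β
        (a₀ + (k + 1 / 2) / N, b₀ + mode * dot β t + (l + 1 / 2) / N)) := by
    rw [sum_range_mul_self fun k l => (hits (A.map α β h.pos) (B.map β (-α) hpos') mode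
        (sampleAt a₀ N k) (sampleAt b₀ N l)).indicator (1 : ℝ × ℝ → ℝ) (coords α β t)]
    refine Finset.sum_congr rfl fun k _ => Finset.sum_congr rfl fun l _ => ?_
    have hiff := coords_mem_hits (A := A) (B := B) h.pos hpos' mode (sampleAt a₀ N k)
      (sampleAt b₀ N l) t
    have e : sampleAt b₀ N l + mode * dot β t = b₀ + mode * dot β t + (l + 1 / 2) / N := by
      rw [sampleAt]; ring
    rw [e] at hiff
    classical
    simp only [Set.indicator_apply, hiff]
    rfl
  rw [hsum]
  refine key.trans ?_
  obtain ⟨c, c', hbox⟩ := h.box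
  have hmax := (le_maxOverlap_of_box h.pos hbox).trans (overlap_le_maxOverlap A B (c - c'))
  have hd := h.pos
  have hN' : (0 : ℝ) < N := by exact_mod_cast hN
  have hε : 0 < ε := by by_contra! hc; nlinarith
  -- The sampling error `2` times the factor `64` of the common box is the `128` used to choose `N`.
  calc 2 / (N * cross α β) = 128 / N * (1 / (64 * cross α β)) := by field_simp; norm_num
    _ ≤ ε * maxOverlap A B := by
      refine mul_le_mul ?_ hmax (by positivity) hε.le
      rw [div_le_iff₀ hN']; linarith

/-- The determinant is `s * s / cross α β`; exchanging the polygons negates both rows, which does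
not reverse orientation. -/
theorem cross_inverseRow {s : ℝ} (hs : s * s = 1) {α β : ℝ × ℝ} (h : 0 < cross α β) :
    0 < cross (inverseRow₁ s α β) (inverseRow₂ s α β) := by
  have : cross (inverseRow₁ s α β) (inverseRow₂ s α β) = s * s / cross α β := by
    have h' := h.ne'
    simp only [inverseRow₁, inverseRow₂]
    generalize hd : cross α β = d at *
    rw [cross] at hd ⊢
    field_simp
    rw [← hd]; ring
  rw [this, hs]
  positivity

theorem coords_inverseRow {s : ℝ} (hs : s * s = 1) {α β : ℝ × ℝ} (h : 0 < cross α β) (t : ℝ × ℝ) :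
    coords (inverseRow₁ s α β) (inverseRow₂ s α β) (coords α β (s • t)) = t := by
  have h' := h.ne'
  generalize hd : cross α β = d at *
  simp only [inverseRow₁, inverseRow₂, coords, dot, hd, Prod.smul_fst, Prod.smul_snd, smul_eq_mul]
  rw [cross] at hd
  ext
  · simp only
    field_simp
    linear_combination t.1 * s * s * hd + d * t.1 * hs
  · simp only
    field_simp
    linear_combination t.2 * s * s * hd + d * t.2 * hs

theorem Ordered.mul_self {X Y A B : ConvexPolygon} {s : ℝ} (h : Ordered X Y A B s) : s * s = 1 := by
  rcases h with ⟨-, -, rfl⟩ | ⟨-, -, rfl⟩ <;> norm_num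

theorem Ordered.overlap_eq {X Y A B : ConvexPolygon} {s : ℝ} (h : Ordered X Y A B s) (t : ℝ × ℝ) :
    overlap X Y t = overlap A B (s • t) := by
  rcases h with ⟨rfl, rfl, rfl⟩ | ⟨rfl, rfl, rfl⟩
  · rw [one_smul]
  · rw [neg_one_smul, overlap_swap]

theorem Ordered.maxOverlap_le {X Y A B : ConvexPolygon} {s : ℝ} (h : Ordered X Y A B s) :
    maxOverlap A B ≤ maxOverlap X Y := by
  refine ciSup_le fun t => ?_
  have : overlap A B t = overlap X Y (s • t) := by
    rw [h.overlap_eq, smul_smul, h.mul_self, one_smul]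
  rw [this]
  exact overlap_le_maxOverlap X Y _

end RealRAM

theorem mainTheorem2 :
    ∃ (prog : RealRAM.Program) (C : ℝ), 0 < C ∧
      ∀ (X Y : ConvexPolygon) (ε : ℝ), 0 < ε → ε < 1 →
        ∃ (T : ℕ) (m : RealRAM.Memory) (ψ : PiecewiseQuadratic) (ρ : ℕ),
          RealRAM.Runs prog (RealRAM.input X Y ε) T m ∧
          RealRAM.HoldsOutput m ψ ∧
          IsApproximation X Y ε ψ.count ρ ψ.polygon ψ.eval ∧
          (T : ℝ) ≤ C * ((X.size + Y.size : ℕ) : ℝ) / ε ^ 2 ∧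
          (ψ.count : ℝ) ≤ C / ε ^ 2 ∧
          (ρ : ℝ) ≤ C * ((X.size + Y.size : ℕ) : ℝ) / ε ^ 2 := by
  refine ⟨RealRAM.algorithm, 2000 * 129 ^ 2, by norm_num, fun X Y ε hε h1 => ?_⟩
  obtain ⟨N, hN, hN1, hN2, T, m, hrun, hT, A, B, s, α, β, mode, a₀, b₀, sz, hpos, hpos', ho, hsuit,
    ha, hb, hsz, h0, hout⟩ := RealRAM.algorithm_spec X Y hε h1
  have hs := ho.mul_self
  obtain ⟨ψ, hcount, hholds, hsize, heval⟩ :=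
    hout.exists_piecewise (RealRAM.cross_inverseRow hs hpos) h0
  have hNN : (N : ℝ) * N ≤ 129 ^ 2 / ε ^ 2 := by
    rw [le_div_iff₀ (by positivity)]
    have : 0 ≤ (N : ℝ) * ε := by positivity
    nlinarith
  have hq : 1 ≤ 1 / ε ^ 2 := by
    rw [le_div_iff₀ (by positivity), one_mul]
    exact pow_le_one₀ hε.le h1.le
  have hS : (0 : ℝ) ≤ ((X.size + Y.size : ℕ) : ℝ) := Nat.cast_nonneg _
  refine ⟨T, m, ψ, sz, hrun, hholds, ⟨fun t => ?_, hsize, ψ.quadratic_on_faces⟩, ?_, ?_, ?_⟩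
  · have hle := (RealRAM.abs_overlap_sub_hits_le hsuit ha hb hN hN1 hpos' (s • t)).trans
      (mul_le_mul_of_nonneg_left ho.maxOverlap_le hε.le)
    -- The estimate for `A` and `B` at `s • t` becomes one for `X` and `Y` at `t`: the output map
    -- inverts the coordinates and, as `s * s = 1`, also the sign.
    rw [← heval, RealRAM.coords_inverseRow hs hpos, ← ho.overlap_eq] at hle
    exact hle
  · calc (T : ℝ) ≤ ((2000 * (N * N * (X.size + Y.size)) : ℕ) : ℝ) := by exact_mod_cast hT
      _ = 2000 * (N * N) * ((X.size + Y.size : ℕ) : ℝ) := by push_cast; ring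
      _ ≤ 2000 * (129 ^ 2 / ε ^ 2) * ((X.size + Y.size : ℕ) : ℝ) := by gcongr
      _ = _ := by ring
  · rw [hcount, Nat.cast_mul]
    refine hNN.trans ?_
    gcongr
    norm_num
  · calc (sz : ℝ) ≤ ((X.size + Y.size : ℕ) : ℝ) := by exact_mod_cast hsz
      _ ≤ ((X.size + Y.size : ℕ) : ℝ) * (2000 * 129 ^ 2 * (1 / ε ^ 2)) :=
        le_mul_of_one_le_right hS (by linarith)
      _ = _ := by ring
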